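/- Let $G$ be a finitely generated group, let $H$ be a finite group, and let $i_1,i_2\colon H\to G$ be injective homomorphisms whose images are almost normal in $G$, i.e. the normalizers of $i_1(H)$ and of $i_2(H)$ have finite index in $G$. Let $G*_{i_1,i_2}$ be the HNN extension, i.e. the quotient of the free product $G*\langle t\rangle$, with $\langle t\rangle\cong\mathbb{Z}$, by the relations $i_1(h)=t\,i_2(h)\,t^{-1}$, $h\in H$. If $G$ is flexibly $HS$-stable, then $G*_{i_1,i_2}$ is flexibly $HS$-stable; and if $G$ is flexibly $P$-stable, then $G*_{i_1,i_2}$ is flexibly $P$-stable. Here a group $\Gamma$ is flexibly $HS$-stable if for all nonzero finite-dimensional complex Hilbert spaces $X_n$ and all maps $\varphi_n\colon\Gamma\to U(X_n)$ ($n\in\mathbb{N}$) with $\|\varphi_n(a)\varphi_n(b)-\varphi_n(ab)\|_{HS,X_n}\to0$ for all $a,b\in\Gamma$, there are finite-dimensional Hilbert spaces $Y_n\supseteq X_n$ and homomorphisms $\psi_n\colon\Gamma\to U(Y_n)$ such that $\|\varphi_n(a)-p_n\psi_n(a)p_n|_{X_n}\|_{HS,X_n}\to0$ for all $a\in\Gamma$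 and $\dim Y_n/\dim X_n\to1$, where $p_n$ is the orthogonal projection of $Y_n$ onto $X_n$ and $\|A\|_{HS,X}=\bigl(\tfrac1{\dim X}\operatorname{Tr}(A^*A)\bigr)^{1/2}$. A group $\Gamma$ is flexibly $P$-stable if for all nonempty finite sets $X_n$ and all maps $\varphi_n\colon\Gamma\to\operatorname{Sym}(X_n)$ ($n\in\mathbb{N}$) with $\frac1{|X_n|}\#\{x\in X_n:\varphi_n(a)\varphi_n(b)x\ne\varphi_n(ab)x\}\to0$ for all $a,b\in\Gamma$, there are finite sets $Y_n\supseteq X_n$ and homomorphisms $\psi_n\colon\Gamma\to\operatorname{Sym}(Y_n)$ such that $\frac1{|X_n|}\#\{x\in X_n:\varphi_n(a)x\ne\psi_n(a)x\}\to0$ for all $a\in\Gamma$ and $|Y_n|/|X_n|\to1$. -/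

import Mathlib

open Filter Topology

/-- The normalized Hilbert–Schmidt norm `‖A‖_HS = Tr(A* A) ^ (1/2)` of an operator on a
finite-dimensional Hilbert space `X`, where `Tr` is the usual trace divided by `dim X`. -/
noncomputable def hsNorm {X : Type*} [NormedAddCommGroup X] [InnerProductSpace ℂ X]
    [FiniteDimensional ℂ X] (A : X →ₗ[ℂ] X) : ℝ :=
  Real.sqrt
    ((LinearMap.trace ℂ X (LinearMap.adjoint A ∘ₗ A)).re / (Module.finrank ℂ X : ℝ))

/-- A unitary of `X` (a linear isometric automorphism), regarded as an operator. -/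
def unitaryOp {X : Type*} [NormedAddCommGroup X] [InnerProductSpace ℂ X]
    (u : X ≃ₗᵢ[ℂ] X) : X →ₗ[ℂ] X :=
  u.toLinearEquiv.toLinearMap

/-- The compression `p A p` of an operator `A` on `Y` to a subspace `X ⊆ Y`, as an operator on `X`.
The inclusion is the isometry `ι`, and its adjoint is the orthogonal projection onto `X`. -/
noncomputable def compression {X Y : Type*} [NormedAddCommGroup X] [InnerProductSpace ℂ X]
    [FiniteDimensional ℂ X] [NormedAddCommGroup Y] [InnerProductSpace ℂ Y]
    [FiniteDimensional ℂ Y] (ι : X →ₗᵢ[ℂ] Y) (A : Y →ₗ[ℂ] Y) : X →ₗ[ℂ] X :=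
  LinearMap.adjoint ι.toLinearMap ∘ₗ A ∘ₗ ι.toLinearMap

/-- Flexible Hilbert–Schmidt stability: every asymptotic homomorphism to unitary groups of nonzero
finite-dimensional Hilbert spaces `X n` is asymptotically the compression of homomorphisms to the
unitary groups of Hilbert spaces `Y n ⊇ X n` with `dim (Y n) / dim (X n) → 1`. -/
def FlexiblyHSStable (G : Type*) [Group G] : Prop :=
  ∀ (X : ℕ → Type) [∀ n, NormedAddCommGroup (X n)] [∀ n, InnerProductSpace ℂ (X n)]
    [∀ n, FiniteDimensional ℂ (X n)] [∀ n, Nontrivial (X n)]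
    (φ : ∀ n, G → (X n ≃ₗᵢ[ℂ] X n)),
    (∀ a b : G, Tendsto
      (fun n => hsNorm (unitaryOp (φ n a * φ n b) - unitaryOp (φ n (a * b)))) atTop (𝓝 0)) →
    ∃ (Y : ℕ → Type) (_ : ∀ n, NormedAddCommGroup (Y n)) (_ : ∀ n, InnerProductSpace ℂ (Y n))
      (_ : ∀ n, FiniteDimensional ℂ (Y n)) (ι : ∀ n, X n →ₗᵢ[ℂ] Y n)
      (ψ : ∀ n, G →* (Y n ≃ₗᵢ[ℂ] Y n)),
      (∀ a : G, Tendsto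
        (fun n => hsNorm (unitaryOp (φ n a) - compression (ι n) (unitaryOp (ψ n a))))
        atTop (𝓝 0)) ∧
      Tendsto (fun n => (Module.finrank ℂ (Y n) : ℝ) / (Module.finrank ℂ (X n) : ℝ))
        atTop (𝓝 1)

/-- The proportion of the points of a finite set `X` at which two maps differ. For permutations of
`X` this is the normalized Hamming distance. -/
noncomputable def hammDist {X Z : Type*} (f g : X → Z) : ℝ :=
  (Nat.card {x : X // f x ≠ g x} : ℝ) / (Nat.card X : ℝ)

/-- Flexible stability in permutations: every asymptotic homomorphism to symmetric groups of
nonempty finite sets `X n` is asymptotically given, at most points of `X n`, by homomorphisms to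
the symmetric groups of finite sets `Y n ⊇ X n` with `|Y n| / |X n| → 1`.
The inclusion of `X n` in `Y n` is the injection `ι n`. -/
def FlexiblyPStable (G : Type*) [Group G] : Prop :=
  ∀ (X : ℕ → Type) [∀ n, Finite (X n)] [∀ n, Nonempty (X n)]
    (φ : ∀ n, G → Equiv.Perm (X n)),
    (∀ a b : G, Tendsto
      (fun n => hammDist (φ n a * φ n b : Equiv.Perm (X n)) (φ n (a * b))) atTop (𝓝 0)) →
    ∃ (Y : ℕ → Type) (_ : ∀ n, Finite (Y n)) (ι : ∀ n, X n ↪ Y n)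
      (ψ : ∀ n, G →* Equiv.Perm (Y n)),
      (∀ a : G, Tendsto
        (fun n => hammDist (fun x => ι n (φ n a x)) (fun x => ψ n a (ι n x)))
        atTop (𝓝 0)) ∧
      Tendsto (fun n => (Nat.card (Y n) : ℝ) / (Nat.card (X n) : ℝ)) atTop (𝓝 1)

/-- A subgroup is almost normal if its normalizer has finite index, equivalently if it has only
finitely many conjugates. -/
def IsAlmostNormal {G : Type*} [Group G] (K : Subgroup G) : Prop :=
  (Subgroup.normalizer (K : Set G)).FiniteIndex

/-- The HNN extension `G *_{i₁, i₂}`: the quotient of `G * ⟨t⟩` by the relations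
`i₁ h = t (i₂ h) t⁻¹` for `h : H`. -/
abbrev HNNOfEmbeddings {G H : Type*} [Group G] [Group H] (i₁ i₂ : H →* G)
    (h₁ : Function.Injective i₁) (h₂ : Function.Injective i₂) : Type _ :=
  HNNExtension G i₂.range i₁.range
    ((MonoidHom.ofInjective h₂).symm.trans (MonoidHom.ofInjective h₁))

/-! ### Residual finiteness of finitely generated linear groups -/

/-! Let φ_n be an asymptotic homomorphism of the HNN extension. Flexible stability of `G` replaces
its restriction to `G` by genuine actions ψ_n on slightly larger sets or spaces Y_n. What is missing
is an exact image of `t`: a permutation or unitary conjugating ψ_n ∘ `i₂` to ψ_n ∘ `i₁` and close to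
φ_n(`t`), which does this only approximately.

Actions of the finite group `H` are classified by numbers: how many points have a given stabilizer
(`exists_equivariant_equiv`), or the character (`exists_equivariant_linearEquiv`). The difference of
these invariants for the two restrictions is the defect; approximate conjugacy makes it o(|X_n|),
respectively o(dim X_n). Once the defect is zero, the approximate conjugator can be made exact: a
permutation is kept where it is already equivariant and completed orbit by orbit, and an operator is
averaged over `H` and replaced by its unitary polar part (`exists_unitary_intertwiner_near`).

It remains to cancel the defect by adding a `G`-action of negligible size. Defects add under
disjoint or direct sums, and nonzero ones are bounded away from zero. If they form a group, it is
discrete in a finite-dimensional space, and `exists_cost_le_mul_norm` realizes each defect at a cost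
linear in its norm. Negatives come from a finite `G`-set on which `H` acts freely through both
embeddings: with its help every action embeds in one of zero defect, and the complement has the
opposite defect (`exists_neg_stabDefect`, `exists_neg_charDefect`).

Freeness can only be asked modulo the elements of `H` that φ_n makes asymptotically trivial, a
condition that is the same for `i₁` and `i₂` because of `t`. By almost normality these have finitely
many conjugates in `G`, so their common fixed points or vectors form an invariant part of almost
full size. Making ψ_n trivial elsewhere, these elements act exactly trivially. Every other element
of `H` is nontrivial in some corrected ψ_n, hence in a finite quotient of `G` killing the former
ones. For permutations this is immediate; for unitaries it is Malcev's theorem, where finite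
generation of `G` enters. The resulting free `G`-set does not depend on n, so the constants are
uniform. -/

theorem isJacobsonRing_int : IsJacobsonRing ℤ := by
  rw [isJacobsonRing_iff_prime_eq]
  intro P hP
  by_cases hbot : P = ⊥
  · subst hbot
    refine le_antisymm (fun x hx => ?_) Ideal.le_jacobson
    -- If x lies in the Jacobson radical, x * x + 1 is a unit, so x² + 1 = ±1 and x = 0.
    have h := Ideal.mem_jacobson_bot.mp hx x
    rw [Int.isUnit_iff] at h
    rw [Ideal.mem_bot]
    rcases h with h | h <;> nlinarith [mul_self_nonneg x]
  · have := hP.isMaximal hbot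
    exact Ideal.jacobson_eq_self_of_isMaximal

/-- By the Nullstellensatz over the Jacobson ring ℤ, the field is a finite ℤ-module. Characteristic
zero would make it integral over a copy of ℤ and so force ℤ to be a field; in characteristic p it is
finitely generated torsion. -/
theorem finite_of_field_of_finiteType_int (k : Type*) [Field k] [inst : Algebra ℤ k]
    [Algebra.FiniteType ℤ k] :
    Finite k := by
  obtain rfl : inst = Ring.toIntAlgebra k := Subsingleton.elim _ _
  have := isJacobsonRing_int
  have hfin : Module.Finite ℤ k := finite_of_finite_type_of_isJacobsonRing ℤ k
  obtain ⟨p, hp⟩ := CharP.exists k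
  rcases Nat.eq_zero_or_pos p with rfl | hpos
  · exfalso
    have : CharZero k := CharP.charP_to_charZero k
    have hinj : Function.Injective (algebraMap ℤ k) := RingHom.injective_int _
    have hint : Algebra.IsIntegral ℤ k := inferInstance
    exact Int.not_isField (isField_of_isIntegral_of_isField hinj
      (Field.toIsField k))
  · apply Module.finite_of_fg_torsion
    intro x
    refine ⟨⟨(p : ℤ), mem_nonZeroDivisors_of_ne_zero (by exact_mod_cast hpos.ne')⟩, ?_⟩
    simp [Submonoid.smul_def]

/-- Nonzero elements of finitely generated domains survive in a finite field. -/
theorem exists_ringHom_finite_field_ne_zero.{u} {A : Type u} [CommRing A] [IsDomain A]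
    [Algebra.FiniteType ℤ A] {a : A} (ha : a ≠ 0) :
    ∃ (k : Type u) (_ : Field k) (_ : Finite k) (f : A →+* k), f a ≠ 0 := by
  -- Once inverted, `a` stays nonzero modulo every maximal ideal.
  let B := Localization.Away a
  have hinj : Function.Injective (algebraMap A B) :=
    IsLocalization.injective B (powers_le_nonZeroDivisors_of_noZeroDivisors ha)
  have hB : Nontrivial B := hinj.nontrivial
  have : Algebra.FiniteType A B := IsLocalization.finiteType_of_monoid_fg (Submonoid.powers a) B
  have : Algebra.FiniteType ℤ B := Algebra.FiniteType.trans (S := A) inferInstance inferInstance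
  obtain ⟨m, hm⟩ := Ideal.exists_maximal B
  let _ := Ideal.Quotient.field m
  have : Algebra.FiniteType ℤ (B ⧸ m) := Algebra.FiniteType.of_surjective
    (Ideal.Quotient.mkₐ ℤ m) (Ideal.Quotient.mkₐ_surjective ℤ m)
  exact ⟨B ⧸ m, inferInstance, @finite_of_field_of_finiteType_int _ _ _ this,
    (Ideal.Quotient.mk m).comp (algebraMap A B),
    ((IsLocalization.Away.algebraMap_isUnit a).map (Ideal.Quotient.mk m)).ne_zero⟩

theorem finiteIndex_ker_of_finite_monoid {G M : Type*} [Group G] [Monoid M] [Finite M]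
    (f : G →* M) : f.ker.FiniteIndex := by
  have hker : f.ker = f.toHomUnits.ker := by
    ext x
    simp [MonoidHom.mem_ker]
  rw [hker]
  infer_instance

/-- Malcev: the image of a finitely generated group in a linear group over a field is residually
finite. -/
theorem exists_normal_finiteIndex_of_matrix_ne_one {G n F : Type*} [Group G] [Group.FG G]
    [Fintype n] [DecidableEq n] [Field F] (ρ : G →* Matrix n n F) {g : G} (hg : ρ g ≠ 1) :
    ∃ N : Subgroup G, N.Normal ∧ N.FiniteIndex ∧ g ∉ N ∧ ∀ x, ρ x = 1 → x ∈ N := by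
  classical
  obtain ⟨s, hs⟩ := (Group.fg_def.mp ‹_› : (⊤ : Subgroup G).FG)
  -- Entries of the inverses are included because the generated ring must contain the entries of ρ
  -- at every element of the group.
  let T : Finset F := s.biUnion fun x => Finset.univ.biUnion fun i => Finset.univ.biUnion
    fun j => {ρ x i j, ρ x⁻¹ i j}
  let A := Algebra.adjoin ℤ (T : Set F)
  have hA : Algebra.FiniteType ℤ A := (Subalgebra.fg_iff_finiteType _).mp
    (Subalgebra.fg_adjoin_finset T)
  have hmul : ∀ x y, (∀ i j, ρ x i j ∈ A) → (∀ i j, ρ y i j ∈ A) → ∀ i j, ρ (x * y) i j ∈ A := by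
    intro x y hx hy i j
    rw [map_mul, Matrix.mul_apply]
    exact sum_mem fun k _ => mul_mem (hx i k) (hy k j)
  have hentry : ∀ x, (∀ i j, ρ x i j ∈ A) ∧ ∀ i j, ρ x⁻¹ i j ∈ A := by
    intro x
    have hx : x ∈ Subgroup.closure (s : Set G) := hs ▸ Subgroup.mem_top x
    induction hx using Subgroup.closure_induction with
    | mem x hx =>
      constructor <;> intro i j <;> apply Algebra.subset_adjoin <;>
        simp only [T, Finset.coe_biUnion, Set.mem_iUnion, Finset.mem_coe, Finset.coe_insert,
          Finset.coe_singleton] <;> exact ⟨x, hx, i, Finset.mem_univ _, j, Finset.mem_univ _, by simp⟩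
    | one =>
      have : ∀ i j, ρ 1 i j ∈ A := by
        intro i j
        rw [map_one, Matrix.one_apply]
        split_ifs
        exacts [one_mem _, zero_mem _]
      simpa using this
    | mul x y _ _ hx hy =>
      refine ⟨hmul x y hx.1 hy.1, ?_⟩
      rw [mul_inv_rev]
      exact hmul _ _ hy.2 hx.2
    | inv x _ hx => exact ⟨hx.2, by simpa using hx.1⟩
  let ρA : G →* Matrix n n A :=
    { toFun := fun x => Matrix.of fun i j => ⟨ρ x i j, (hentry x).1 i j⟩
      map_one' := by
        ext i j
        simp [Matrix.one_apply, apply_ite]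
      map_mul' := by
        intro x y
        ext i j
        simp [Matrix.mul_apply] }
  have hne : ∃ i j, ρA g i j - (1 : Matrix n n A) i j ≠ 0 := by
    by_contra! hcon
    apply hg
    ext i j
    have h1 := congrArg (Subtype.val) (sub_eq_zero.mp (hcon i j))
    simpa [ρA, Matrix.one_apply, apply_ite] using h1
  obtain ⟨i, j, hij⟩ := hne
  obtain ⟨k, _, _, f, hf⟩ := exists_ringHom_finite_field_ne_zero hij
  let θ : G →* Matrix n n k := (f.mapMatrix (m := n)).toMonoidHom.comp ρA
  have hfin : Finite (Matrix n n k) := inferInstanceAs (Finite (n → n → k))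
  refine ⟨θ.ker, inferInstance, finiteIndex_ker_of_finite_monoid θ, ?_, ?_⟩
  · intro hmem
    apply hf
    have h1 : (ρA g).map f = 1 := hmem
    have h2 := congrFun (congrFun h1 i) j
    rw [map_sub, ← Matrix.map_apply (f := f), h2]
    simp [Matrix.one_apply, apply_ite f]
  · intro x hx
    have : ρA x = 1 := by
      ext i j
      simp [ρA, hx, Matrix.one_apply, apply_ite]
    rw [MonoidHom.mem_ker, MonoidHom.comp_apply, this, map_one]

/-! ### Bounded generation of discrete subgroups -/

/-- In a discrete subgroup of a finite-dimensional space, a subadditive cost that is finite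
everywhere is linearly bounded by the norm. -/
theorem exists_cost_le_mul_norm {E : Type*} [NormedAddCommGroup E] [NormedSpace ℝ E]
    [FiniteDimensional ℝ E] (Λ : AddSubgroup E) (hdisc : ∀ v ∈ Λ, v ≠ 0 → 1 ≤ ‖v‖)
    (P : E → ℕ → Prop) (hzero : P 0 0)
    (hadd : ∀ v w a b, P v a → P w b → P (v + w) (a + b)) (hex : ∀ v ∈ Λ, ∃ c, P v c) :
    ∃ C : ℝ, ∀ v ∈ Λ, ∃ c : ℕ, P v c ∧ (c : ℝ) ≤ C * ‖v‖ := by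
  classical
  -- The basis of the span is taken inside Λ, so that integral combinations of it have a cost
  -- controlled by their coefficients.
  obtain ⟨b, hbsub, hbspan, hbli⟩ := exists_linearIndependent ℝ (Λ : Set E)
  have hbfin : Finite b := hbli.finite
  let _ := Fintype.ofFinite b
  let V := Submodule.span ℝ b
  let B : Module.Basis b ℝ (Submodule.span ℝ (Set.range ((↑) : b → E))) := Module.Basis.span hbli
  have hmem : ∀ v ∈ Λ, v ∈ Submodule.span ℝ (Set.range ((↑) : b → E)) := by
    intro v hv
    rw [Subtype.range_coe, hbspan]
    exact Submodule.subset_span hv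
  obtain ⟨M, hM0, hM⟩ : ∃ M : ℝ, 0 ≤ M ∧ ∀ v (hv : v ∈ Λ) (i : b),
      |B.repr ⟨v, hmem v hv⟩ i| ≤ M * ‖v‖ := by
    let L := LinearMap.toContinuousLinearMap B.equivFun.toLinearMap
    refine ⟨‖L‖, ContinuousLinearMap.opNorm_nonneg L, fun v hv i => ?_⟩
    have h1 := L.le_opNorm ⟨v, hmem v hv⟩
    have h2 := norm_le_pi_norm (L ⟨v, hmem v hv⟩) i
    exact h2.trans h1
  -- witnesses for the basis vectors and their negatives
  have hb : ∀ i : b, ∃ c, P i c := fun i => hex _ (hbsub i.2)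
  have hb' : ∀ i : b, ∃ c, P (-i) c := fun i => hex _ (Λ.neg_mem (hbsub i.2))
  choose c₁ hc₁ using hb
  choose c₂ hc₂ using hb'
  have hnsmul : ∀ (m : ℕ) v a, P v a → P (m • v) (m * a) := by
    intro m v a h
    induction m with
    | zero => simpa using hzero
    | succ m ih => simpa [add_smul, add_mul] using hadd _ _ _ _ ih h
  have hzsmul : ∀ (m : ℤ) (i : b), ∃ c : ℕ, P (m • (i : E)) c ∧
      (c : ℝ) ≤ |(m : ℝ)| * (c₁ i + c₂ i) := by
    intro m i
    rcases Int.eq_nat_or_neg m with ⟨k, rfl | rfl⟩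
    · refine ⟨k * c₁ i, by simpa using hnsmul k _ _ (hc₁ i), ?_⟩
      push_cast
      rw [Nat.abs_cast]
      gcongr
      simp
    · refine ⟨k * c₂ i, by simpa using hnsmul k _ _ (hc₂ i), ?_⟩
      push_cast
      rw [abs_neg, Nat.abs_cast]
      gcongr
      simp
  have hsum : ∀ (s : Finset b) (m : b → ℤ), ∃ c : ℕ, P (∑ i ∈ s, m i • (i : E)) c ∧
      (c : ℝ) ≤ ∑ i ∈ s, |(m i : ℝ)| * (c₁ i + c₂ i) := by
    intro s m
    induction s using Finset.induction_on with
    | empty => exact ⟨0, by simpa using hzero, by simp⟩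
    | insert i s hi ih =>
      obtain ⟨c, hc, hc'⟩ := ih
      obtain ⟨d, hd, hd'⟩ := hzsmul (m i) i
      refine ⟨d + c, ?_, ?_⟩
      · rw [Finset.sum_insert hi]
        exact hadd _ _ _ _ hd hc
      · rw [Finset.sum_insert hi]
        push_cast
        linarith
  -- finitely many elements of bounded norm
  let R : ℝ := ∑ i : b, ‖(i : E)‖
  have hfin : {v : E | v ∈ Λ ∧ ‖v‖ ≤ R}.Finite := by
    have hsep : ∀ v ∈ Λ, ∀ w ∈ Λ, v ≠ w → 1 ≤ dist v w := fun v hv w hw hvw => by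
      rw [dist_eq_norm]
      exact hdisc _ (Λ.sub_mem hv hw) (sub_ne_zero.mpr hvw)
    have hd : IsDiscrete (Λ : Set E) :=
      ⟨DiscreteTopology.of_forall_le_dist one_pos fun v w hvw =>
        hsep v v.2 w w.2 fun h => hvw (Subtype.ext h)⟩
    have hcl : IsClosed (Λ : Set E) :=
      Metric.isClosed_of_pairwise_le_dist one_pos fun v hv w hw hvw => hsep v hv w hw hvw
    refine (Metric.finite_isBounded_inter_isClosed hd
      (Metric.isBounded_closedBall (x := (0 : E)) (r := R)) hcl).subset ?_
    rintro v ⟨h1, h2⟩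
    exact ⟨by simpa using h2, h1⟩
  have hfinc : ∃ c₀ : ℕ, ∀ v ∈ Λ, ‖v‖ ≤ R → ∃ c, P v c ∧ c ≤ c₀ := by
    have : ∀ v : E, ∃ c, v ∈ Λ → P v c := by
      intro v
      by_cases hv : v ∈ Λ
      · obtain ⟨c, hc⟩ := hex v hv
        exact ⟨c, fun _ => hc⟩
      · exact ⟨0, fun h => absurd h hv⟩
    choose c hc using this
    refine ⟨hfin.toFinset.sup c, fun v hv hvR => ⟨c v, hc v hv, ?_⟩⟩
    exact Finset.le_sup (f := c) (hfin.mem_toFinset.mpr ⟨hv, hvR⟩)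
  obtain ⟨c₀, hc₀⟩ := hfinc
  -- The additive errors, 1 per coordinate from rounding and c₀ from the remainder, become multiples
  -- of ‖v‖ because 1 ≤ ‖v‖ for nonzero v.
  refine ⟨∑ i : b, (M + 1) * (c₁ i + c₂ i) + c₀, fun v hv => ?_⟩
  by_cases hv0 : v = 0
  · exact ⟨0, hv0 ▸ hzero, by simp [hv0]⟩
  have hv1 := hdisc v hv hv0
  let a : b → ℝ := fun i => B.repr ⟨v, hmem v hv⟩ i
  have hva : v = ∑ i, a i • (i : E) := by
    have h := congrArg Subtype.val (B.sum_repr ⟨v, hmem v hv⟩)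
    rw [Submodule.coe_sum] at h
    conv_lhs => rw [← show _ = v from h]
    refine Finset.sum_congr rfl fun i _ => ?_
    simp [a, B, Module.Basis.span_apply]
  -- Rounding the coordinates down leaves a remainder in Λ of norm at most `R`, hence one of
  -- finitely many elements.
  let u : E := ∑ i, ⌊a i⌋ • (i : E)
  have hu : u ∈ Λ := AddSubgroup.sum_mem _ fun i _ => AddSubgroup.zsmul_mem _ (hbsub i.2) _
  have hw : v - u ∈ Λ := Λ.sub_mem hv hu
  have hwR : ‖v - u‖ ≤ R := by
    have : v - u = ∑ i, (Int.fract (a i)) • (i : E) := by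
      conv_lhs => rw [hva]
      simp only [u]
      rw [← Finset.sum_sub_distrib]
      refine Finset.sum_congr rfl fun i _ => ?_
      rw [← Int.cast_smul_eq_zsmul ℝ, ← sub_smul, Int.self_sub_floor]
    rw [this]
    refine (norm_sum_le _ _).trans (Finset.sum_le_sum fun i _ => ?_)
    rw [norm_smul, Real.norm_of_nonneg (Int.fract_nonneg _)]
    exact mul_le_of_le_one_left (norm_nonneg _) (Int.fract_lt_one _).le
  obtain ⟨c, hc, hcc⟩ := hc₀ _ hw hwR
  obtain ⟨d, hd, hdd⟩ := hsum Finset.univ fun i => ⌊a i⌋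
  refine ⟨d + c, by simpa [u] using hadd _ _ _ _ hd hc, ?_⟩
  push_cast
  rw [add_mul, Finset.sum_mul]
  refine add_le_add (hdd.trans (Finset.sum_le_sum fun i _ => ?_)) ?_
  · have h1 : |(⌊a i⌋ : ℝ)| ≤ (M + 1) * ‖v‖ := by
      have h2 := hM v hv i
      have h3 : |(⌊a i⌋ : ℝ)| ≤ |a i| + 1 := by
        have h4 := Int.floor_le (a i)
        have h5 := Int.lt_floor_add_one (a i)
        rw [abs_le]
        constructor
        · linarith [neg_abs_le (a i)]
        · linarith [le_abs_self (a i)]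
      change |a i| ≤ _ at h2
      linarith
    calc _ ≤ (M + 1) * ‖v‖ * (c₁ i + c₂ i) := by gcongr
      _ = _ := by ring
  · have : (c : ℝ) ≤ c₀ := by exact_mod_cast hcc
    nlinarith [(Nat.cast_nonneg c₀ : (0 : ℝ) ≤ c₀)]

/-! ### Conjugates of finite almost normal subgroups and free actions of finite quotients -/

/-- Conjugation by an element of the normalizer stays in the finite image of `i`, so conjugates are
indexed by a coset of the normalizer and an element of `H`. -/
theorem finite_conjugates_of_isAlmostNormal {G H : Type*} [Group G] [Group H] [Finite H]
    (i : H →* G) (hn : IsAlmostNormal i.range) (h : H) :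
    (Set.range fun g : G => g * i h * g⁻¹).Finite := by
  have hfi : (Subgroup.normalizer (i.range : Set G)).FiniteIndex := hn
  have : Finite (G ⧸ Subgroup.normalizer (i.range : Set G)) := inferInstance
  refine (Set.finite_range fun p : (G ⧸ Subgroup.normalizer (i.range : Set G)) × H =>
    p.1.out * i p.2 * p.1.out⁻¹).subset ?_
  rintro _ ⟨g, rfl⟩
  set q : G ⧸ Subgroup.normalizer (i.range : Set G) := QuotientGroup.mk g with hq
  have h1 : q.out⁻¹ * g ∈ Subgroup.normalizer (i.range : Set G) := by
    rw [← QuotientGroup.eq, QuotientGroup.out_eq', hq]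
  have h2 : (q.out⁻¹ * g) * i h * (q.out⁻¹ * g)⁻¹ ∈ (i.range : Set G) :=
    (Subgroup.mem_normalizer_iff.mp h1 _).mp ⟨h, rfl⟩
  obtain ⟨k, hk⟩ := h2
  refine ⟨(q, k), ?_⟩
  simp only [hk]
  group

/-- If finitely many elements are individually detected by finite quotients killing the remaining
ones, then some finite set carries an action in which the former act without fixed points and the
latter trivially. -/
theorem exists_perm_action_free {G ι : Type*} [Group G] [Finite ι] (u : ι → G) (bad : ι → Prop)
    (h : ∀ s, bad s → ∃ N : Subgroup G, N.Normal ∧ N.FiniteIndex ∧ u s ∉ N ∧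
      ∀ s', ¬ bad s' → u s' ∈ N) :
    ∃ (k : ℕ) (α : G →* Equiv.Perm (Fin (k + 1))), (∀ s, ¬ bad s → α (u s) = 1) ∧
      ∀ s, bad s → ∀ x, α (u s) x ≠ x := by
  choose! N hN₁ hN₂ hN₃ hN₄ using h
  let M : Subgroup G := ⨅ s : {s // bad s}, N s
  have hM₁ : M.Normal := Subgroup.normal_iInf_normal fun s => hN₁ s s.2
  have hM₂ : M.FiniteIndex := Subgroup.finiteIndex_iInf fun s => hN₂ s s.2
  have hMbad : ∀ s, bad s → u s ∉ M := fun s hs hmem =>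
    hN₃ s hs ((Subgroup.mem_iInf.mp hmem) ⟨s, hs⟩)
  have hMgood : ∀ s, ¬ bad s → u s ∈ M := fun s hs =>
    Subgroup.mem_iInf.mpr fun t => hN₄ t t.2 s hs
  have hfin : Finite (G ⧸ M) := inferInstance
  -- Since `M` is normal, an element fixing one coset fixes all of them; acting nontrivially
  -- therefore means acting without fixed points.
  have hfix : ∀ (g : G) (x : G ⧸ M), g • x = x ↔ g ∈ M := by
    intro g x
    induction x using QuotientGroup.induction_on with
    | H x =>
      rw [MulAction.Quotient.smul_mk, QuotientGroup.eq, smul_eq_mul, ← inv_mem_iff]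
      simp only [mul_inv_rev, inv_inv]
      exact ⟨fun h => by simpa [mul_assoc] using hM₁.conj_mem _ h x,
        fun h => by simpa [mul_assoc] using hM₁.conj_mem _ h x⁻¹⟩
  obtain ⟨k, hk⟩ := Nat.exists_eq_succ_of_ne_zero (Nat.card_pos (α := G ⧸ M)).ne'
  let e : (G ⧸ M) ≃ Fin (k + 1) := (Finite.equivFin _).trans (finCongr hk)
  refine ⟨k, e.permCongrHom.toMonoidHom.comp (MulAction.toPermHom G (G ⧸ M)), ?_, ?_⟩
  · intro s hs
    ext x
    have := (hfix (u s) (e.symm x)).mpr (hMgood s hs)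
    simp [Equiv.permCongr_apply, this]
  · intro s hs x hx
    refine hMbad s hs ((hfix (u s) (e.symm x)).mp ?_)
    simpa [Equiv.permCongr_apply, ← Equiv.eq_symm_apply] using hx

/-! ### Actions of finite groups on finite sets -/

/-- The set of group elements fixing a point. -/
def fixSet {H Z : Type*} [Group H] (a : H →* Equiv.Perm Z) (z : Z) : Set H := {h | a h z = z}

/-- The number of points with a given stabilizer. -/
noncomputable def stabCount {H Z : Type*} [Group H] (a : H →* Equiv.Perm Z) (L : Set H) : ℕ :=
  Nat.card {z : Z // fixSet a z = L}

section Stab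

variable {H Z Z₁ Z₂ : Type*} [Group H]

theorem fixSet_eq_of_injective {a : H →* Equiv.Perm Z₁} {b : H →* Equiv.Perm Z₂} {f : Z₁ → Z₂}
    {D : Set Z₁} (hinj : Set.InjOn f D) (hD : ∀ h z, z ∈ D → a h z ∈ D)
    (hf : ∀ h z, z ∈ D → f (a h z) = b h (f z)) {z : Z₁} (hz : z ∈ D) :
    fixSet b (f z) = fixSet a z := by
  ext h
  simp only [fixSet, Set.mem_ofPred_eq, ← hf h z hz]
  exact ⟨fun h1 => hinj (hD h z hz) hz h1, fun h1 => by rw [h1]⟩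

theorem stabCount_congr {a : H →* Equiv.Perm Z₁} {b : H →* Equiv.Perm Z₂} (e : Z₁ ≃ Z₂)
    (he : ∀ h z, e (a h z) = b h (e z)) (L : Set H) : stabCount a L = stabCount b L := by
  refine Nat.card_congr (e.subtypeEquiv fun z => ?_)
  rw [fixSet_eq_of_injective (a := a) (b := b) (D := Set.univ) e.injective.injOn
    (fun _ _ _ => trivial) (fun h z _ => he h z) trivial]

/-- Equivariant partial injections between finite actions with the same stabilizer counts extend
to equivariant bijections. -/
theorem exists_equivariant_equiv [Finite Z₁] [Finite Z₂] {a : H →* Equiv.Perm Z₁}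
    {b : H →* Equiv.Perm Z₂} (hab : ∀ L, stabCount a L = stabCount b L) (D : Set Z₁) (f : Z₁ → Z₂)
    (hinj : Set.InjOn f D) (hD : ∀ h z, z ∈ D → a h z ∈ D)
    (hf : ∀ h z, z ∈ D → f (a h z) = b h (f z)) :
    ∃ e : Z₁ ≃ Z₂, (∀ h z, e (a h z) = b h (e z)) ∧ ∀ z ∈ D, e z = f z := by
  classical
  -- Each step enlarges the domain by one whole orbit.
  induction hk : Dᶜ.ncard using Nat.strong_induction_on generalizing D f with
  | _ k ih =>
  have hmaps : ∀ L : Set H, ∀ z ∈ D, fixSet a z = L → fixSet b (f z) = L := fun L z hz hL =>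
    (fixSet_eq_of_injective hinj hD hf hz).trans hL
  have hcard : ∀ L : Set H, {z | fixSet a z = L}.ncard = {z | fixSet b z = L}.ncard := fun L => by
    rw [← Nat.card_coe_set_eq, ← Nat.card_coe_set_eq]
    exact hab L
  by_cases hu : D = Set.univ
  · subst hu
    have hfinj : Function.Injective f := Set.injOn_univ.mp hinj
    have hsurj : Function.Surjective f := by
      intro y
      have h1 : f '' {z | fixSet a z = fixSet b y} = {z | fixSet b z = fixSet b y} := by
        refine Set.eq_of_subset_of_ncard_le ?_ ?_ (Set.toFinite _)
        · rintro _ ⟨z, hz, rfl⟩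
          exact hmaps _ z trivial hz
        · rw [Set.ncard_image_of_injective _ hfinj, hcard]
      have h2 : y ∈ f '' {z | fixSet a z = fixSet b y} := by rw [h1]; rfl
      obtain ⟨z, -, hz⟩ := h2
      exact ⟨z, hz⟩
    exact ⟨Equiv.ofBijective f ⟨hfinj, hsurj⟩, fun h z => hf h z trivial, fun z _ => rfl⟩
  · obtain ⟨x, hx⟩ := (Set.ne_univ_iff_exists_notMem D).mp hu
    -- The points with the stabilizer of x are equally numerous on both sides. Since x is outside D,
    -- the image of D cannot exhaust those on the right.
    obtain ⟨y, hyL, hy⟩ : ∃ y, fixSet b y = fixSet a x ∧ y ∉ f '' D := by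
      by_contra! hcon
      have h1 : {z | fixSet b z = fixSet a x} ⊆ f '' (D ∩ {z | fixSet a z = fixSet a x}) := by
        intro z hz
        obtain ⟨w, hw, rfl⟩ := hcon z hz
        exact ⟨w, ⟨hw, (fixSet_eq_of_injective hinj hD hf hw).symm.trans hz⟩, rfl⟩
      have h2 := Set.ncard_le_ncard h1 (Set.toFinite _)
      rw [← hcard] at h2
      have h3 := h2.trans (Set.ncard_image_le (Set.toFinite _))
      have h4 : D ∩ {z | fixSet a z = fixSet a x} ⊂ {z | fixSet a z = fixSet a x} :=
        ⟨Set.inter_subset_right, fun h => hx (h (rfl : fixSet a x = fixSet a x)).1⟩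
      exact absurd h3 (not_le.mpr (Set.ncard_lt_ncard h4 (Set.toFinite _)))
    have horb : ∀ h, a h x ∉ D := fun h hmem => hx (by simpa using hD h⁻¹ _ hmem)
    have hyorb : ∀ h, b h y ∉ f '' D := by
      rintro h ⟨z, hz, hzy⟩
      exact hy ⟨a h⁻¹ z, hD _ _ hz, by rw [hf _ _ hz, hzy]; simp⟩
    have hxy : ∀ h h', a h x = a h' x ↔ b h y = b h' y := by
      intro h h'
      have h1 : h'⁻¹ * h ∈ fixSet a x ↔ h'⁻¹ * h ∈ fixSet b y := by rw [hyL]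
      simpa [fixSet, Equiv.symm_apply_eq] using h1
    let D' : Set Z₁ := D ∪ Set.range fun h => a h x
    -- The orbit map is independent of the chosen group element because x and y have the same
    -- stabilizer.
    let f' : Z₁ → Z₂ := fun z =>
      if hz : ∃ h, a h x = z then b hz.choose y else f z
    have hf'orb : ∀ h, f' (a h x) = b h y := by
      intro h
      have hz : ∃ h', a h' x = a h x := ⟨h, rfl⟩
      simp only [f', dif_pos hz]
      exact (hxy _ _).mp hz.choose_spec
    have hf'D : ∀ z ∈ D, f' z = f z := by
      intro z hz
      have : ¬ ∃ h, a h x = z := by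
        rintro ⟨h, rfl⟩
        exact horb h hz
      simp only [f', dif_neg this]
    have hlt : D'ᶜ.ncard < k := by
      rw [← hk]
      refine Set.ncard_lt_ncard ⟨Set.compl_subset_compl.mpr Set.subset_union_left, ?_⟩
        (Set.toFinite _)
      intro h
      exact h hx (Or.inr ⟨1, by simp⟩)
    have hinj' : Set.InjOn f' D' := by
      rintro z (hz | ⟨h, rfl⟩) w (hw | ⟨h', rfl⟩) hzw
      · rw [hf'D z hz, hf'D w hw] at hzw
        exact hinj hz hw hzw
      · rw [hf'D z hz, hf'orb] at hzw
        exact absurd ⟨z, hz, hzw⟩ (hyorb h')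
      · rw [hf'D w hw, hf'orb] at hzw
        exact absurd ⟨w, hw, hzw.symm⟩ (hyorb h)
      · simp only [hf'orb] at hzw
        exact (hxy _ _).mpr hzw
    have hD' : ∀ h z, z ∈ D' → a h z ∈ D' := by
      rintro h z (hz | ⟨h', rfl⟩)
      · exact Or.inl (hD h z hz)
      · exact Or.inr ⟨h * h', by simp⟩
    have hf'eq : ∀ h z, z ∈ D' → f' (a h z) = b h (f' z) := by
      rintro h z (hz | ⟨h', rfl⟩)
      · rw [hf'D _ hz, hf'D _ (hD h z hz), hf h z hz]
      · simp only [hf'orb]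
        rw [← Equiv.Perm.mul_apply, ← Equiv.Perm.mul_apply, ← map_mul, ← map_mul, hf'orb]
    obtain ⟨e, he, he'⟩ := ih _ hlt D' f' hinj' hD' hf'eq rfl
    exact ⟨e, he, fun z hz => (he' z (Or.inl hz)).trans (hf'D z hz)⟩

/-- The disjoint union of two actions. -/
def sumAction (a : H →* Equiv.Perm Z₁) (b : H →* Equiv.Perm Z₂) : H →* Equiv.Perm (Z₁ ⊕ Z₂) :=
  (Equiv.Perm.sumCongrHom Z₁ Z₂).comp (a.prod b)

@[simp]
theorem sumAction_inl (a : H →* Equiv.Perm Z₁) (b : H →* Equiv.Perm Z₂) (h : H) (z : Z₁) :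
    sumAction a b h (Sum.inl z) = Sum.inl (a h z) := rfl

@[simp]
theorem sumAction_inr (a : H →* Equiv.Perm Z₁) (b : H →* Equiv.Perm Z₂) (h : H) (z : Z₂) :
    sumAction a b h (Sum.inr z) = Sum.inr (b h z) := rfl

theorem stabCount_sumAction [Finite Z₁] [Finite Z₂] (a : H →* Equiv.Perm Z₁)
    (b : H →* Equiv.Perm Z₂) (L : Set H) :
    stabCount (sumAction a b) L = stabCount a L + stabCount b L := by
  rw [stabCount, Nat.card_congr Equiv.subtypeSum, Nat.card_sum]
  simp [stabCount, fixSet]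

/-- The action on the complement of an equivariant map. -/
def complAction (b : H →* Equiv.Perm Z₂) (j : Z₁ → Z₂)
    (hj : ∀ h z, z ∉ Set.range j ↔ b h z ∉ Set.range j) :
    H →* Equiv.Perm {z // z ∉ Set.range j} where
  toFun h := (b h).subtypePerm fun z => (hj h z).symm
  map_one' := by ext; simp
  map_mul' h h' := Equiv.ext fun z => Subtype.ext <| by
    change b (h * h') z = b h (b h' z)
    rw [map_mul]
    rfl

theorem stabCount_complAction [Finite Z₁] [Finite Z₂] (a : H →* Equiv.Perm Z₁)
    (b : H →* Equiv.Perm Z₂) (j : Z₁ → Z₂) (hinj : Function.Injective j)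
    (hj : ∀ h z, z ∉ Set.range j ↔ b h z ∉ Set.range j) (heq : ∀ h z, j (a h z) = b h (j z))
    (L : Set H) : stabCount b L = stabCount a L + stabCount (complAction b j hj) L := by
  classical
  rw [← stabCount_sumAction]
  let e : Z₁ ⊕ {z // z ∉ Set.range j} ≃ Z₂ :=
    ((Equiv.ofInjective j hinj).sumCongr (Equiv.refl _)).trans (Equiv.sumCompl (· ∈ Set.range j))
  refine (stabCount_congr e ?_ L).symm
  rintro h (z | z)
  · simp [e, heq]
  · simp [e, complAction]

/-- The induced action on subsets. -/
def setAction (a : H →* Equiv.Perm Z) : H →* Equiv.Perm (Set Z) where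
  toFun h := Equiv.Set.congr (a h)
  map_one' := by ext; simp [Equiv.Set.congr]
  map_mul' _ _ := by ext; simp [Equiv.Set.congr, Set.image_image]

/-- The diagonal action on a product. -/
def prodAction (a : H →* Equiv.Perm Z₁) (b : H →* Equiv.Perm Z₂) : H →* Equiv.Perm (Z₁ × Z₂) where
  toFun h := (a h).prodCongr (b h)
  map_one' := by ext <;> simp
  map_mul' _ _ := by ext <;> simp

end Stab

/-! ### Correcting the defect between two restrictions of a permutation action -/

/-- The difference of the stabilizer counts of the two restrictions of an action. -/
noncomputable def stabDefect {G H Z : Type*} [Group G] [Group H] (i₁ i₂ : H →* G)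
    (ρ : G →* Equiv.Perm Z) : Set H → ℝ :=
  fun L => stabCount (ρ.comp i₁) L - stabCount (ρ.comp i₂) L

section Defect

variable {G H : Type*} [Group G] [Group H] (i₁ i₂ : H →* G)

theorem stabDefect_congr {Z₁ Z₂ : Type*} {ρ : G →* Equiv.Perm Z₁} {σ : G →* Equiv.Perm Z₂}
    (e : Z₁ ≃ Z₂) (he : ∀ g z, e (ρ g z) = σ g (e z)) :
    stabDefect i₁ i₂ ρ = stabDefect i₁ i₂ σ := by
  ext L
  rw [stabDefect, stabDefect, stabCount_congr (b := σ.comp i₁) e fun h z => he _ _,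
    stabCount_congr (b := σ.comp i₂) e fun h z => he _ _]

theorem stabDefect_sumAction {Z₁ Z₂ : Type*} [Finite Z₁] [Finite Z₂] (ρ : G →* Equiv.Perm Z₁)
    (σ : G →* Equiv.Perm Z₂) :
    stabDefect i₁ i₂ (sumAction ρ σ) = stabDefect i₁ i₂ ρ + stabDefect i₁ i₂ σ := by
  ext L
  have h₁ := stabCount_sumAction (ρ.comp i₁) (σ.comp i₁) L
  have h₂ := stabCount_sumAction (ρ.comp i₂) (σ.comp i₂) L
  simp only [stabDefect, Pi.add_apply]
  rw [show (sumAction ρ σ).comp i₁ = sumAction (ρ.comp i₁) (σ.comp i₁) from rfl, h₁,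
    show (sumAction ρ σ).comp i₂ = sumAction (ρ.comp i₂) (σ.comp i₂) from rfl, h₂]
  push_cast
  ring

theorem stabDefect_complAction {Z₁ Z₂ : Type*} [Finite Z₁] [Finite Z₂] (ρ : G →* Equiv.Perm Z₁)
    (σ : G →* Equiv.Perm Z₂) (j : Z₁ → Z₂) (hinj : Function.Injective j)
    (hj : ∀ g z, z ∉ Set.range j ↔ σ g z ∉ Set.range j) (heq : ∀ g z, j (ρ g z) = σ g (j z)) :
    stabDefect i₁ i₂ σ = stabDefect i₁ i₂ ρ + stabDefect i₁ i₂ (complAction σ j hj) := by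
  ext L
  have h₁ := stabCount_complAction (ρ.comp i₁) (σ.comp i₁) j hinj (fun h => hj (i₁ h))
    (fun h => heq (i₁ h)) L
  have h₂ := stabCount_complAction (ρ.comp i₂) (σ.comp i₂) j hinj (fun h => hj (i₂ h))
    (fun h => heq (i₂ h)) L
  simp only [stabDefect, Pi.add_apply]
  rw [h₁, h₂]
  push_cast
  have e₁ : complAction (σ.comp i₁) j (fun h => hj (i₁ h)) = (complAction σ j hj).comp i₁ := rfl
  have e₂ : complAction (σ.comp i₂) j (fun h => hj (i₂ h)) = (complAction σ j hj).comp i₂ := rfl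
  rw [e₁, e₂]
  ring

/-- If two embeddings of a finite group act freely, modulo the same part, on an auxiliary set, every
action embeds into one with vanishing defect. -/
theorem exists_neg_stabDefect (bad : H → Prop) {k : ℕ} (α : G →* Equiv.Perm (Fin (k + 1)))
    (hgood : ∀ h, ¬ bad h → α (i₁ h) = 1 ∧ α (i₂ h) = 1)
    (hbad : ∀ h, bad h → ∀ x, α (i₁ h) x ≠ x ∧ α (i₂ h) x ≠ x)
    {Z : Type} [Finite Z] (ρ : G →* Equiv.Perm Z)
    (hρ : ∀ h, ¬ bad h → ρ (i₁ h) = 1 ∧ ρ (i₂ h) = 1) :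
    ∃ (Z' : Type) (_ : Finite Z') (ρ' : G →* Equiv.Perm Z'),
      (∀ h, ¬ bad h → ρ' (i₁ h) = 1 ∧ ρ' (i₂ h) = 1) ∧
      stabDefect i₁ i₂ ρ' = - stabDefect i₁ i₂ ρ := by
  -- Under both restrictions of the product, every point has exactly the good elements as
  -- stabilizer: these act trivially, and the bad ones already move the second coordinate. So the
  -- restrictions are isomorphic.
  let β := prodAction ρ α
  have hβ : ∀ h, ¬ bad h → β (i₁ h) = 1 ∧ β (i₂ h) = 1 := by
    intro h hh
    constructor <;> ext x <;> simp [β, prodAction, hρ h hh, hgood h hh]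
  have hfix : ∀ z, fixSet (β.comp i₁) z = {h | ¬ bad h} ∧ fixSet (β.comp i₂) z = {h | ¬ bad h} := by
    intro z
    constructor <;> ext h <;> simp only [fixSet, Set.mem_ofPred_eq, MonoidHom.comp_apply] <;>
      by_cases hh : bad h <;> simp only [hh, not_true, not_false_iff, iff_false, iff_true]
    · exact fun h1 => (hbad h hh z.2).1 (congrArg Prod.snd h1)
    · rw [(hβ h hh).1]; rfl
    · exact fun h1 => (hbad h hh z.2).2 (congrArg Prod.snd h1)
    · rw [(hβ h hh).2]; rfl
  obtain ⟨e, he, -⟩ := exists_equivariant_equiv (a := β.comp i₁) (b := β.comp i₂)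
    (fun L => by simp [stabCount, hfix]) ∅ id (by simp) (by simp) (by simp)
  -- The isomorphism of restrictions passes to subsets. Subsets are used because ρ need not embed in
  -- the product, whereas its points correspond to fibres of the projection.
  let σ := setAction β
  have hσ : stabDefect i₁ i₂ σ = 0 := by
    ext L
    simp only [stabDefect, Pi.zero_apply]
    rw [stabCount_congr (a := σ.comp i₁) (b := σ.comp i₂) (Equiv.Set.congr e), sub_self]
    intro h s
    have he' : ∀ z, e (β (i₁ h) z) = β (i₂ h) (e z) := he h
    simp [σ, setAction, Equiv.Set.congr, Set.image_image, he']
  -- Distinct points give distinct fibres since `Fin (k + 1)` is nonempty.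
  let j : Z → Set (Z × Fin (k + 1)) := fun z => {q | q.1 = z}
  have hinj : Function.Injective j := by
    intro z w hzw
    have h1 : (z, (0 : Fin (k + 1))) ∈ j z := rfl
    rw [hzw] at h1
    exact h1
  have heq : ∀ g z, j (ρ g z) = σ g (j z) := by
    intro g z
    ext ⟨w, x⟩
    simp only [j, σ, setAction, Set.mem_ofPred_eq, MonoidHom.coe_mk, OneHom.coe_mk,
      Equiv.Set.congr_apply, Set.mem_image]
    constructor
    · rintro rfl
      exact ⟨(z, (α g)⁻¹ x), rfl, by simp [β, prodAction]⟩
    · rintro ⟨q, rfl, hq⟩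
      exact (congrArg Prod.fst hq).symm
  have hj : ∀ g z, z ∉ Set.range j ↔ σ g z ∉ Set.range j := by
    intro g z
    refine not_congr ⟨?_, ?_⟩
    · rintro ⟨w, rfl⟩
      exact ⟨ρ g w, heq g w⟩
    · rintro ⟨w, hw⟩
      refine ⟨ρ g⁻¹ w, ?_⟩
      rw [heq, hw, ← Equiv.Perm.mul_apply, ← map_mul]
      simp
  refine ⟨_, inferInstance, complAction σ j hj, ?_, ?_⟩
  · intro h hh
    constructor <;> ext s : 2 <;> simp [complAction, σ, setAction, hβ h hh, Equiv.Set.congr]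
  · have := stabDefect_complAction i₁ i₂ ρ σ j hinj hj heq
    rw [hσ] at this
    exact (neg_eq_of_add_eq_zero_right this.symm).symm

/-- The defect of an action can be cancelled by an action on a set whose size is linearly bounded
by the defect. -/
theorem exists_perm_correction [Finite H] (bad : H → Prop) {k : ℕ}
    (α : G →* Equiv.Perm (Fin (k + 1)))
    (hgood : ∀ h, ¬ bad h → α (i₁ h) = 1 ∧ α (i₂ h) = 1)
    (hbad : ∀ h, bad h → ∀ x, α (i₁ h) x ≠ x ∧ α (i₂ h) x ≠ x) :
    ∃ C : ℝ, ∀ (Z : Type) [Finite Z] (ρ : G →* Equiv.Perm Z) (M : ℝ),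
      (∀ h, ¬ bad h → ρ (i₁ h) = 1 ∧ ρ (i₂ h) = 1) → (∀ L, |stabDefect i₁ i₂ ρ L| ≤ M) → 0 ≤ M →
      ∃ (c : ℕ) (σ : G →* Equiv.Perm (Fin c)), (c : ℝ) ≤ C * M ∧
        stabDefect i₁ i₂ σ = - stabDefect i₁ i₂ ρ := by
  classical
  have := Fintype.ofFinite H
  -- The cost of a defect is the number of points of an action realizing it. The good elements must
  -- act trivially, as otherwise negatives would not be available.
  let P : (Set H → ℝ) → ℕ → Prop := fun v c => ∃ ρ : G →* Equiv.Perm (Fin c),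
    (∀ h, ¬ bad h → ρ (i₁ h) = 1 ∧ ρ (i₂ h) = 1) ∧ stabDefect i₁ i₂ ρ = v
  have htransfer : ∀ {Z : Type} [Finite Z] (ρ : G →* Equiv.Perm Z),
      (∀ h, ¬ bad h → ρ (i₁ h) = 1 ∧ ρ (i₂ h) = 1) → P (stabDefect i₁ i₂ ρ) (Nat.card Z) := by
    intro Z _ ρ hρ
    let e := Finite.equivFin Z
    refine ⟨e.permCongrHom.toMonoidHom.comp ρ, fun h hh => ?_, ?_⟩
    · constructor <;> ext x <;> simp [hρ h hh, Equiv.permCongr_apply]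
    · exact (stabDefect_congr i₁ i₂ e fun g z => by simp [Equiv.permCongr_apply]).symm
  have hzero : P 0 0 := by
    refine ⟨1, fun h _ => by simp, ?_⟩
    ext L
    simp [stabDefect, stabCount]
  have hadd : ∀ v w a b, P v a → P w b → P (v + w) (a + b) := by
    rintro _ _ a b ⟨ρ, hρ, rfl⟩ ⟨σ, hσ, rfl⟩
    rw [← stabDefect_sumAction]
    have := htransfer (sumAction ρ σ) fun h hh => by
      constructor <;> ext (z | z) <;> simp [hρ h hh, hσ h hh]
    simpa using this
  let Λ : AddSubgroup (Set H → ℝ) :=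
    { carrier := {v | ∃ c, P v c}
      zero_mem' := ⟨0, hzero⟩
      add_mem' := fun ⟨a, ha⟩ ⟨b, hb⟩ => ⟨a + b, hadd _ _ _ _ ha hb⟩
      neg_mem' := by
        rintro _ ⟨a, ρ, hρ, rfl⟩
        obtain ⟨Z', _, ρ', hρ', h⟩ := exists_neg_stabDefect i₁ i₂ bad α hgood hbad ρ hρ
        exact ⟨_, h ▸ htransfer ρ' hρ'⟩ }
  -- Stabilizer counts are integers, so a nonzero defect has sup norm at least 1.
  obtain ⟨C, hC⟩ := exists_cost_le_mul_norm Λ (by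
    rintro _ ⟨a, ρ, hρ, rfl⟩ hne
    obtain ⟨L, hL⟩ := Function.ne_iff.mp hne
    refine le_trans ?_ (norm_le_pi_norm _ L)
    have h1 : stabDefect i₁ i₂ ρ L =
      (((stabCount (ρ.comp i₁) L : ℤ) - stabCount (ρ.comp i₂) L : ℤ) : ℝ) := by
      simp [stabDefect]
    rw [Real.norm_eq_abs]
    rw [Pi.zero_apply] at hL
    rw [h1] at hL ⊢
    exact_mod_cast Int.one_le_abs (by exact_mod_cast hL)) P hzero hadd fun v hv => hv
  refine ⟨|C|, fun Z _ ρ M hρ hM hM0 => ?_⟩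
  obtain ⟨c, ⟨σ, -, hσ⟩, hc⟩ := hC (-stabDefect i₁ i₂ ρ) (Λ.neg_mem ⟨_, htransfer ρ hρ⟩)
  refine ⟨c, σ, hc.trans ?_, hσ⟩
  rw [norm_neg]
  have hn : ‖stabDefect i₁ i₂ ρ‖ ≤ M := (pi_norm_le_iff_of_nonneg hM0).mpr hM
  exact mul_le_mul (le_abs_self C) hn (norm_nonneg _) (abs_nonneg C)

end Defect

/-! ### Negligible sets of points -/

/-- The number of points of `Y n` satisfying `p n` is `o(|X n|)`. -/
def Negligible (X : ℕ → Type) {Y : ℕ → Type} (p : ∀ n, Y n → Prop) : Prop :=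
  Tendsto (fun n => (Nat.card {y : Y n // p n y} : ℝ) / (Nat.card (X n) : ℝ)) atTop (𝓝 0)

namespace Negligible

variable {X Y Z : ℕ → Type}

theorem of_le {p : ∀ n, Y n → Prop} {b : ℕ → ℝ}
    (hb : Tendsto (fun n => b n / (Nat.card (X n) : ℝ)) atTop (𝓝 0))
    (h : ∀ n, (Nat.card {y : Y n // p n y} : ℝ) ≤ b n) : Negligible X p :=
  squeeze_zero (fun n => by positivity) (fun n => by gcongr; exact h n) hb

theorem mono [∀ n, Finite (Y n)] {p q : ∀ n, Y n → Prop} (hq : Negligible X q) (h : ∀ n y, p n y → q n y) :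
    Negligible X p :=
  of_le hq fun n => by
    exact_mod_cast Nat.card_le_card_of_injective
      (Subtype.map id (h n)) (Subtype.map_injective _ Function.injective_id)

theorem comap [∀ n, Finite (Z n)] {q : ∀ n, Z n → Prop} (hq : Negligible X q) (f : ∀ n, Y n → Z n)
    (hf : ∀ n, Function.Injective (f n)) : Negligible X fun n y => q n (f n y) :=
  of_le hq fun n => by
    exact_mod_cast Nat.card_le_card_of_injective
      (Subtype.map (f n) fun _ h => h) (Subtype.map_injective _ (hf n))

theorem or {p q : ∀ n, Y n → Prop} (hp : Negligible X p) (hq : Negligible X q) :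
    Negligible X fun n y => p n y ∨ q n y := by
  refine of_le (b := fun n => (Nat.card {y : Y n // p n y} : ℝ) + Nat.card {y : Y n // q n y}) ?_ ?_
  · simp only [add_div]
    simpa using Tendsto.add hp hq
  · intro n
    have h := Set.ncard_union_le {y | p n y} {y | q n y}
    exact_mod_cast h

theorem exists_mem [∀ n, Finite (Y n)] {ι : Type*} (s : Finset ι) {p : ι → ∀ n, Y n → Prop}
    (h : ∀ i ∈ s, Negligible X (p i)) : Negligible X fun n y => ∃ i ∈ s, p i n y := by
  classical
  induction s using Finset.induction_on with
  | empty => simp [Negligible]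
  | insert i s _ ih =>
    refine ((h i (Finset.mem_insert_self _ _)).or
      (ih fun j hj => h j (Finset.mem_insert_of_mem hj))).mono ?_
    rintro n y ⟨j, hj, hp⟩
    rcases Finset.mem_insert.mp hj with rfl | hj
    · exact Or.inl hp
    · exact Or.inr ⟨j, hj, hp⟩

theorem exists_of_finite [∀ n, Finite (Y n)] {ι : Type*} [Finite ι] {p : ι → ∀ n, Y n → Prop}
    (h : ∀ i, Negligible X (p i)) : Negligible X fun n y => ∃ i, p i n y := by
  have := Fintype.ofFinite ι
  exact (exists_mem Finset.univ fun i _ => h i).mono fun n y ⟨i, hi⟩ => ⟨i, Finset.mem_univ i, hi⟩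

/-- Only |Y n| - |X n| = o(|X n|) points lie outside the image. -/
theorem of_embedding [∀ n, Finite (Y n)] [∀ n, Finite (X n)] [∀ n, Nonempty (X n)] {p : ∀ n, Y n → Prop}
    (ι : ∀ n, X n ↪ Y n)
    (hcard : Tendsto (fun n => (Nat.card (Y n) : ℝ) / (Nat.card (X n) : ℝ)) atTop (𝓝 1))
    (h : Negligible X fun n x => p n (ι n x)) : Negligible X p := by
  refine of_le (b := fun n => (Nat.card {x : X n // p n (ι n x)} : ℝ) +
    (Nat.card (Y n) - Nat.card (X n))) ?_ ?_
  · have h1 : Tendsto (fun n => (Nat.card {x : X n // p n (ι n x)} : ℝ) / (Nat.card (X n) : ℝ) +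
        ((Nat.card (Y n) : ℝ) / (Nat.card (X n) : ℝ) - 1)) atTop (𝓝 0) := by
      simpa using Tendsto.add h (hcard.sub_const 1)
    refine h1.congr fun n => ?_
    have : (Nat.card (X n) : ℝ) ≠ 0 := by exact_mod_cast Nat.card_pos.ne'
    field_simp
  · intro n
    have h1 : Nat.card {y : Y n // p n y} ≤ Nat.card {x : X n // p n (ι n x)} +
        Nat.card {y // y ∉ Set.range (ι n)} := by
      have h2 : {y | p n y} ⊆ ι n '' {x | p n (ι n x)} ∪ {y | y ∉ Set.range (ι n)} := by
        intro y hy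
        by_cases hr : y ∈ Set.range (ι n)
        · obtain ⟨x, rfl⟩ := hr
          exact Or.inl ⟨x, hy, rfl⟩
        · exact Or.inr hr
      have h3 := (Set.ncard_le_ncard h2 (Set.toFinite _)).trans (Set.ncard_union_le _ _)
      rw [Set.ncard_image_of_injective _ (ι n).injective] at h3
      exact h3
    have h2 : Nat.card (Y n) = Nat.card (X n) + Nat.card {y // y ∉ Set.range (ι n)} := by
      classical
      rw [← Nat.card_congr (Equiv.sumCompl (· ∈ Set.range (ι n))), Nat.card_sum,
        ← Nat.card_congr (Equiv.ofInjective _ (ι n).injective)]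
    have h1' : (Nat.card {y : Y n // p n y} : ℝ) ≤ Nat.card {x : X n // p n (ι n x)} +
        Nat.card {y // y ∉ Set.range (ι n)} := by exact_mod_cast h1
    have h2' : (Nat.card (Y n) : ℝ) = Nat.card (X n) + Nat.card {y // y ∉ Set.range (ι n)} := by
      exact_mod_cast h2
    linarith

end Negligible

/-- The elements at which a homomorphism extends an asymptotic homomorphism, up to negligible sets,
are closed under products. -/
theorem negligible_mul {Γ : Type*} [Group Γ] {X Z : ℕ → Type} [∀ n, Finite (X n)]
    {φ : ∀ n, Γ → Equiv.Perm (X n)}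
    (hφ : ∀ a b, Negligible X fun n x => φ n a (φ n b x) ≠ φ n (a * b) x)
    (ι : ∀ n, X n → Z n) (ρ : ∀ n, Γ →* Equiv.Perm (Z n)) {a b : Γ}
    (ha : Negligible X fun n x => ι n (φ n a x) ≠ ρ n a (ι n x))
    (hb : Negligible X fun n x => ι n (φ n b x) ≠ ρ n b (ι n x)) :
    Negligible X fun n x => ι n (φ n (a * b) x) ≠ ρ n (a * b) (ι n x) := by
  refine (((hφ a b).or hb).or (ha.comap (fun n => φ n b) fun n => (φ n b).injective)).mono ?_
  intro n x hx
  by_contra! h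
  obtain ⟨⟨h1, h2⟩, h3⟩ := h
  apply hx
  rw [← h1, h3, h2, map_mul, Equiv.Perm.mul_apply]

/-- At most points φ(1)φ(1) agrees with φ(1 · 1) = φ(1), and one factor cancels. -/
theorem negligible_one {Γ : Type*} [Group Γ] {X : ℕ → Type} [∀ n, Finite (X n)]
    {φ : ∀ n, Γ → Equiv.Perm (X n)}
    (hφ : ∀ a b, Negligible X fun n x => φ n a (φ n b x) ≠ φ n (a * b) x) :
    Negligible X fun n x => φ n 1 x ≠ x := by
  refine (hφ 1 1).mono fun n x hx h => hx ?_
  rw [mul_one] at h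
  exact (φ n 1).injective h

theorem negligible_inv {Γ : Type*} [Group Γ] {X Z : ℕ → Type} [∀ n, Finite (X n)]
    {φ : ∀ n, Γ → Equiv.Perm (X n)}
    (hφ : ∀ a b, Negligible X fun n x => φ n a (φ n b x) ≠ φ n (a * b) x)
    (ι : ∀ n, X n → Z n) (ρ : ∀ n, Γ →* Equiv.Perm (Z n)) {a : Γ}
    (ha : Negligible X fun n x => ι n (φ n a x) ≠ ρ n a (ι n x)) :
    Negligible X fun n x => ι n (φ n a⁻¹ x) ≠ ρ n a⁻¹ (ι n x) := by
  refine (((hφ a a⁻¹).or (negligible_one hφ)).or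
    (ha.comap (fun n => φ n a⁻¹) fun n => (φ n a⁻¹).injective)).mono ?_
  intro n x hx
  by_contra! h
  obtain ⟨⟨h1, h2⟩, h3⟩ := h
  apply hx
  rw [h1, mul_inv_cancel, h2] at h3
  rw [h3, ← Equiv.Perm.mul_apply, ← map_mul]
  simp

/-- Replace an action by the trivial one outside an invariant set. -/
noncomputable def trivializeOff {G Y : Type*} [Group G] (ψ : G →* Equiv.Perm Y) (S : Set Y)
    (hS : ∀ g, ∀ y ∈ S, ψ g y ∈ S) : G →* Equiv.Perm Y :=
  open Classical in
  MonoidHom.toHomPerm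
    { toFun := fun g y => if y ∈ S then ψ g y else y
      map_one' := by
        funext y
        simp
        rfl
      map_mul' := fun a b => by
        classical
        funext y
        change _ = (fun y => if y ∈ S then ψ a y else y) (if y ∈ S then ψ b y else y)
        by_cases hy : y ∈ S
        · simp [hy, hS b y hy]
        · simp [hy] }

theorem trivializeOff_of_mem {G Y : Type*} [Group G] {ψ : G →* Equiv.Perm Y} {S : Set Y}
    {hS : ∀ g, ∀ y ∈ S, ψ g y ∈ S} {y : Y} (hy : y ∈ S) (g : G) :
    trivializeOff ψ S hS g y = ψ g y :=
  if_pos hy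

theorem trivializeOff_of_notMem {G Y : Type*} [Group G] {ψ : G →* Equiv.Perm Y} {S : Set Y}
    {hS : ∀ g, ∀ y ∈ S, ψ g y ∈ S} {y : Y} (hy : y ∉ S) (g : G) :
    trivializeOff ψ S hS g y = y :=
  if_neg hy

/-! ### Generators and relations of the HNN extension -/

section HNN

variable {G H M : Type*} [Group G] [Group H] [Group M] {i₁ i₂ : H →* G}
  {h₁ : Function.Injective i₁} {h₂ : Function.Injective i₂}

theorem hnn_equiv_apply (h : H) :
    ((((MonoidHom.ofInjective h₂).symm.trans (MonoidHom.ofInjective h₁))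
      (MonoidHom.ofInjective h₂ h) : i₁.range) : G) = i₁ h := by
  simp [MonoidHom.ofInjective_apply]

theorem hnn_t_mul_of (h : H) :
    (HNNExtension.t * HNNExtension.of (i₂ h) : HNNOfEmbeddings i₁ i₂ h₁ h₂) =
      HNNExtension.of (i₁ h) * HNNExtension.t := by
  have := HNNExtension.t_mul_of (φ := (MonoidHom.ofInjective h₂).symm.trans
    (MonoidHom.ofInjective h₁)) (MonoidHom.ofInjective h₂ h)
  rwa [hnn_equiv_apply] at this

theorem exists_hnn_lift (f : G →* M) (x : M) (hx : ∀ h, x * f (i₂ h) = f (i₁ h) * x) :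
    ∃ F : HNNOfEmbeddings i₁ i₂ h₁ h₂ →* M, (∀ g, F (HNNExtension.of g) = f g) ∧
      F HNNExtension.t = x := by
  refine ⟨HNNExtension.lift f x ?_, fun g => HNNExtension.lift_of f x _ g,
    HNNExtension.lift_t f x _⟩
  intro a
  obtain ⟨h, rfl⟩ := (MonoidHom.ofInjective h₂).surjective a
  rw [hnn_equiv_apply]
  exact hx h

end HNN

/-! ### Flexible stability in permutations -/

/-- `T` preserves the stabilizer of every point at which it intertwines the two actions. -/
theorem abs_stabCount_sub_le {H Z : Type*} [Group H] [Finite Z] (a b : H →* Equiv.Perm Z)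
    (T : Equiv.Perm Z) (L : Set H) :
    |(stabCount a L : ℝ) - stabCount b L| ≤ Nat.card {z // ∃ h, a h (T z) ≠ T (b h z)} := by
  have hfix : ∀ z, (¬ ∃ h, a h (T z) ≠ T (b h z)) → fixSet a (T z) = fixSet b z := by
    intro z hz
    push Not at hz
    ext h
    simp [fixSet, hz h]
  have ha : stabCount a L = {z | fixSet a (T z) = L}.ncard :=
    (Nat.card_congr (T.subtypeEquiv fun _ => Iff.rfl)).symm
  have hb : stabCount b L = {z | fixSet b z = L}.ncard := rfl
  have hc : Nat.card {z // ∃ h, a h (T z) ≠ T (b h z)} =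
    {z | ∃ h, a h (T z) ≠ T (b h z)}.ncard := rfl
  have h1 : {z | fixSet a (T z) = L} ⊆ {z | fixSet b z = L} ∪ {z | ∃ h, a h (T z) ≠ T (b h z)} := by
    intro z hz
    by_cases h : ∃ h, a h (T z) ≠ T (b h z)
    · exact Or.inr h
    · exact Or.inl ((hfix z h).symm.trans hz)
  have h2 : {z | fixSet b z = L} ⊆ {z | fixSet a (T z) = L} ∪ {z | ∃ h, a h (T z) ≠ T (b h z)} := by
    intro z hz
    by_cases h : ∃ h, a h (T z) ≠ T (b h z)
    · exact Or.inr h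
    · exact Or.inl ((hfix z h).trans hz)
  have h3 := (Set.ncard_le_ncard h1 (Set.toFinite _)).trans (Set.ncard_union_le _ _)
  have h4 := (Set.ncard_le_ncard h2 (Set.toFinite _)).trans (Set.ncard_union_le _ _)
  rw [ha, hb, hc, abs_sub_le_iff]
  constructor
  · rw [sub_le_iff_le_add']
    exact_mod_cast h3
  · rw [sub_le_iff_le_add']
    exact_mod_cast h4

/-- The points where `T` is equivariant for all of `H` form an invariant set, so `T` restricted to
it is a partial equivariant injection and `exists_equivariant_equiv` completes it. -/
theorem exists_intertwiner_of_stabDefect_eq_zero {G H Z : Type*} [Group G] [Group H] [Finite Z]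
    (i₁ i₂ : H →* G) (ρ : G →* Equiv.Perm Z) (h0 : stabDefect i₁ i₂ ρ = 0) (T : Equiv.Perm Z) :
    ∃ τ : Equiv.Perm Z, (∀ h, τ * ρ (i₂ h) = ρ (i₁ h) * τ) ∧
      ∀ z, (∀ h, ρ (i₁ h) (T z) = T (ρ (i₂ h) z)) → τ z = T z := by
  obtain ⟨τ, hτ, hτ'⟩ := exists_equivariant_equiv (a := ρ.comp i₂) (b := ρ.comp i₁)
    (fun L => by
      have := congrFun h0 L
      rw [stabDefect, Pi.zero_apply, sub_eq_zero] at this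
      exact_mod_cast this.symm)
    {z | ∀ h, ρ (i₁ h) (T z) = T (ρ (i₂ h) z)} T T.injective.injOn
    (fun k z hz h => by
      have h1 := hz (h * k)
      simp only [map_mul, Equiv.Perm.mul_apply] at h1
      simp only [MonoidHom.comp_apply]
      rw [← h1, hz k])
    (fun h z hz => (hz h).symm)
  exact ⟨τ, fun h => Equiv.ext (hτ h), hτ'⟩

theorem flexiblyPStable_hnn {G H : Type*} [Group G] [Group H] [Finite H]
    (i₁ i₂ : H →* G) (h₁ : Function.Injective i₁) (h₂ : Function.Injective i₂)
    (hn₁ : IsAlmostNormal i₁.range) (hn₂ : IsAlmostNormal i₂.range) (hG : FlexiblyPStable G) :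
    FlexiblyPStable (HNNOfEmbeddings i₁ i₂ h₁ h₂) := by
  classical
  intro X _ _ φ hφ₀
  have hφ : ∀ a b, Negligible X fun n x => φ n a (φ n b x) ≠ φ n (a * b) x := hφ₀
  obtain ⟨Y, _, ι, ψ, hψ₀, hcard⟩ := hG X (fun n g => φ n (HNNExtension.of g)) fun a b => by
    simpa using hφ₀ (HNNExtension.of a) (HNNExtension.of b)
  have hψ : ∀ g, Negligible X fun n x => ι n (φ n (HNNExtension.of g) x) ≠ ψ n g (ι n x) := hψ₀
  have hrel : ∀ h, Negligible X fun n x =>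
      φ n (HNNExtension.of (i₁ h)) (φ n HNNExtension.t x) ≠
        φ n HNNExtension.t (φ n (HNNExtension.of (i₂ h)) x) := by
    intro h
    refine ((hφ (HNNExtension.of (i₁ h)) HNNExtension.t).or
      (hφ HNNExtension.t (HNNExtension.of (i₂ h)))).mono fun n x hx => ?_
    by_contra! hcon
    exact hx (by rw [hcon.1, hcon.2, hnn_t_mul_of])
  -- the elements of `H` acting asymptotically nontrivially
  let bad : H → Prop := fun h => ¬ Negligible X fun n x => φ n (HNNExtension.of (i₁ h)) x ≠ x
  -- Up to negligible sets, φ(`t`) carries the fixed points of `i₂ h` onto those of `i₁ h`.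
  have hgood₂ : ∀ h, ¬ bad h ↔ Negligible X fun n x => φ n (HNNExtension.of (i₂ h)) x ≠ x := by
    intro h
    simp only [bad, not_not]
    constructor
    · intro hh
      refine ((hh.comap (fun n => φ n HNNExtension.t)
        fun n => (φ n HNNExtension.t).injective).or (hrel h)).mono fun n x hx => ?_
      by_contra! hcon
      rw [hcon.1] at hcon
      exact hx ((φ n HNNExtension.t).injective hcon.2).symm
    · intro hh
      refine ((hh.or (hrel h)).comap (fun n => (φ n HNNExtension.t).symm)
        fun n => (φ n HNNExtension.t).symm.injective).mono fun n x hx => ?_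
      by_contra! hcon
      rw [hcon.1] at hcon
      simp only [Equiv.apply_symm_apply] at hcon
      exact hx hcon.2
  let u : H ⊕ H → G := Sum.elim i₁ i₂
  let ubad : H ⊕ H → Prop := Sum.elim bad bad
  have hubad : ∀ s, ¬ ubad s ↔ Negligible X fun n x => φ n (HNNExtension.of (u s)) x ≠ x := by
    rintro (h | h)
    · simp [ubad, u, bad]
    · exact hgood₂ h
  have hψu : ∀ s, ¬ ubad s → Negligible X fun n y => ψ n (u s) y ≠ y := by
    intro s hs
    refine Negligible.of_embedding ι hcard ((((hubad s).mp hs).or (hψ (u s))).mono ?_)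
    intro n x hx
    by_contra! hcon
    exact hx (by rw [← hcon.2, hcon.1])
  have hconj : ∀ s, (Set.range fun g : G => g * u s * g⁻¹).Finite := by
    rintro (h | h)
    · exact finite_conjugates_of_isAlmostNormal i₁ hn₁ h
    · exact finite_conjugates_of_isAlmostNormal i₂ hn₂ h
  -- the common fixed points of the asymptotically trivial elements
  let S : ∀ n, Set (Y n) := fun n => {y | ∀ s, ¬ ubad s → ∀ g, ψ n (g * u s * g⁻¹) y = y}
  have hS : ∀ n g, ∀ y ∈ S n, ψ n g y ∈ S n := by
    intro n g y hy s hs k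
    have h1 := hy s hs (g⁻¹ * k)
    rw [show g⁻¹ * k * u s * (g⁻¹ * k)⁻¹ = g⁻¹ * (k * u s * k⁻¹) * g by group] at h1
    simp only [map_mul, Equiv.Perm.mul_apply, map_inv, Equiv.Perm.inv_eq_iff_eq] at h1 ⊢
    exact h1
  -- Almost normality is used here: only finitely many conjugates occur, so a finite union of
  -- negligible sets suffices.
  have hSc : Negligible X fun n y => y ∉ S n := by
    have hconjneg : ∀ s, ¬ ubad s → ∀ g, Negligible X fun n y => ψ n (g * u s * g⁻¹) y ≠ y := by
      intro s hs g
      refine ((hψu s hs).comap (fun n => ψ n g⁻¹) fun n => (ψ n g⁻¹).injective).mono ?_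
      intro n y hy hcon
      apply hy
      rw [map_mul, map_mul, Equiv.Perm.mul_apply, Equiv.Perm.mul_apply, hcon,
        ← Equiv.Perm.mul_apply, ← map_mul]
      simp
    have hfin := Negligible.exists_of_finite (X := X) (Y := Y) (ι := H ⊕ H)
      (p := fun s n y => ∃ c ∈ (hconj s).toFinset, ¬ ubad s ∧ ψ n c y ≠ y) fun s =>
        Negligible.exists_mem _ fun c hc => by
          obtain ⟨g, rfl⟩ := (hconj s).mem_toFinset.mp hc
          by_cases hs : ubad s
          · simp [hs, Negligible]
          · simpa [hs] using hconjneg s hs g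
    refine hfin.mono fun n y hy => ?_
    simp only [S, Set.mem_ofPred_eq, not_forall] at hy
    obtain ⟨s, hs, g, hg⟩ := hy
    exact ⟨s, _, (hconj s).mem_toFinset.mpr ⟨g, rfl⟩, hs, hg⟩
  let ψ' : ∀ n, G →* Equiv.Perm (Y n) := fun n => trivializeOff (ψ n) (S n) (hS n)
  have hψ' : ∀ g, Negligible X fun n x => ι n (φ n (HNNExtension.of g) x) ≠ ψ' n g (ι n x) := by
    intro g
    refine ((hψ g).or (hSc.comap (fun n => ι n) fun n => (ι n).injective)).mono fun n x hx => ?_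
    by_contra! hcon
    exact hx (hcon.1.trans (trivializeOff_of_mem hcon.2 g).symm)
  have hψ'u : ∀ n s, ¬ ubad s → ψ' n (u s) = 1 := by
    intro n s hs
    ext y
    by_cases hy : y ∈ S n
    · rw [trivializeOff_of_mem hy]
      simpa using hy s hs 1
    · rw [trivializeOff_of_notMem hy, Equiv.Perm.one_apply]
  -- a finite quotient detecting the remaining elements
  obtain ⟨k, α, hα, hα'⟩ := exists_perm_action_free u ubad fun s hs => by
    -- If `u s` acted trivially for all n, it would be asymptotically trivial under φ. A single n
    -- suffices, since its kernel already contains all the good elements.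
    obtain ⟨n, hn⟩ : ∃ n, ψ' n (u s) ≠ 1 := by
      by_contra! hcon
      refine (hubad s).not.mp (not_not.mpr hs) ((hψ' (u s)).mono fun n x hx h => hx ?_)
      rw [hcon n, Equiv.Perm.one_apply] at h
      exact (ι n).injective h
    have : (ψ' n).ker.FiniteIndex := inferInstance
    exact ⟨(ψ' n).ker, inferInstance, this, hn, fun s' hs' => hψ'u n s' hs'⟩
  obtain ⟨C, hC⟩ := exists_perm_correction i₁ i₂ bad α
    (fun h hh => ⟨hα (Sum.inl h) hh, hα (Sum.inr h) hh⟩)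
    (fun h hh x => ⟨hα' (Sum.inl h) hh x, hα' (Sum.inr h) hh x⟩)
  -- φ(`t`) is extended by the identity off the image of X n.
  let T : ∀ n, Equiv.Perm (Y n) := fun n => (φ n HNNExtension.t).viaEmbedding (ι n)
  have hT : ∀ n x, T n (ι n x) = ι n (φ n HNNExtension.t x) := fun n x =>
    Equiv.Perm.viaEmbedding_apply _ _ _
  have hTneg : Negligible X fun n y => ∃ h, ψ' n (i₁ h) (T n y) ≠ T n (ψ' n (i₂ h) y) := by
    refine Negligible.of_embedding ι hcard (Negligible.exists_of_finite fun h => ?_)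
    refine (((hψ' (i₁ h)).comap (fun n => φ n HNNExtension.t)
      fun n => (φ n HNNExtension.t).injective).or ((hrel h).or (hψ' (i₂ h)))).mono fun n x hx => ?_
    by_contra! hcon
    apply hx
    rw [hT, ← hcon.1, hcon.2.1, ← hcon.2.2, hT]
  -- The defect is bounded by the number of points where `T n` fails to intertwine, so the set to be
  -- added has o(|X n|) points.
  have hcorr := fun n => hC (Y n) (ψ' n) _
    (fun h hh => ⟨hψ'u n (Sum.inl h) hh, hψ'u n (Sum.inr h) hh⟩)
    (abs_stabCount_sub_le _ _ (T n)) (Nat.cast_nonneg _)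
  choose c σ hc hσ using hcorr
  let ρ : ∀ n, G →* Equiv.Perm (Y n ⊕ Fin (c n)) := fun n => sumAction (ψ' n) (σ n)
  have hρ : ∀ n, stabDefect i₁ i₂ (ρ n) = 0 := fun n => by
    rw [stabDefect_sumAction, hσ, add_neg_cancel]
  choose τ hτ hτ' using fun n => exists_intertwiner_of_stabDefect_eq_zero i₁ i₂ (ρ n) (hρ n)
    ((T n).sumCongr (Equiv.refl _))
  choose Ψ hΨ hΨt using fun n => exists_hnn_lift (h₁ := h₁) (h₂ := h₂) (ρ n) (τ n) (hτ n)
  let κ : ∀ n, X n ↪ Y n ⊕ Fin (c n) := fun n => (ι n).trans Function.Embedding.inl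
  refine ⟨fun n => Y n ⊕ Fin (c n), fun n => inferInstance, κ, Ψ, fun a => ?_, ?_⟩
  · change Negligible X fun n x => κ n (φ n a x) ≠ Ψ n a (κ n x)
    induction a using HNNExtension.induction_on with
    | of g =>
      refine (hψ' g).mono fun n x hx h => hx ?_
      simp only [κ, hΨ, ρ, Function.Embedding.trans_apply, Function.Embedding.inl_apply,
        sumAction_inl, h]
    | t =>
      refine (hTneg.comap (fun n => ι n) fun n => (ι n).injective).mono fun n x hx => ?_
      by_contra! hcon
      apply hx
      rw [hΨt, hτ' n (κ n x) fun h => ?_]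
      · simp [κ, hT]
      · simp [κ, ρ, hcon h]
    | mul a b ha hb => exact negligible_mul hφ (fun n => κ n) Ψ ha hb
    | inv a ha => exact negligible_inv hφ (fun n => κ n) Ψ ha
  · have hc0 : Tendsto (fun n => (c n : ℝ) / (Nat.card (X n) : ℝ)) atTop (𝓝 0) := by
      have h1 := Tendsto.const_mul C hTneg
      rw [mul_zero] at h1
      refine squeeze_zero (fun n => by positivity) (fun n => ?_) h1
      rw [← mul_div_assoc]
      gcongr
      exact hc n
    have h2 := hcard.add hc0
    rw [add_zero] at h2
    refine h2.congr fun n => ?_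
    rw [Nat.card_sum, Nat.card_fin, Nat.cast_add, add_div]

/-! ### The Hilbert–Schmidt norm -/

section HS

variable {X Y Z : Type*} [NormedAddCommGroup X] [InnerProductSpace ℂ X] [FiniteDimensional ℂ X]
  [NormedAddCommGroup Y] [InnerProductSpace ℂ Y] [FiniteDimensional ℂ Y]
  [NormedAddCommGroup Z] [InnerProductSpace ℂ Z] [FiniteDimensional ℂ Z]

/-- The unnormalized Hilbert–Schmidt norm of a linear map. -/
noncomputable def hs (A : X →ₗ[ℂ] Y) : ℝ :=
  Real.sqrt (LinearMap.trace ℂ X (LinearMap.adjoint A ∘ₗ A)).re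

theorem re_trace_adjoint_comp_self {ι : Type*} [Fintype ι] (b : OrthonormalBasis ι ℂ X)
    (A : X →ₗ[ℂ] Y) :
    (LinearMap.trace ℂ X (LinearMap.adjoint A ∘ₗ A)).re = ∑ i, ‖A (b i)‖ ^ 2 := by
  rw [LinearMap.trace_eq_sum_inner _ b, Complex.re_sum]
  refine Finset.sum_congr rfl fun i _ => ?_
  rw [LinearMap.comp_apply, LinearMap.adjoint_inner_right, inner_self_eq_norm_sq_to_K]
  norm_cast

theorem hs_nonneg (A : X →ₗ[ℂ] Y) : 0 ≤ hs A := Real.sqrt_nonneg _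

theorem hs_sq (A : X →ₗ[ℂ] Y) :
    hs A ^ 2 = (LinearMap.trace ℂ X (LinearMap.adjoint A ∘ₗ A)).re := by
  rw [hs, Real.sq_sqrt]
  rw [re_trace_adjoint_comp_self (stdOrthonormalBasis ℂ X)]
  positivity

theorem hs_sq_eq_sum {ι : Type*} [Fintype ι] (b : OrthonormalBasis ι ℂ X) (A : X →ₗ[ℂ] Y) :
    hs A ^ 2 = ∑ i, ‖A (b i)‖ ^ 2 := by
  rw [hs_sq, re_trace_adjoint_comp_self b]

theorem hs_eq_norm (A : X →ₗ[ℂ] Y) :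
    hs A = ‖(WithLp.toLp 2 fun i => A (stdOrthonormalBasis ℂ X i) :
      PiLp 2 fun _ : Fin (Module.finrank ℂ X) => Y)‖ := by
  rw [PiLp.norm_eq_of_L2, hs, re_trace_adjoint_comp_self (stdOrthonormalBasis ℂ X)]

theorem hsNorm_eq (A : X →ₗ[ℂ] X) : hsNorm A = hs A / Real.sqrt (Module.finrank ℂ X) := by
  rw [hsNorm, hs, Real.sqrt_div' _ (Nat.cast_nonneg _)]

@[simp]
theorem hs_zero : hs (0 : X →ₗ[ℂ] Y) = 0 := by simp [hs]

theorem hs_add_le (A B : X →ₗ[ℂ] Y) : hs (A + B) ≤ hs A + hs B := by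
  have h : (WithLp.toLp 2 fun i => (A + B) (stdOrthonormalBasis ℂ X i) :
      PiLp 2 fun _ : Fin (Module.finrank ℂ X) => Y) =
      WithLp.toLp 2 (fun i => A (stdOrthonormalBasis ℂ X i)) +
        WithLp.toLp 2 fun i => B (stdOrthonormalBasis ℂ X i) := rfl
  rw [hs_eq_norm, hs_eq_norm, hs_eq_norm, h]
  exact norm_add_le _ _

theorem hs_smul (c : ℂ) (A : X →ₗ[ℂ] Y) : hs (c • A) = ‖c‖ * hs A := by
  rw [hs_eq_norm, hs_eq_norm, ← norm_smul]
  rfl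

theorem hs_neg (A : X →ₗ[ℂ] Y) : hs (-A) = hs A := by
  simpa using hs_smul (-1) A

theorem hs_sub_comm (A B : X →ₗ[ℂ] Y) : hs (A - B) = hs (B - A) := by
  rw [← hs_neg, neg_sub]

theorem hs_sub_le (A B C : X →ₗ[ℂ] Y) : hs (A - C) ≤ hs (A - B) + hs (B - C) := by
  simpa using hs_add_le (A - B) (B - C)

theorem hs_sum_le {ι : Type*} (s : Finset ι) (A : ι → X →ₗ[ℂ] Y) :
    hs (∑ i ∈ s, A i) ≤ ∑ i ∈ s, hs (A i) := by
  classical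
  induction s using Finset.induction_on with
  | empty => simp
  | insert i s hi ih =>
    rw [Finset.sum_insert hi, Finset.sum_insert hi]
    exact (hs_add_le _ _).trans (by gcongr)

theorem hs_le_mul_of_norm_le {A : X →ₗ[ℂ] Y} {B : X →ₗ[ℂ] Z} {c : ℝ} (hc : 0 ≤ c)
    (h : ∀ x, ‖A x‖ ≤ c * ‖B x‖) : hs A ≤ c * hs B := by
  refine le_of_sq_le_sq ?_ (mul_nonneg hc (hs_nonneg B))
  rw [mul_pow, hs_sq_eq_sum (stdOrthonormalBasis ℂ X), hs_sq_eq_sum (stdOrthonormalBasis ℂ X),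
    Finset.mul_sum]
  refine Finset.sum_le_sum fun i _ => ?_
  rw [← mul_pow]
  gcongr
  exact h _

theorem hs_le_of_norm_le {A : X →ₗ[ℂ] Y} {B : X →ₗ[ℂ] Z} (h : ∀ x, ‖A x‖ ≤ ‖B x‖) :
    hs A ≤ hs B := by
  simpa using hs_le_mul_of_norm_le zero_le_one (by simpa using h)

theorem hs_comp_of_isometry (B : Y →ₗ[ℂ] Z) (hB : ∀ y, ‖B y‖ = ‖y‖) (A : X →ₗ[ℂ] Y) :
    hs (B ∘ₗ A) = hs A :=
  le_antisymm (hs_le_of_norm_le fun _ => (hB _).le) (hs_le_of_norm_le fun _ => (hB _).ge)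

theorem hs_comp_le (B : Y →ₗ[ℂ] Z) (hB : ∀ y, ‖B y‖ ≤ ‖y‖) (A : X →ₗ[ℂ] Y) :
    hs (B ∘ₗ A) ≤ hs A :=
  hs_le_of_norm_le fun _ => hB _

theorem hs_adjoint (A : X →ₗ[ℂ] Y) : hs (LinearMap.adjoint A) = hs A := by
  rw [hs, hs, LinearMap.adjoint_adjoint, LinearMap.trace_comp_comm']

theorem norm_adjoint_apply_le {B : X →ₗ[ℂ] Y} (hB : ∀ x, ‖B x‖ ≤ ‖x‖) (y : Y) :
    ‖LinearMap.adjoint B y‖ ≤ ‖y‖ := by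
  by_contra! hcon
  have h1 : ‖LinearMap.adjoint B y‖ * ‖LinearMap.adjoint B y‖ ≤
      ‖y‖ * ‖LinearMap.adjoint B y‖ := by
    rw [← inner_self_eq_norm_mul_norm (𝕜 := ℂ), LinearMap.adjoint_inner_left]
    refine (re_inner_le_norm _ _).trans ?_
    gcongr
    exact hB _
  have h2 : 0 < ‖LinearMap.adjoint B y‖ := (norm_nonneg y).trans_lt hcon
  exact absurd (le_of_mul_le_mul_right h1 h2) (not_le.mpr hcon)

/-- Taking adjoints turns this into composition with a contraction on the left. -/
theorem hs_comp_le_right (A : Y →ₗ[ℂ] Z) (B : X →ₗ[ℂ] Y) (hB : ∀ x, ‖B x‖ ≤ ‖x‖) :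
    hs (A ∘ₗ B) ≤ hs A := by
  rw [← hs_adjoint, LinearMap.adjoint_comp, ← hs_adjoint A]
  exact hs_comp_le _ (norm_adjoint_apply_le hB) _

theorem hs_comp_equiv (A : Y →ₗ[ℂ] Z) (e : X ≃ₗᵢ[ℂ] Y) :
    hs (A ∘ₗ e.toLinearEquiv.toLinearMap) = hs A := by
  refine le_antisymm (hs_comp_le_right _ _ fun x => (e.norm_map x).le) ?_
  have h := hs_comp_le_right (A ∘ₗ e.toLinearEquiv.toLinearMap) e.symm.toLinearEquiv.toLinearMap
    fun x => (e.symm.norm_map x).le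
  refine le_trans (le_of_eq ?_) h
  congr 1
  ext x
  simp

theorem sum_norm_le_sqrt_mul_hs (A : X →ₗ[ℂ] Y) :
    ∑ i, ‖A (stdOrthonormalBasis ℂ X i)‖ ≤ Real.sqrt (Module.finrank ℂ X) * hs A := by
  have h := Finset.sum_mul_sq_le_sq_mul_sq Finset.univ (fun _ => (1 : ℝ))
    fun i => ‖A (stdOrthonormalBasis ℂ X i)‖
  simp only [one_mul, one_pow, Finset.sum_const, Finset.card_univ, Fintype.card_fin,
    nsmul_eq_mul, mul_one, ← hs_sq_eq_sum] at h
  refine le_of_sq_le_sq ?_ (mul_nonneg (Real.sqrt_nonneg _) (hs_nonneg A))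
  rwa [mul_pow, Real.sq_sqrt (Nat.cast_nonneg _)]

theorem norm_trace_le (A : X →ₗ[ℂ] X) :
    ‖LinearMap.trace ℂ X A‖ ≤ Real.sqrt (Module.finrank ℂ X) * hs A := by
  rw [LinearMap.trace_eq_sum_inner _ (stdOrthonormalBasis ℂ X)]
  refine (norm_sum_le _ _).trans (le_trans (Finset.sum_le_sum fun i _ => ?_)
    (sum_norm_le_sqrt_mul_hs A))
  refine (norm_inner_le_norm _ _).trans ?_
  simp

theorem trace_adjoint (A : X →ₗ[ℂ] X) :
    LinearMap.trace ℂ X (LinearMap.adjoint A) = starRingEnd ℂ (LinearMap.trace ℂ X A) := by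
  rw [LinearMap.trace_eq_sum_inner _ (stdOrthonormalBasis ℂ X),
    LinearMap.trace_eq_sum_inner _ (stdOrthonormalBasis ℂ X), map_sum]
  refine Finset.sum_congr rfl fun i _ => ?_
  rw [LinearMap.adjoint_inner_right, inner_conj_symm]

/-- The squared Hilbert–Schmidt norm of an orthogonal projection is its trace. -/
theorem hs_sq_of_projection {P : X →ₗ[ℂ] X} (hP : LinearMap.adjoint P = P) (hP2 : P ∘ₗ P = P) :
    hs P ^ 2 = (LinearMap.trace ℂ X P).re := by
  rw [hs_sq, hP, hP2]

theorem hs_id_sub_sq_of_projection {P : X →ₗ[ℂ] X} (hP : LinearMap.adjoint P = P)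
    (hP2 : P ∘ₗ P = P) :
    hs (LinearMap.id - P) ^ 2 = Module.finrank ℂ X - (LinearMap.trace ℂ X P).re := by
  rw [hs_sq_of_projection]
  · rw [map_sub, LinearMap.trace_id]
    simp
  · rw [map_sub, hP, LinearMap.adjoint_id]
  · rw [LinearMap.sub_comp, LinearMap.comp_sub, LinearMap.comp_sub, hP2]
    simp

theorem adjoint_comp_isometry (ι : X →ₗᵢ[ℂ] Y) :
    LinearMap.adjoint ι.toLinearMap ∘ₗ ι.toLinearMap = LinearMap.id := by
  ext x
  refine ext_inner_right ℂ fun y => ?_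
  rw [LinearMap.comp_apply, LinearMap.adjoint_inner_left]
  exact ι.inner_map_map x y

theorem hs_id_sub_range_projection_sq (ι : X →ₗᵢ[ℂ] Y) :
    hs (LinearMap.id - ι.toLinearMap ∘ₗ LinearMap.adjoint ι.toLinearMap) ^ 2 =
      Module.finrank ℂ Y - Module.finrank ℂ X := by
  rw [hs_id_sub_sq_of_projection, LinearMap.trace_comp_comm', adjoint_comp_isometry,
    LinearMap.trace_id]
  · simp
  · rw [LinearMap.adjoint_comp, LinearMap.adjoint_adjoint]
  · rw [LinearMap.comp_assoc, ← LinearMap.comp_assoc _ _ (LinearMap.adjoint ι.toLinearMap),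
      adjoint_comp_isometry, LinearMap.id_comp]

/-- An isometry is close to a compression exactly if it is nearly intertwined with the original. -/
theorem hs_comp_sub_comp_sq_le (ι : X →ₗᵢ[ℂ] Y) (U : X ≃ₗᵢ[ℂ] X) (V : Y ≃ₗᵢ[ℂ] Y) :
    hs (ι.toLinearMap ∘ₗ unitaryOp U - unitaryOp V ∘ₗ ι.toLinearMap) ^ 2 ≤
      2 * (Real.sqrt (Module.finrank ℂ X) *
        hs (unitaryOp U - compression ι (unitaryOp V))) := by
  rw [hs_sq_eq_sum (stdOrthonormalBasis ℂ X)]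
  refine le_trans ?_ (mul_le_mul_of_nonneg_left (sum_norm_le_sqrt_mul_hs _) zero_le_two)
  rw [Finset.mul_sum]
  refine Finset.sum_le_sum fun i _ => ?_
  set x := stdOrthonormalBasis ℂ X i with hx
  have hx1 : ‖x‖ = 1 := (stdOrthonormalBasis ℂ X).orthonormal.1 i
  -- For unit x the left side equals 2 Re⟨Ux, Ux - ι*Vιx⟩. Only the first power of the error remains
  -- on the right, and Cauchy–Schwarz over the basis produces the factor √dim.
  change ‖ι (U x) - V (ι x)‖ ^ 2 ≤ 2 * ‖U x - LinearMap.adjoint ι.toLinearMap (V (ι x))‖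
  have h1 : ‖ι (U x)‖ = 1 := by rw [ι.norm_map, U.norm_map, hx1]
  have h2 : ‖V (ι x)‖ = 1 := by rw [V.norm_map, ι.norm_map, hx1]
  rw [@norm_sub_sq ℂ, h1, h2]
  have h3 : RCLike.re (inner ℂ (U x) (U x - LinearMap.adjoint ι.toLinearMap (V (ι x)))) =
      1 - RCLike.re (inner ℂ (ι (U x)) (V (ι x))) := by
    rw [inner_sub_right, map_sub, LinearMap.adjoint_inner_right, inner_self_eq_norm_sq (𝕜 := ℂ),
      U.norm_map, hx1]
    norm_num
  have h4 := re_inner_le_norm (𝕜 := ℂ) (U x) (U x - LinearMap.adjoint ι.toLinearMap (V (ι x)))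
  rw [U.norm_map, hx1, one_mul, h3] at h4
  linarith

theorem hs_sub_compression_le (ι : X →ₗᵢ[ℂ] Y) (U : X →ₗ[ℂ] X) (V : Y →ₗ[ℂ] Y) :
    hs (U - compression ι V) ≤ hs (ι.toLinearMap ∘ₗ U - V ∘ₗ ι.toLinearMap) := by
  have h : U - compression ι V =
      LinearMap.adjoint ι.toLinearMap ∘ₗ (ι.toLinearMap ∘ₗ U - V ∘ₗ ι.toLinearMap) := by
    rw [LinearMap.comp_sub, ← LinearMap.comp_assoc, adjoint_comp_isometry, LinearMap.id_comp]
    rfl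
  rw [h]
  exact hs_comp_le _ (norm_adjoint_apply_le fun x => (ι.norm_map x).le) _

end HS

/-! ### Unitary representations and their characters -/

section URep

variable {G : Type*} [Group G]
  {V W : Type*} [NormedAddCommGroup V] [InnerProductSpace ℂ V]
  [NormedAddCommGroup W] [InnerProductSpace ℂ W]

/-- The linear representation underlying a unitary representation. -/
def linRep (ρ : G →* (V ≃ₗᵢ[ℂ] V)) : Representation ℂ G V where
  toFun g := unitaryOp (ρ g)
  map_one' := by rw [map_one]; rfl
  map_mul' a b := by rw [map_mul]; rfl

/-- The character of a unitary representation. -/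
noncomputable def uchar (ρ : G →* (V ≃ₗᵢ[ℂ] V)) (g : G) : ℂ :=
  LinearMap.trace ℂ V (unitaryOp (ρ g))

/-- A linear representation by isometries, as a unitary representation. -/
def ofIsometric (f : G →* (V →ₗ[ℂ] V)) (hf : ∀ g v, ‖f g v‖ = ‖v‖) : G →* (V ≃ₗᵢ[ℂ] V) where
  toFun g :=
    { toLinearEquiv := LinearEquiv.ofLinearMap (f g) (f g⁻¹)
        (by rw [← Module.End.mul_eq_comp, ← map_mul, mul_inv_cancel, map_one]; rfl)
        (by rw [← Module.End.mul_eq_comp, ← map_mul, inv_mul_cancel, map_one]; rfl)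
      norm_map' := hf g }
  map_one' := by
    ext v
    change f 1 v = v
    rw [map_one]
    rfl
  map_mul' a b := by
    ext v
    change f (a * b) v = f a (f b v)
    rw [map_mul]
    rfl

theorem urep_mul_apply (ρ : G →* (V ≃ₗᵢ[ℂ] V)) (a b : G) (v : V) :
    ρ (a * b) v = ρ a (ρ b v) := by
  rw [map_mul]
  rfl

theorem urep_inv_apply_self (ρ : G →* (V ≃ₗᵢ[ℂ] V)) (a : G) (v : V) : ρ a⁻¹ (ρ a v) = v := by
  rw [← urep_mul_apply]
  simp

theorem urep_apply_inv_self (ρ : G →* (V ≃ₗᵢ[ℂ] V)) (a : G) (v : V) : ρ a (ρ a⁻¹ v) = v := by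
  rw [← urep_mul_apply]
  simp

theorem urep_inner_inv_left (ρ : G →* (V ≃ₗᵢ[ℂ] V)) (a : G) (v w : V) :
    inner ℂ (ρ a⁻¹ v) w = inner ℂ v (ρ a w) := by
  rw [← (ρ a).inner_map_map, urep_apply_inv_self]

theorem uchar_one (ρ : G →* (V ≃ₗᵢ[ℂ] V)) [FiniteDimensional ℂ V] :
    uchar ρ 1 = Module.finrank ℂ V := by
  rw [uchar, map_one]
  exact LinearMap.trace_one ℂ V

theorem uchar_eq_finrank_of_eq_one (ρ : G →* (V ≃ₗᵢ[ℂ] V)) [FiniteDimensional ℂ V] {g : G}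
    (hg : ρ g = 1) : uchar ρ g = Module.finrank ℂ V := by
  rw [← uchar_one ρ, uchar, uchar, hg, map_one]

theorem adjoint_unitaryOp [FiniteDimensional ℂ V] (u : V ≃ₗᵢ[ℂ] V) :
    LinearMap.adjoint (unitaryOp u) = unitaryOp u⁻¹ := by
  symm
  rw [LinearMap.eq_adjoint_iff]
  intro x y
  change inner ℂ (u.symm x) y = inner ℂ x (u y)
  rw [← u.inner_map_map, u.apply_symm_apply]

theorem uchar_inv [FiniteDimensional ℂ V] (ρ : G →* (V ≃ₗᵢ[ℂ] V)) (g : G) :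
    uchar ρ g⁻¹ = starRingEnd ℂ (uchar ρ g) := by
  rw [uchar, uchar, map_inv, ← adjoint_unitaryOp, trace_adjoint]

theorem uchar_congr {ρ : G →* (V ≃ₗᵢ[ℂ] V)} {σ : G →* (W ≃ₗᵢ[ℂ] W)} (e : V ≃ₗ[ℂ] W)
    (he : ∀ g v, e (ρ g v) = σ g (e v)) (g : G) : uchar ρ g = uchar σ g := by
  rw [uchar, uchar, ← LinearMap.trace_conj' _ e]
  congr 1
  ext w
  change e (ρ g (e.symm w)) = σ g w
  rw [he, e.apply_symm_apply]

/-- The conjugate of a unitary representation by an isometry. -/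
def conjRep (ρ : G →* (V ≃ₗᵢ[ℂ] V)) (e : V ≃ₗᵢ[ℂ] W) : G →* (W ≃ₗᵢ[ℂ] W) where
  toFun g := (e.symm.trans (ρ g)).trans e
  map_one' := by
    ext w
    simp
  map_mul' a b := by
    ext w
    simp

theorem uchar_conjRep (ρ : G →* (V ≃ₗᵢ[ℂ] V)) (e : V ≃ₗᵢ[ℂ] W) (g : G) :
    uchar (conjRep ρ e) g = uchar ρ g :=
  (uchar_congr e.toLinearEquiv (fun g v => by simp [conjRep]) g).symm

/-- The restriction of a unitary representation to an invariant subspace. -/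
noncomputable def subRep (ρ : G →* (V ≃ₗᵢ[ℂ] V)) (E : Submodule ℂ V) (hE : ∀ g, ∀ v ∈ E, ρ g v ∈ E) :
    G →* (E ≃ₗᵢ[ℂ] E) :=
  ofIsometric
    { toFun := fun g => (unitaryOp (ρ g)).restrict (hE g)
      map_one' := by
        ext v
        change ρ 1 (v : V) = v
        rw [map_one]
        rfl
      map_mul' := fun a b => by
        ext v
        exact urep_mul_apply ρ a b v } fun g v => (ρ g).norm_map v

@[simp]
theorem coe_subRep_apply (ρ : G →* (V ≃ₗᵢ[ℂ] V)) (E : Submodule ℂ V)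
    (hE : ∀ g, ∀ v ∈ E, ρ g v ∈ E) (g : G) (v : E) : (subRep ρ E hE g v : V) = ρ g v := rfl

theorem orthogonal_invariant {ρ : G →* (V ≃ₗᵢ[ℂ] V)} {E : Submodule ℂ V}
    (hE : ∀ g, ∀ v ∈ E, ρ g v ∈ E) : ∀ g, ∀ v ∈ Eᗮ, ρ g v ∈ Eᗮ := by
  intro g v hv w hw
  rw [← urep_inner_inv_left]
  exact hv _ (hE _ _ hw)

theorem starProjection_commute [FiniteDimensional ℂ V] {ρ : G →* (V ≃ₗᵢ[ℂ] V)} {E : Submodule ℂ V}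
    (hE : ∀ g, ∀ v ∈ E, ρ g v ∈ E) (g : G) (v : V) :
    E.starProjection (ρ g v) = ρ g (E.starProjection v) := by
  refine (Submodule.eq_starProjection_of_mem_orthogonal (hE g _ (Submodule.starProjection_apply_mem _ _)) ?_)
  rw [← map_sub]
  exact orthogonal_invariant hE g _ (Submodule.sub_starProjection_mem_orthogonal v)

theorem uchar_subRep [FiniteDimensional ℂ V] (ρ : G →* (V ≃ₗᵢ[ℂ] V)) (E : Submodule ℂ V)
    (hE : ∀ g, ∀ v ∈ E, ρ g v ∈ E) (g : G) :
    uchar (subRep ρ E hE) g =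
      LinearMap.trace ℂ V (unitaryOp (ρ g) ∘ₗ E.starProjection.toLinearMap) := by
  have h1 : unitaryOp (subRep ρ E hE g) =
      E.orthogonalProjectionOnto.toLinearMap ∘ₗ (unitaryOp (ρ g) ∘ₗ E.subtype) := by
    ext v
    change ρ g (v : V) = E.orthogonalProjectionOnto (ρ g v)
    exact (congrArg Subtype.val
      (Submodule.orthogonalProjectionOnto_mem_subspace_eq_self (⟨ρ g v, hE g v v.2⟩ : E))).symm
  rw [uchar, h1, LinearMap.trace_comp_comm']
  rfl

theorem uchar_eq_add_orthogonal [FiniteDimensional ℂ V] (ρ : G →* (V ≃ₗᵢ[ℂ] V)) (E : Submodule ℂ V)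
    (hE : ∀ g, ∀ v ∈ E, ρ g v ∈ E) (g : G) :
    uchar ρ g = uchar (subRep ρ E hE) g + uchar (subRep ρ Eᗮ (orthogonal_invariant hE)) g := by
  rw [uchar_subRep, uchar_subRep, ← map_add, ← LinearMap.comp_add, uchar]
  congr 1
  ext v
  change ρ g v = ρ g (E.starProjection v + Eᗮ.starProjection v)
  rw [Submodule.starProjection_add_starProjection_orthogonal]

/-- The orthogonal direct sum of unitary representations. -/
noncomputable def prodRep (ρ : G →* (V ≃ₗᵢ[ℂ] V)) (σ : G →* (W ≃ₗᵢ[ℂ] W)) :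
    G →* (WithLp 2 (V × W) ≃ₗᵢ[ℂ] WithLp 2 (V × W)) :=
  ofIsometric
    { toFun := fun g =>
        { toFun := fun v => WithLp.toLp 2 (ρ g v.fst, σ g v.snd)
          map_add' := fun v w => by
            simp only [WithLp.add_fst, WithLp.add_snd, map_add]
            rfl
          map_smul' := fun c v => by
            simp only [WithLp.smul_fst, WithLp.smul_snd, map_smul]
            rfl }
      map_one' := by
        simp only [map_one]
        rfl
      map_mul' := fun a b => by
        simp only [map_mul]
        rfl } fun g v => by
      rw [← sq_eq_sq₀ (norm_nonneg _) (norm_nonneg _), WithLp.prod_norm_sq_eq_of_L2,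
        WithLp.prod_norm_sq_eq_of_L2]
      change ‖ρ g v.fst‖ ^ 2 + ‖σ g v.snd‖ ^ 2 = _
      rw [LinearIsometryEquiv.norm_map, LinearIsometryEquiv.norm_map]

theorem prodRep_apply (ρ : G →* (V ≃ₗᵢ[ℂ] V)) (σ : G →* (W ≃ₗᵢ[ℂ] W)) (g : G)
    (v : WithLp 2 (V × W)) : prodRep ρ σ g v = WithLp.toLp 2 (ρ g v.fst, σ g v.snd) := rfl

theorem uchar_prodRep [FiniteDimensional ℂ V] [FiniteDimensional ℂ W] (ρ : G →* (V ≃ₗᵢ[ℂ] V))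
    (σ : G →* (W ≃ₗᵢ[ℂ] W)) (g : G) : uchar (prodRep ρ σ) g = uchar ρ g + uchar σ g := by
  rw [uchar, uchar, uchar, ← LinearMap.trace_prodMap',
    ← LinearMap.trace_conj' _ (WithLp.linearEquiv 2 ℂ (V × W))]
  congr 1

/-- The tensor product of a unitary representation with a permutation representation. -/
noncomputable def permRep {m : ℕ} (ρ : G →* (V ≃ₗᵢ[ℂ] V)) (α : G →* Equiv.Perm (Fin m)) :
    G →* (PiLp 2 (fun _ : Fin m => V) ≃ₗᵢ[ℂ] PiLp 2 fun _ : Fin m => V) :=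
  ofIsometric
    { toFun := fun g =>
        { toFun := fun f => WithLp.toLp 2 fun x => ρ g (f ((α g)⁻¹ x))
          map_add' := fun v w => by
            ext x
            simp
          map_smul' := fun c v => by
            ext x
            simp }
      map_one' := by
        ext f x
        simp
        rfl
      map_mul' := fun a b => by
        ext f x
        simp
        rfl } fun g v => by
      rw [← sq_eq_sq₀ (norm_nonneg _) (norm_nonneg _), PiLp.norm_sq_eq_of_L2,
        PiLp.norm_sq_eq_of_L2]
      change ∑ x, ‖ρ g (v ((α g)⁻¹ x))‖ ^ 2 = _
      simp only [LinearIsometryEquiv.norm_map]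
      exact Equiv.sum_comp (α g)⁻¹ fun x => ‖v x‖ ^ 2

theorem permRep_apply {m : ℕ} (ρ : G →* (V ≃ₗᵢ[ℂ] V)) (α : G →* Equiv.Perm (Fin m)) (g : G)
    (f : PiLp 2 fun _ : Fin m => V) (x : Fin m) :
    permRep ρ α g f x = ρ g (f ((α g)⁻¹ x)) := rfl

/-- A permutation without fixed points leaves no diagonal blocks. -/
theorem uchar_permRep_of_free [FiniteDimensional ℂ V] {m : ℕ} (ρ : G →* (V ≃ₗᵢ[ℂ] V))
    (α : G →* Equiv.Perm (Fin m)) {g : G} (hg : ∀ x, α g x ≠ x) : uchar (permRep ρ α) g = 0 := by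
  rw [uchar, LinearMap.trace_eq_sum_inner _
    (Pi.orthonormalBasis fun _ : Fin m => stdOrthonormalBasis ℂ V)]
  refine Finset.sum_eq_zero fun i _ => ?_
  rw [PiLp.inner_apply]
  refine Finset.sum_eq_zero fun x _ => ?_
  change inner ℂ _ (ρ g ((Pi.orthonormalBasis fun _ : Fin m => stdOrthonormalBasis ℂ V) i
    ((α g)⁻¹ x))) = 0
  rw [Pi.orthonormalBasis_apply]
  by_cases hx : x = i.1
  · subst hx
    have h1 : (α g)⁻¹ i.1 ≠ i.1 := fun h => hg i.1 (by
      rw [Equiv.Perm.inv_eq_iff_eq] at h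
      exact h.symm)
    have h2 : (PiLp.single 2 i.1 (stdOrthonormalBasis ℂ V i.2) : PiLp 2 fun _ : Fin m => V)
        ((α g)⁻¹ i.1) = 0 := by
      rw [PiLp.single_apply, if_neg h1]
    rw [h2, map_zero, inner_zero_right]
  · simp [PiLp.single_apply, hx]

/-- The inclusion of the constant functions. -/
noncomputable def constMap (m : ℕ) : V →ₗ[ℂ] PiLp 2 fun _ : Fin m => V where
  toFun v := WithLp.toLp 2 fun _ => v
  map_add' _ _ := rfl
  map_smul' _ _ := rfl

end URep

/-! ### Characters of finite groups determine unitary representations -/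

section Character

variable {H : Type*} [Group H]
  {V W : Type*} [NormedAddCommGroup V] [InnerProductSpace ℂ V] [FiniteDimensional ℂ V]
  [NormedAddCommGroup W] [InnerProductSpace ℂ W] [FiniteDimensional ℂ W]

/-- This is character orthogonality; unitarity turns the value at h⁻¹ into a complex conjugate. -/
theorem sum_uchar_mul_conj [Fintype H] (ρ : H →* (V ≃ₗᵢ[ℂ] V)) (σ : H →* (W ≃ₗᵢ[ℂ] W)) :
    ∑ h, uchar σ h * starRingEnd ℂ (uchar ρ h) =
      Nat.card H * Module.finrank ℂ ((linRep ρ).IntertwiningMap (linRep σ)) := by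
  have hne : (Nat.card H : ℂ) ≠ 0 := by exact_mod_cast Nat.card_pos.ne'
  have : Invertible (Nat.card H : ℂ) := invertibleOfNonzero hne
  rw [← Representation.card_inv_mul_sum_char_mul_char_eq_finrank, mul_inv_cancel_left₀ hne]
  refine Finset.sum_congr rfl fun h _ => ?_
  rw [← uchar_inv]
  rfl

/-- Equal characters give dim Hom(ρ, σ) = dim End(ρ), which is positive because of the identity. -/
theorem exists_ne_zero_intertwiner [Finite H] [Nontrivial V] (ρ : H →* (V ≃ₗᵢ[ℂ] V))
    (σ : H →* (W ≃ₗᵢ[ℂ] W)) (hchar : ∀ h, uchar ρ h = uchar σ h) :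
    ∃ R : V →ₗ[ℂ] W, R ≠ 0 ∧ ∀ h v, R (ρ h v) = σ h (R v) := by
  have := Fintype.ofFinite H
  have h1 := sum_uchar_mul_conj ρ σ
  have h2 := sum_uchar_mul_conj ρ ρ
  simp only [← hchar] at h1
  rw [h2] at h1
  have hne : (Nat.card H : ℂ) ≠ 0 := by exact_mod_cast Nat.card_pos.ne'
  have h3 : Module.finrank ℂ ((linRep ρ).IntertwiningMap (linRep ρ)) =
      Module.finrank ℂ ((linRep ρ).IntertwiningMap (linRep σ)) := by
    exact_mod_cast mul_left_cancel₀ hne h1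
  have : Module.Finite ℂ ((linRep ρ).IntertwiningMap (linRep ρ)) :=
    Module.Finite.equiv (Representation.invariantsEquivIntertwiningMap (linRep ρ) (linRep ρ))
  have hid : Representation.IntertwiningMap.id (linRep ρ) ≠ 0 := by
    intro h0
    obtain ⟨v, hv⟩ := exists_ne (0 : V)
    exact hv (congrArg (fun f : (linRep ρ).IntertwiningMap (linRep ρ) => f.toLinearMap v) h0)
  have : Nontrivial ((linRep ρ).IntertwiningMap (linRep ρ)) := ⟨⟨_, _, hid⟩⟩
  have hpos := Module.finrank_pos (R := ℂ) (M := (linRep ρ).IntertwiningMap (linRep ρ))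
  rw [h3] at hpos
  have : Nontrivial ((linRep ρ).IntertwiningMap (linRep σ)) :=
    Module.nontrivial_of_finrank_pos hpos
  obtain ⟨R, hR⟩ := exists_ne (0 : (linRep ρ).IntertwiningMap (linRep σ))
  refine ⟨R.toLinearMap, fun h0 => hR ?_, fun h v => ?_⟩
  · ext v
    exact congrArg (fun f : V →ₗ[ℂ] W => f v) h0
  · exact congrArg (fun f : V →ₗ[ℂ] W => f v) (R.isIntertwining' h)

/-- Unitary representations of a finite group with equal characters are isomorphic. -/
theorem exists_equivariant_linearEquiv [Finite H] (ρ : H →* (V ≃ₗᵢ[ℂ] V))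
    (σ : H →* (W ≃ₗᵢ[ℂ] W)) (hchar : ∀ h, uchar ρ h = uchar σ h) :
    ∃ Q : V ≃ₗ[ℂ] W, ∀ h v, Q (ρ h v) = σ h (Q v) := by
  let S : Set ℕ := {n | ∃ Q : V →ₗ[ℂ] W, (∀ h v, Q (ρ h v) = σ h (Q v)) ∧
    Module.finrank ℂ (LinearMap.ker Q) = n}
  have hS : S.Nonempty := ⟨_, 0, by simp, rfl⟩
  obtain ⟨Q, hQ, hQmin⟩ := Nat.sInf_mem hS
  have hE : ∀ h, ∀ v ∈ LinearMap.ker Q, ρ h v ∈ LinearMap.ker Q := by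
    intro h v hv
    rw [LinearMap.mem_ker] at hv ⊢
    rw [hQ, hv, map_zero]
  have hRg : ∀ h, ∀ w ∈ LinearMap.range Q, σ h w ∈ LinearMap.range Q := by
    rintro h _ ⟨v, rfl⟩
    exact ⟨ρ h v, hQ h v⟩
  have hcompl : IsCompl (LinearMap.ker Q)ᗮ (LinearMap.ker Q) :=
    (Submodule.isCompl_orthogonal _).symm
  have hchar' : ∀ h, uchar (subRep ρ _ hE) h = uchar (subRep σ _ (orthogonal_invariant hRg)) h := by
    intro h
    have h1 := uchar_eq_add_orthogonal ρ _ hE h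
    have h2 := uchar_eq_add_orthogonal σ _ hRg h
    have h3 : uchar (subRep ρ _ (orthogonal_invariant hE)) h = uchar (subRep σ _ hRg) h :=
      
      uchar_congr (ρ := subRep ρ _ (orthogonal_invariant hE)) (σ := subRep σ _ hRg)
        (Q.kerComplementEquivRange hcompl) (fun g v => Subtype.ext (by
          simpa using hQ g (v : V))) h
    rw [hchar, h2, h3] at h1
    linear_combination -h1
  have hker : LinearMap.ker Q = ⊥ := by
    by_contra hne
    have : Nontrivial (LinearMap.ker Q) := Submodule.nontrivial_iff_ne_bot.mpr hne
    obtain ⟨R, hR0, hR⟩ := exists_ne_zero_intertwiner _ _ hchar'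
    let R' : V →ₗ[ℂ] W := (LinearMap.range Q)ᗮ.subtype ∘ₗ R ∘ₗ
      (LinearMap.ker Q).orthogonalProjectionOnto.toLinearMap
    have hR' : ∀ h v, R' (ρ h v) = σ h (R' v) := by
      intro h v
      have h1 : (LinearMap.ker Q).orthogonalProjectionOnto (ρ h v) =
          subRep ρ _ hE h ((LinearMap.ker Q).orthogonalProjectionOnto v) :=
        Subtype.ext (starProjection_commute hE h v)
      change ((R ((LinearMap.ker Q).orthogonalProjectionOnto (ρ h v)) :
        (LinearMap.range Q)ᗮ) : W) = _
      rw [h1, hR]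
      rfl
    have hlt : LinearMap.ker (Q + R') < LinearMap.ker Q := by
      have hle : ∀ v ∈ LinearMap.ker (Q + R'), Q v = 0 ∧ R' v = 0 := by
        intro v hv
        have h1 : Q v + R' v = 0 := hv
        have h2 : R' v ∈ (LinearMap.range Q)ᗮ := Submodule.coe_mem _
        have h3 : inner ℂ (Q v) (R' v) = 0 := h2 _ ⟨v, rfl⟩
        rw [eq_neg_of_add_eq_zero_left h1, inner_neg_left, neg_eq_zero, inner_self_eq_zero] at h3
        exact ⟨by simpa [h3] using h1, h3⟩
      refine ⟨fun v hv => (hle v hv).1, fun hge => hR0 ?_⟩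
      ext v
      have h1 := (hle v (hge v.2)).2
      have h2 : R' v = R v := by
        change ((R ((LinearMap.ker Q).orthogonalProjectionOnto v) : (LinearMap.range Q)ᗮ) : W) = _
        rw [Submodule.orthogonalProjectionOnto_mem_subspace_eq_self]
      rw [← h2, h1]
      rfl
    have h1 := Submodule.finrank_lt_finrank_of_lt hlt
    have h2 : sInf S ≤ Module.finrank ℂ (LinearMap.ker (Q + R')) :=
      Nat.sInf_le ⟨Q + R', fun h v => by simp [hQ, hR'], rfl⟩
    omega
  have hdim : Module.finrank ℂ V = Module.finrank ℂ W := by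
    have h1 := hchar 1
    rw [uchar_one, uchar_one] at h1
    exact_mod_cast h1
  exact ⟨LinearEquiv.ofInjectiveOfFinrankEq Q (LinearMap.ker_eq_bot.mp hker) hdim, hQ⟩

end Character

/-! ### Approximate intertwiners are close to unitary intertwiners -/

section Polar

variable {H : Type*} [Group H]
  {V : Type*} [NormedAddCommGroup V] [InnerProductSpace ℂ V] [FiniteDimensional ℂ V]

/-- The absolute value of an operator on a finite-dimensional Hilbert space. -/
theorem exists_abs (S : V →ₗ[ℂ] V) :
    ∃ P : V →ₗ[ℂ] V, LinearMap.adjoint P = P ∧ (∀ v, 0 ≤ (inner ℂ (P v) v).re) ∧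
      P ∘ₗ P = LinearMap.adjoint S ∘ₗ S ∧
      ∀ U : V →ₗ[ℂ] V, Commute (LinearMap.adjoint S ∘ₗ S) U → Commute P U := by
  have : CompleteSpace V := FiniteDimensional.complete ℂ V
  let N : V →L[ℂ] V := LinearMap.toContinuousLinearMap (LinearMap.adjoint S ∘ₗ S)
  have hN : 0 ≤ N := by
    rw [ContinuousLinearMap.nonneg_iff_isPositive]
    refine ⟨?_, fun v => ?_⟩
    · exact LinearMap.isSymmetric_adjoint_comp_self S
    · change 0 ≤ RCLike.re (inner ℂ (LinearMap.adjoint S (S v)) v)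
      rw [LinearMap.adjoint_inner_left]
      exact inner_self_nonneg
  have hP := CFC.sqrt_nonneg N
  rw [ContinuousLinearMap.nonneg_iff_isPositive] at hP
  refine ⟨(CFC.sqrt N).toLinearMap, hP.isSymmetric.adjoint_eq, fun v => hP.2 v, ?_, fun U hU => ?_⟩
  · ext v
    exact congrArg (fun f : V →L[ℂ] V => f v) (CFC.sqrt_mul_sqrt_self N hN)
  · have h1 : Commute N (LinearMap.toContinuousLinearMap U) := by
      ext v
      exact congrArg (fun f : V →ₗ[ℂ] V => f v) hU
    have h2 : Commute (CFC.sqrt N) (LinearMap.toContinuousLinearMap U) := by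
      rw [CFC.sqrt_eq_cfc]
      exact h1.cfc_nnreal _
    ext v
    exact congrArg (fun f : V →L[ℂ] V => f v) h2

/-- The unitary is the polar part S|S|⁻¹. It intertwines because S*S, hence |S|, commutes with ρ. -/
theorem exists_unitary_intertwiner_of_injective (ρ σ : H →* (V ≃ₗᵢ[ℂ] V)) (S : V →ₗ[ℂ] V)
    (hS : ∀ h v, S (ρ h v) = σ h (S v)) (hinj : Function.Injective S) :
    ∃ τ : V ≃ₗᵢ[ℂ] V, (∀ h, τ * ρ h = σ h * τ) ∧
      hs (unitaryOp τ - S) ≤ hs (LinearMap.id - LinearMap.adjoint S ∘ₗ S) := by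
  obtain ⟨P, hPadj, hPpos, hPP, hPcomm⟩ := exists_abs S
  have hnorm : ∀ v, ‖S v‖ = ‖P v‖ := by
    intro v
    rw [← sq_eq_sq₀ (norm_nonneg _) (norm_nonneg _), ← inner_self_eq_norm_sq (𝕜 := ℂ),
      ← inner_self_eq_norm_sq (𝕜 := ℂ), ← LinearMap.adjoint_inner_right,
      ← LinearMap.adjoint_inner_right P, hPadj]
    exact congrArg (fun f : V →ₗ[ℂ] V => RCLike.re (inner ℂ v (f v))) hPP.symm
  have hPinj : Function.Injective P := by
    rw [injective_iff_map_eq_zero]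
    intro v hv
    refine (injective_iff_map_eq_zero S).mp hinj v ?_
    rw [← norm_eq_zero, hnorm, hv, norm_zero]
  let Pe : V ≃ₗ[ℂ] V := LinearEquiv.ofInjectiveEndo P hPinj
  let Se : V ≃ₗ[ℂ] V := LinearEquiv.ofInjectiveEndo S hinj
  have hPe : ∀ v, P (Pe.symm v) = v := fun v => Pe.apply_symm_apply v
  let τ : V ≃ₗᵢ[ℂ] V :=
    { toLinearEquiv := Pe.symm.trans Se
      norm_map' := fun v => by
        change ‖S (Pe.symm v)‖ = ‖v‖
        rw [hnorm, hPe] }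
  have hτP : ∀ v, τ (P v) = S v := fun v => by
    change S (Pe.symm (Pe v)) = S v
    rw [Pe.symm_apply_apply]
  have hcomm : ∀ h v, P (ρ h v) = ρ h (P v) := by
    intro h v
    have h1 : Commute (LinearMap.adjoint S ∘ₗ S) (unitaryOp (ρ h)) := by
      ext w
      change LinearMap.adjoint S (S (ρ h w)) = ρ h (LinearMap.adjoint S (S w))
      rw [hS]
      refine ext_inner_right ℂ fun z => ?_
      rw [LinearMap.adjoint_inner_left, ← inv_inv h, urep_inner_inv_left, urep_inner_inv_left,
        LinearMap.adjoint_inner_left, hS]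
    exact congrArg (fun f : V →ₗ[ℂ] V => f v) (hPcomm _ h1)
  refine ⟨τ, fun h => ?_, ?_⟩
  · ext v
    change τ (ρ h v) = σ h (τ v)
    rw [← hPe v, ← hcomm, hτP, hτP, hS]
  · have h1 : unitaryOp τ - S = unitaryOp τ ∘ₗ (LinearMap.id - P) := by
      ext v
      change τ v - S v = τ (v - P v)
      rw [map_sub, hτP]
    rw [h1, hs_comp_of_isometry (unitaryOp τ) τ.norm_map, ← hPP]
    -- Here 1 - P² = (1 + P)(1 - P), and ‖w‖ ≤ ‖w + Pw‖ because P is positive.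
    refine hs_le_of_norm_le fun v => ?_
    set w := v - P v with hw
    have h2 : (LinearMap.id - P ∘ₗ P : V →ₗ[ℂ] V) v = w + P w := by
      simp [hw]
    rw [h2]
    change ‖w‖ ≤ _
    rw [← sq_le_sq₀ (norm_nonneg _) (norm_nonneg _), @norm_add_sq ℂ]
    have h3 : 0 ≤ RCLike.re (inner ℂ w (P w)) := by
      rw [inner_re_symm]
      exact hPpos w
    nlinarith [sq_nonneg ‖P w‖]

/-- If two unitary representations of a finite group have equal characters, then any
self-intertwiner `S` is as close to a unitary intertwiner as `S* S` is to the identity. -/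
theorem exists_unitary_intertwiner [Finite H] (ρ σ : H →* (V ≃ₗᵢ[ℂ] V))
    (hchar : ∀ h, uchar ρ h = uchar σ h) (S : V →ₗ[ℂ] V) (hS : ∀ h v, S (ρ h v) = σ h (S v))
    {ε : ℝ} (hε : 0 < ε) :
    ∃ τ : V ≃ₗᵢ[ℂ] V, (∀ h, τ * ρ h = σ h * τ) ∧
      hs (unitaryOp τ - S) ≤ hs (LinearMap.id - LinearMap.adjoint S ∘ₗ S) + ε := by
  obtain ⟨Q, hQ⟩ := exists_equivariant_linearEquiv ρ σ hchar
  let A : V →ₗ[ℂ] V := Q.toLinearMap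
  let M : ℝ := hs A + (hs (LinearMap.adjoint A ∘ₗ S) + hs (LinearMap.adjoint S ∘ₗ A) +
    hs (LinearMap.adjoint A ∘ₗ A))
  have hM : 0 ≤ M := by
    have := hs_nonneg A
    have := hs_nonneg (LinearMap.adjoint A ∘ₗ S)
    have := hs_nonneg (LinearMap.adjoint S ∘ₗ A)
    have := hs_nonneg (LinearMap.adjoint A ∘ₗ A)
    positivity
  let B : Module.End ℂ V := Q.symm.toLinearMap ∘ₗ S
  -- Avoiding the finitely many eigenvalues of Q⁻¹S makes S + δQ injective. The bound ε / (M + 1)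
  -- keeps the total perturbation below ε, and δ ≤ 1 handles the quadratic term.
  obtain ⟨δ, hδ, hδB⟩ : ∃ δ ∈ Set.Ioo (0 : ℝ) (min 1 (ε / (M + 1))),
      ¬ Module.End.HasEigenvalue B (-(δ : ℂ)) := by
    by_contra! hcon
    have hfin : {μ : ℂ | Module.End.HasEigenvalue B μ}.Finite := Module.End.finite_hasEigenvalue B
    have hinf : (Set.Ioo (0 : ℝ) (min 1 (ε / (M + 1)))).Infinite :=
      Set.Ioo_infinite (lt_min one_pos (by positivity))
    exact hinf (Set.Finite.of_finite_image (f := fun δ : ℝ => -(δ : ℂ))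
      (hfin.subset (by rintro _ ⟨δ, hδ, rfl⟩; exact hcon δ hδ))
      (fun a _ b _ hab => by simpa using hab))
  let S' : V →ₗ[ℂ] V := S + (δ : ℂ) • A
  have hδ1 : δ ≤ 1 := hδ.2.le.trans (min_le_left _ _)
  have hδε : δ * M ≤ ε := by
    have h1 : δ ≤ ε / (M + 1) := hδ.2.le.trans (min_le_right _ _)
    rw [le_div_iff₀ (by positivity)] at h1
    nlinarith [hδ.1]
  have hnδ : ‖(δ : ℂ)‖ = δ := by
    rw [Complex.norm_real, Real.norm_of_nonneg hδ.1.le]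
  have hS' : ∀ h v, S' (ρ h v) = σ h (S' v) := by
    intro h v
    change S (ρ h v) + (δ : ℂ) • Q (ρ h v) = σ h (S v + (δ : ℂ) • Q v)
    rw [hS, hQ, map_add, map_smul]
  have hinj : Function.Injective S' := by
    rw [injective_iff_map_eq_zero]
    intro v hv
    by_contra hv0
    apply hδB
    refine Module.End.hasEigenvalue_of_hasEigenvector (x := v) ⟨?_, hv0⟩
    rw [Module.End.mem_eigenspace_iff]
    have h1 : S v = -((δ : ℂ) • Q v) := eq_neg_of_add_eq_zero_left hv
    change Q.symm (S v) = _
    rw [h1, map_neg, map_smul, Q.symm_apply_apply, neg_smul]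
  obtain ⟨τ, hτ, hτS⟩ := exists_unitary_intertwiner_of_injective ρ σ S' hS' hinj
  refine ⟨τ, hτ, ?_⟩
  have h1 : hs (S' - S) ≤ δ * hs A := by
    have : S' - S = (δ : ℂ) • A := by simp [S']
    rw [this, hs_smul, hnδ]
  have h2 : hs (LinearMap.id - LinearMap.adjoint S' ∘ₗ S') ≤
      hs (LinearMap.id - LinearMap.adjoint S ∘ₗ S) + δ * (hs (LinearMap.adjoint A ∘ₗ S) +
        hs (LinearMap.adjoint S ∘ₗ A) + hs (LinearMap.adjoint A ∘ₗ A)) := by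
    have h3 : LinearMap.id - LinearMap.adjoint S' ∘ₗ S' =
        (LinearMap.id - LinearMap.adjoint S ∘ₗ S) + (-(δ : ℂ)) • (LinearMap.adjoint A ∘ₗ S +
          LinearMap.adjoint S ∘ₗ A + (δ : ℂ) • (LinearMap.adjoint A ∘ₗ A)) := by
      have hadj : LinearMap.adjoint ((δ : ℂ) • A) = (δ : ℂ) • LinearMap.adjoint A := by
        rw [map_smulₛₗ, Complex.conj_ofReal]
      simp only [S', map_add, hadj, LinearMap.add_comp, LinearMap.comp_add, LinearMap.comp_smul,
        LinearMap.smul_comp, smul_add, neg_smul]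
      abel
    rw [h3]
    refine (hs_add_le _ _).trans ?_
    gcongr
    rw [hs_smul, norm_neg, hnδ]
    refine mul_le_mul_of_nonneg_left ?_ hδ.1.le
    refine (hs_add_le _ _).trans (add_le_add (hs_add_le _ _) ?_)
    rw [hs_smul, hnδ]
    exact mul_le_of_le_one_left (hs_nonneg _) hδ1
  have h4 := hs_sub_le (unitaryOp τ) S' S
  have h5 : δ * M = δ * hs A + δ * (hs (LinearMap.adjoint A ∘ₗ S) +
        hs (LinearMap.adjoint S ∘ₗ A) + hs (LinearMap.adjoint A ∘ₗ A)) := by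
    simp only [M]
    ring
  linarith

end Polar

/-! ### Correcting the defect between two restrictions of a unitary representation -/

/-- The difference of the characters of the two restrictions of a unitary representation. -/
noncomputable def charDefect {G H V : Type*} [Group G] [Group H] [NormedAddCommGroup V]
    [InnerProductSpace ℂ V] (i₁ i₂ : H →* G) (ρ : G →* (V ≃ₗᵢ[ℂ] V)) : H → ℂ :=
  fun h => uchar ρ (i₁ h) - uchar ρ (i₂ h)

section CharDefect

variable {G H : Type*} [Group G] [Group H] (i₁ i₂ : H →* G)
  {V W : Type*} [NormedAddCommGroup V] [InnerProductSpace ℂ V] [FiniteDimensional ℂ V]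
  [NormedAddCommGroup W] [InnerProductSpace ℂ W] [FiniteDimensional ℂ W]

theorem charDefect_prodRep (ρ : G →* (V ≃ₗᵢ[ℂ] V)) (σ : G →* (W ≃ₗᵢ[ℂ] W)) :
    charDefect i₁ i₂ (prodRep ρ σ) = charDefect i₁ i₂ ρ + charDefect i₁ i₂ σ := by
  ext h
  simp only [charDefect, Pi.add_apply, uchar_prodRep]
  ring

/-- Nonzero character defects are bounded below, by integrality of inner products of characters. -/
theorem exists_one_le_norm_charDefect [Finite H] (ρ : G →* (V ≃ₗᵢ[ℂ] V))
    (hne : charDefect i₁ i₂ ρ ≠ 0) : ∃ h, 1 ≤ ‖charDefect i₁ i₂ ρ h‖ := by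
  have := Fintype.ofFinite H
  set v := charDefect i₁ i₂ ρ with hv
  -- The squared ℓ² norm of a difference of characters is |H| times an integer, so it is at least
  -- |H| unless zero; then not all |H| values can have modulus below 1.
  obtain ⟨z, hz⟩ : ∃ z : ℤ, ∑ h, v h * starRingEnd ℂ (v h) = Nat.card H * (z : ℂ) := by
    have hint : ∀ i j : H →* G, ∃ n : ℕ, ∑ h, uchar (ρ.comp j) h *
        starRingEnd ℂ (uchar (ρ.comp i) h) = Nat.card H * (n : ℂ) :=
      fun i j => ⟨_, sum_uchar_mul_conj (ρ.comp i) (ρ.comp j)⟩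
    obtain ⟨n₁₁, h11⟩ := hint i₁ i₁
    obtain ⟨n₁₂, h12⟩ := hint i₁ i₂
    obtain ⟨n₂₁, h21⟩ := hint i₂ i₁
    obtain ⟨n₂₂, h22⟩ := hint i₂ i₂
    refine ⟨n₁₁ - n₁₂ - n₂₁ + n₂₂, ?_⟩
    push_cast
    rw [mul_add, mul_sub, mul_sub, ← h11, ← h12, ← h21, ← h22, ← Finset.sum_sub_distrib,
      ← Finset.sum_sub_distrib, ← Finset.sum_add_distrib]
    refine Finset.sum_congr rfl fun h _ => ?_
    change (uchar (ρ.comp i₁) h - uchar (ρ.comp i₂) h) *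
      starRingEnd ℂ (uchar (ρ.comp i₁) h - uchar (ρ.comp i₂) h) = _
    rw [map_sub]
    ring
  have hsum : ∑ h, ‖v h‖ ^ 2 = Nat.card H * (z : ℝ) := by
    have h1 : ∑ h, v h * starRingEnd ℂ (v h) = ((∑ h, ‖v h‖ ^ 2 : ℝ) : ℂ) := by
      push_cast
      exact Finset.sum_congr rfl fun h _ => by rw [Complex.mul_conj, Complex.normSq_eq_norm_sq]; simp
    rw [h1] at hz
    exact_mod_cast hz
  have hcard : (0 : ℝ) < Nat.card H := by exact_mod_cast Nat.card_pos
  have hpos : 0 < ∑ h, ‖v h‖ ^ 2 := by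
    obtain ⟨h, hh⟩ := Function.ne_iff.mp hne
    exact Finset.sum_pos' (fun _ _ => by positivity)
      ⟨h, Finset.mem_univ h, by
        have : v h ≠ 0 := hh
        positivity⟩
  have hz1 : (1 : ℝ) ≤ z := by
    rw [hsum] at hpos
    have : (0 : ℝ) < z := pos_of_mul_pos_right hpos hcard.le
    exact_mod_cast this
  by_contra! hcon
  have h2 : ∑ h, ‖v h‖ ^ 2 < ∑ _h : H, (1 : ℝ) := by
    refine Finset.sum_lt_sum_of_nonempty Finset.univ_nonempty fun h _ => ?_
    have := hcon h
    have := norm_nonneg (v h)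
    nlinarith
  simp only [Finset.sum_const, Finset.card_univ, nsmul_eq_mul, mul_one,
    ← Nat.card_eq_fintype_card] at h2
  nlinarith

/-- The tensor product of ρ with the permutation representation of α has zero defect: on bad
elements both characters vanish, on good ones both equal the dimension. The constant functions are a
copy of ρ, so their orthogonal complement has the opposite defect. -/
theorem exists_neg_charDefect (bad : H → Prop) {k : ℕ} (α : G →* Equiv.Perm (Fin (k + 1)))
    (hgood : ∀ h, ¬ bad h → α (i₁ h) = 1 ∧ α (i₂ h) = 1)
    (hbad : ∀ h, bad h → ∀ x, α (i₁ h) x ≠ x ∧ α (i₂ h) x ≠ x)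
    (ρ : G →* (V ≃ₗᵢ[ℂ] V)) (hρ : ∀ h, ¬ bad h → ρ (i₁ h) = 1 ∧ ρ (i₂ h) = 1) :
    ∃ (E : Submodule ℂ (PiLp 2 fun _ : Fin (k + 1) => V)) (σ : G →* (E ≃ₗᵢ[ℂ] E)),
      (∀ h, ¬ bad h → σ (i₁ h) = 1 ∧ σ (i₂ h) = 1) ∧
      charDefect i₁ i₂ σ = - charDefect i₁ i₂ ρ := by
  let τ := permRep ρ α
  have hτ : ∀ h, ¬ bad h → τ (i₁ h) = 1 ∧ τ (i₂ h) = 1 := by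
    intro h hh
    constructor <;> ext f x <;> simp [τ, permRep_apply, hgood h hh, hρ h hh] <;> rfl
  let E := LinearMap.range (constMap (V := V) (k + 1))
  have heq : ∀ g v, constMap (k + 1) (ρ g v) = τ g (constMap (k + 1) v) := fun g v => rfl
  have hE : ∀ g, ∀ f ∈ E, τ g f ∈ E := by
    rintro g _ ⟨v, rfl⟩
    exact ⟨ρ g v, heq g v⟩
  have hinj : Function.Injective (constMap (V := V) (k + 1)) := fun v w h =>
    congrArg (fun f : PiLp 2 fun _ : Fin (k + 1) => V => f 0) h
  have hcharE : ∀ g, uchar ρ g = uchar (subRep τ E hE) g :=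
    uchar_congr (LinearEquiv.ofInjective _ hinj) fun g v => Subtype.ext (heq g v)
  refine ⟨Eᗮ, subRep τ Eᗮ (orthogonal_invariant hE), fun h hh => ?_, ?_⟩
  · constructor <;> ext v : 2 <;> simp [hτ h hh]
  · ext h
    have h0 : uchar τ (i₁ h) = uchar τ (i₂ h) := by
      by_cases hh : bad h
      · rw [uchar_permRep_of_free _ _ fun x => (hbad h hh x).1,
          uchar_permRep_of_free _ _ fun x => (hbad h hh x).2]
      · rw [uchar_eq_finrank_of_eq_one _ (hτ h hh).1, uchar_eq_finrank_of_eq_one _ (hτ h hh).2]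
    rw [uchar_eq_add_orthogonal τ E hE, uchar_eq_add_orthogonal τ E hE, ← hcharE, ← hcharE] at h0
    simp only [charDefect, Pi.neg_apply]
    linear_combination h0

/-- The character defect of a unitary representation can be cancelled by a representation whose
dimension is linearly bounded by the defect. -/
theorem exists_unitary_correction [Finite H] (bad : H → Prop) {k : ℕ}
    (α : G →* Equiv.Perm (Fin (k + 1)))
    (hgood : ∀ h, ¬ bad h → α (i₁ h) = 1 ∧ α (i₂ h) = 1)
    (hbad : ∀ h, bad h → ∀ x, α (i₁ h) x ≠ x ∧ α (i₂ h) x ≠ x) :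
    ∃ C : ℝ, ∀ (V : Type) [NormedAddCommGroup V] [InnerProductSpace ℂ V] [FiniteDimensional ℂ V]
      (ρ : G →* (V ≃ₗᵢ[ℂ] V)) (M : ℝ),
      (∀ h, ¬ bad h → ρ (i₁ h) = 1 ∧ ρ (i₂ h) = 1) → (∀ h, ‖charDefect i₁ i₂ ρ h‖ ≤ M) → 0 ≤ M →
      ∃ (c : ℕ) (σ : G →* (EuclideanSpace ℂ (Fin c) ≃ₗᵢ[ℂ] EuclideanSpace ℂ (Fin c))),
        (c : ℝ) ≤ C * M ∧ charDefect i₁ i₂ σ = - charDefect i₁ i₂ ρ := by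
  classical
  have := Fintype.ofFinite H
  let P : (H → ℂ) → ℕ → Prop := fun v c =>
    ∃ ρ : G →* (EuclideanSpace ℂ (Fin c) ≃ₗᵢ[ℂ] EuclideanSpace ℂ (Fin c)),
      (∀ h, ¬ bad h → ρ (i₁ h) = 1 ∧ ρ (i₂ h) = 1) ∧ charDefect i₁ i₂ ρ = v
  have htransfer : ∀ {V : Type} [NormedAddCommGroup V] [InnerProductSpace ℂ V]
      [FiniteDimensional ℂ V] (ρ : G →* (V ≃ₗᵢ[ℂ] V)),
      (∀ h, ¬ bad h → ρ (i₁ h) = 1 ∧ ρ (i₂ h) = 1) →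
      P (charDefect i₁ i₂ ρ) (Module.finrank ℂ V) := by
    intro V _ _ _ ρ hρ
    refine ⟨conjRep ρ (stdOrthonormalBasis ℂ V).repr, fun h hh => ?_, ?_⟩
    · constructor <;> ext w : 1 <;> simp [conjRep, hρ h hh]
    · ext h
      simp only [charDefect, uchar_conjRep]
  have hzero : P 0 0 := by
    refine ⟨1, fun h _ => by simp, ?_⟩
    ext h
    simp [charDefect, uchar]
  have hadd : ∀ v w a b, P v a → P w b → P (v + w) (a + b) := by
    rintro _ _ a b ⟨ρ, hρ, rfl⟩ ⟨σ, hσ, rfl⟩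
    rw [← charDefect_prodRep]
    have h1 := htransfer (prodRep ρ σ) fun h hh => by
      constructor <;> ext w : 1 <;> rw [prodRep_apply] <;> simp [hρ h hh, hσ h hh] <;> rfl
    have h2 : Module.finrank ℂ (WithLp 2 (EuclideanSpace ℂ (Fin a) × EuclideanSpace ℂ (Fin b))) =
        a + b := by
      rw [(WithLp.linearEquiv 2 ℂ
        (EuclideanSpace ℂ (Fin a) × EuclideanSpace ℂ (Fin b))).finrank_eq]
      simp
    rwa [h2] at h1
  let Λ : AddSubgroup (H → ℂ) :=
    { carrier := {v | ∃ c, P v c}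
      zero_mem' := ⟨0, hzero⟩
      add_mem' := fun ⟨a, ha⟩ ⟨b, hb⟩ => ⟨a + b, hadd _ _ _ _ ha hb⟩
      neg_mem' := by
        rintro _ ⟨a, ρ, hρ, rfl⟩
        obtain ⟨E, σ, hσ, h⟩ := exists_neg_charDefect i₁ i₂ bad α hgood hbad ρ hρ
        have h1 := htransfer (V := E) σ hσ
        rw [h] at h1
        exact ⟨_, h1⟩ }
  obtain ⟨C, hC⟩ := exists_cost_le_mul_norm Λ (by
    rintro _ ⟨a, ρ, hρ, rfl⟩ hne
    obtain ⟨h, hh⟩ := exists_one_le_norm_charDefect i₁ i₂ ρ hne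
    exact hh.trans (norm_le_pi_norm _ h)) P hzero hadd fun v hv => hv
  refine ⟨|C|, fun V _ _ _ ρ M hρ hM hM0 => ?_⟩
  obtain ⟨c, ⟨σ, -, hσ⟩, hc⟩ := hC (-charDefect i₁ i₂ ρ) (Λ.neg_mem ⟨_, htransfer ρ hρ⟩)
  refine ⟨c, σ, hc.trans ?_, hσ⟩
  rw [norm_neg]
  have hn : ‖charDefect i₁ i₂ ρ‖ ≤ M := (pi_norm_le_iff_of_nonneg hM0).mpr hM
  exact mul_le_mul (le_abs_self C) hn (norm_nonneg _) (abs_nonneg C)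

end CharDefect

/-! ### Fixed subspaces -/

/-- The common fixed vectors of a set of group elements. -/
def fixedSpace {G V : Type*} [Group G] [NormedAddCommGroup V]
    [InnerProductSpace ℂ V] (ρ : G →* (V ≃ₗᵢ[ℂ] V)) (C : Set G) :
    Submodule ℂ V where
  carrier := {v | ∀ c ∈ C, ρ c v = v}
  add_mem' hv hw c hc := by rw [map_add, hv c hc, hw c hc]
  zero_mem' c _ := map_zero _
  smul_mem' a v hv c hc := by rw [map_smul, hv c hc]

theorem fixedSpace_invariant {G V : Type*} [Group G] [NormedAddCommGroup V]
    [InnerProductSpace ℂ V] (ρ : G →* (V ≃ₗᵢ[ℂ] V)) {C : Set G}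
    (hC : ∀ g, ∀ c ∈ C, g⁻¹ * c * g ∈ C) :
    ∀ g, ∀ v ∈ fixedSpace ρ C, ρ g v ∈ fixedSpace ρ C := by
  intro g v hv c hc
  have h1 := hv _ (hC g c hc)
  rw [urep_mul_apply, urep_mul_apply] at h1
  rw [← urep_apply_inv_self ρ g (ρ c (ρ g v)), h1]

section Fixed

variable {G : Type*} [Group G]
  {V W : Type*} [NormedAddCommGroup V] [InnerProductSpace ℂ V] [FiniteDimensional ℂ V]
  [NormedAddCommGroup W] [InnerProductSpace ℂ W] [FiniteDimensional ℂ W]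

theorem adjoint_starProjection (E : Submodule ℂ V) :
    LinearMap.adjoint E.starProjection.toLinearMap = E.starProjection.toLinearMap :=
  (Submodule.starProjection_isSymmetric E).adjoint_eq

theorem starProjection_comp_self (E : Submodule ℂ V) :
    E.starProjection.toLinearMap ∘ₗ E.starProjection.toLinearMap =
      E.starProjection.toLinearMap := by
  ext v
  exact Submodule.starProjection_eq_self_iff.mpr (Submodule.starProjection_apply_mem _ _)

theorem trace_starProjection (E : Submodule ℂ V) :
    LinearMap.trace ℂ V E.starProjection.toLinearMap = Module.finrank ℂ E := by
  have h1 : E.starProjection.toLinearMap =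
      E.subtype ∘ₗ E.orthogonalProjectionOnto.toLinearMap := rfl
  rw [h1, LinearMap.trace_comp_comm', ← LinearMap.trace_id ℂ E]
  congr 1
  ext v
  exact congrArg Subtype.val (Submodule.orthogonalProjectionOnto_mem_subspace_eq_self v)

theorem hs_sq_starProjection (E : Submodule ℂ V) :
    hs E.starProjection.toLinearMap ^ 2 = Module.finrank ℂ E := by
  rw [hs_sq_of_projection (adjoint_starProjection E) (starProjection_comp_self E),
    trace_starProjection]
  simp

/-- For an element of finite order, the codimension of the fixed space is controlled by the
Hilbert–Schmidt distance from the identity. -/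
theorem finrank_orthogonal_fixedSpace_le (ρ : G →* (V ≃ₗᵢ[ℂ] V)) {c : G} {m : ℕ} (hm : 0 < m)
    (hc : c ^ m = 1) :
    (Module.finrank ℂ (fixedSpace ρ {c})ᗮ : ℝ) ≤
      m ^ 2 * hs (unitaryOp (ρ c) - LinearMap.id) ^ 2 := by
  have hm' : (0 : ℝ) < m := by exact_mod_cast hm
  have hpow : ∀ (j : ℕ) (v : V), ‖v - ρ (c ^ j) v‖ ≤ j * ‖ρ c v - v‖ := by
    intro j v
    induction j with
    | zero => simp
    | succ j ih =>
      have h1 : v - ρ (c ^ (j + 1)) v = (v - ρ (c ^ j) v) - ρ (c ^ j) (ρ c v - v) := by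
        rw [pow_succ, urep_mul_apply, map_sub]
        abel
      rw [h1]
      refine (norm_sub_le _ _).trans ?_
      rw [LinearIsometryEquiv.norm_map]
      push_cast
      linarith
  -- The sum of the translates of v under the powers of c is fixed, hence orthogonal to v; so m‖v‖²
  -- is the inner product of Σ (v - ρ(c^j)v) with v.
  have hbound : ∀ v ∈ (fixedSpace ρ {c})ᗮ, ‖v‖ ≤ m * ‖ρ c v - v‖ := by
    intro v hv
    set w := ∑ j ∈ Finset.range m, ρ (c ^ j) v with hw
    have hwfix : w ∈ fixedSpace ρ {c} := by
      intro c' hc'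
      rw [Set.mem_singleton_iff.mp hc', hw, map_sum]
      simp only [← urep_mul_apply, ← pow_succ']
      have h1 := Finset.sum_range_succ (fun j => ρ (c ^ j) v) m
      have h2 := Finset.sum_range_succ' (fun j => ρ (c ^ j) v) m
      rw [h1, hc, pow_zero] at h2
      exact (add_right_cancel h2).symm
    have horth : inner ℂ w v = 0 := hv w hwfix
    have h1 : (m : ℂ) * inner ℂ v v = inner ℂ (∑ j ∈ Finset.range m, (v - ρ (c ^ j) v)) v := by
      rw [Finset.sum_sub_distrib, inner_sub_left, ← hw, horth, Finset.sum_const, Finset.card_range,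
        ← Nat.cast_smul_eq_nsmul ℂ, inner_smul_left, map_natCast, sub_zero]
    have h2 : ‖∑ j ∈ Finset.range m, (v - ρ (c ^ j) v)‖ ≤ m * (m * ‖ρ c v - v‖) := by
      refine (norm_sum_le _ _).trans ?_
      have : ∑ j ∈ Finset.range m, ‖v - ρ (c ^ j) v‖ ≤
          ∑ j ∈ Finset.range m, (m * ‖ρ c v - v‖ : ℝ) := by
        refine Finset.sum_le_sum fun j hj => (hpow j v).trans ?_
        have : (j : ℝ) ≤ m := by exact_mod_cast (Finset.mem_range.mp hj).le
        gcongr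
      simpa using this
    have h3 : (m : ℝ) * (‖v‖ * ‖v‖) ≤ m * (m * ‖ρ c v - v‖) * ‖v‖ := by
      have h4 := norm_inner_le_norm (𝕜 := ℂ) (∑ j ∈ Finset.range m, (v - ρ (c ^ j) v)) v
      rw [← h1, norm_mul, inner_self_eq_norm_sq_to_K] at h4
      have h5 : ‖(m : ℂ)‖ * ‖((‖v‖ : ℝ) : ℂ) ^ 2‖ = m * (‖v‖ * ‖v‖) := by
        rw [norm_pow, Complex.norm_real, norm_norm, Complex.norm_natCast, sq]
      rw [← h5]
      exact h4.trans (by gcongr)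
    rcases (norm_nonneg v).eq_or_lt with h0 | h0
    · rw [← h0]
      positivity
    · have h6 : (m * ‖v‖) * ‖v‖ ≤ (m * (m * ‖ρ c v - v‖)) * ‖v‖ := by linarith
      exact le_of_mul_le_mul_left (le_of_mul_le_mul_right h6 h0) hm'
  rw [← hs_sq_starProjection, ← mul_pow]
  refine pow_le_pow_left₀ (hs_nonneg _) ?_ 2
  refine hs_le_mul_of_norm_le hm'.le fun v => ?_
  refine (hbound _ (Submodule.starProjection_apply_mem _ v)).trans (le_of_eq ?_)
  -- v and its projection q differ by a fixed vector, so ρ(c) - 1 takes the same value on both.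
  congr 2
  set q := (fixedSpace ρ {c})ᗮ.starProjection v with hq
  have h1 : v - q ∈ fixedSpace ρ {c} := by
    have := Submodule.starProjection_add_starProjection_orthogonal (K := fixedSpace ρ {c}) v
    rw [← hq] at this
    rw [← eq_sub_iff_add_eq.mpr this]
    exact Submodule.starProjection_apply_mem _ v
  have h2 := h1 c rfl
  rw [map_sub] at h2
  change ρ c q - q = ρ c v - v
  rw [sub_eq_sub_iff_sub_eq_sub] at h2
  rw [h2]

theorem finrank_orthogonal_fixedSpace_finset_le (ρ : G →* (V ≃ₗᵢ[ℂ] V)) (C : Finset G) :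
    Module.finrank ℂ (fixedSpace ρ (C : Set G))ᗮ ≤
      ∑ c ∈ C, Module.finrank ℂ (fixedSpace ρ {c})ᗮ := by
  classical
  induction C using Finset.induction_on with
  | empty =>
    have h1 : fixedSpace ρ ((∅ : Finset G) : Set G) = ⊤ := by
      rw [Submodule.eq_top_iff']
      intro v c hc
      simp at hc
    rw [h1, Submodule.top_orthogonal_eq_bot]
    simp
  | insert c C hc ih =>
    rw [Finset.sum_insert hc]
    have h1 : fixedSpace ρ ((insert c C : Finset G) : Set G) =
        fixedSpace ρ {c} ⊓ fixedSpace ρ (C : Set G) := by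
      ext v
      simp [fixedSpace]
    have h2 := Submodule.finrank_sup_add_finrank_inf_eq (fixedSpace ρ {c})
      (fixedSpace ρ (C : Set G))
    have h3 := Submodule.finrank_le (fixedSpace ρ {c} ⊔ fixedSpace ρ (C : Set G))
    have h4 := Submodule.finrank_add_finrank_orthogonal (fixedSpace ρ {c})
    have h5 := Submodule.finrank_add_finrank_orthogonal (fixedSpace ρ (C : Set G))
    have h6 := Submodule.finrank_add_finrank_orthogonal
      (fixedSpace ρ {c} ⊓ fixedSpace ρ (C : Set G))
    rw [h1]
    omega

/-- Replace a unitary representation by the trivial one on the complement of an invariant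
subspace. -/
noncomputable def trivializeRep (ρ : G →* (V ≃ₗᵢ[ℂ] V)) (E : Submodule ℂ V)
    (hE : ∀ g, ∀ v ∈ E, ρ g v ∈ E) : G →* (V ≃ₗᵢ[ℂ] V) :=
  ofIsometric
    { toFun := fun g => unitaryOp (ρ g) ∘ₗ E.starProjection.toLinearMap +
        Eᗮ.starProjection.toLinearMap
      map_one' := by
        ext v
        change ρ 1 (E.starProjection v) + Eᗮ.starProjection v = v
        rw [map_one]
        exact Submodule.starProjection_add_starProjection_orthogonal v
      map_mul' := fun a b => by
        ext v
        change ρ (a * b) (E.starProjection v) + Eᗮ.starProjection v =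
          ρ a (E.starProjection (ρ b (E.starProjection v) + Eᗮ.starProjection v)) +
            Eᗮ.starProjection (ρ b (E.starProjection v) + Eᗮ.starProjection v)
        have h1 : ρ b (E.starProjection v) ∈ E := hE b _ (Submodule.starProjection_apply_mem _ _)
        have h2 : Eᗮ.starProjection v ∈ Eᗮ := Submodule.starProjection_apply_mem _ _
        have h3 : E.starProjection (ρ b (E.starProjection v) + Eᗮ.starProjection v) =
            ρ b (E.starProjection v) := by
          rw [map_add, Submodule.starProjection_eq_self_iff.mpr h1,
            (Submodule.starProjection_apply_eq_zero_iff E).mpr h2, add_zero]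
        have h4 : Eᗮ.starProjection (ρ b (E.starProjection v) + Eᗮ.starProjection v) =
            Eᗮ.starProjection v := by
          rw [map_add, Submodule.starProjection_eq_self_iff.mpr h2,
            Submodule.starProjection_orthogonal_apply_eq_zero h1, zero_add]
        rw [h3, h4, urep_mul_apply] } fun g v => by
      change ‖ρ g (E.starProjection v) + Eᗮ.starProjection v‖ = ‖v‖
      have h1 : ρ g (E.starProjection v) ∈ E := hE g _ (Submodule.starProjection_apply_mem _ _)
      have h2 : Eᗮ.starProjection v ∈ Eᗮ := Submodule.starProjection_apply_mem _ _
      conv_rhs => rw [← Submodule.starProjection_add_starProjection_orthogonal (K := E) v]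
      rw [← sq_eq_sq₀ (norm_nonneg _) (norm_nonneg _), sq, sq,
        norm_add_sq_eq_norm_sq_add_norm_sq_of_inner_eq_zero _ _ (h2 _ h1),
        norm_add_sq_eq_norm_sq_add_norm_sq_of_inner_eq_zero _ _
          (h2 _ (Submodule.starProjection_apply_mem E v)), LinearIsometryEquiv.norm_map]

theorem trivializeRep_apply (ρ : G →* (V ≃ₗᵢ[ℂ] V)) (E : Submodule ℂ V)
    (hE : ∀ g, ∀ v ∈ E, ρ g v ∈ E) (g : G) (v : V) :
    trivializeRep ρ E hE g v = ρ g (E.starProjection v) + Eᗮ.starProjection v := rfl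

theorem trivializeRep_eq_one {ρ : G →* (V ≃ₗᵢ[ℂ] V)} {E : Submodule ℂ V}
    {hE : ∀ g, ∀ v ∈ E, ρ g v ∈ E} {g : G} (hg : ∀ v ∈ E, ρ g v = v) :
    trivializeRep ρ E hE g = 1 := by
  ext v
  rw [trivializeRep_apply, hg _ (Submodule.starProjection_apply_mem _ _),
    Submodule.starProjection_add_starProjection_orthogonal]
  rfl

theorem hs_sub_trivializeRep_le (ρ : G →* (V ≃ₗᵢ[ℂ] V)) (E : Submodule ℂ V)
    (hE : ∀ g, ∀ v ∈ E, ρ g v ∈ E) (g : G) :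
    hs (unitaryOp (ρ g) - unitaryOp (trivializeRep ρ E hE g)) ≤
      2 * Real.sqrt (Module.finrank ℂ Eᗮ) := by
  rw [← hs_sq_starProjection, Real.sqrt_sq (hs_nonneg _)]
  refine hs_le_mul_of_norm_le zero_le_two fun v => ?_
  change ‖ρ g v - (ρ g (E.starProjection v) + Eᗮ.starProjection v)‖ ≤ 2 * ‖Eᗮ.starProjection v‖
  have h1 : ρ g v - (ρ g (E.starProjection v) + Eᗮ.starProjection v) =
      ρ g (Eᗮ.starProjection v) - Eᗮ.starProjection v := by
    conv_lhs => enter [1]; rw [← Submodule.starProjection_add_starProjection_orthogonal (K := E) v]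
    rw [map_add]
    abel
  rw [h1]
  refine (norm_sub_le _ _).trans ?_
  rw [LinearIsometryEquiv.norm_map]
  linarith

end Fixed

/-! ### Comparing operators across an isometric embedding -/

section Compare

variable {X Y : Type*} [NormedAddCommGroup X] [InnerProductSpace ℂ X] [FiniteDimensional ℂ X]
  [NormedAddCommGroup Y] [InnerProductSpace ℂ Y] [FiniteDimensional ℂ Y]

theorem hs_id_sub_range_projection (ι : X →ₗᵢ[ℂ] Y) :
    hs (LinearMap.id - ι.toLinearMap ∘ₗ LinearMap.adjoint ι.toLinearMap) =
      Real.sqrt (Module.finrank ℂ Y - Module.finrank ℂ X) := by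
  rw [← hs_id_sub_range_projection_sq ι, Real.sqrt_sq (hs_nonneg _)]

theorem norm_isometry_adjoint_apply_le (ι : X →ₗᵢ[ℂ] Y) (y : Y) :
    ‖LinearMap.adjoint ι.toLinearMap y‖ ≤ ‖y‖ :=
  norm_adjoint_apply_le (fun x => (ι.norm_map x).le) y

/-- Split the identity of Y into the projection ιι* and its complement, whose Hilbert–Schmidt norm
is the square root of the codimension. -/
theorem hs_le_hs_comp_isometry_add {W : Type*} [NormedAddCommGroup W] [InnerProductSpace ℂ W]
    [FiniteDimensional ℂ W] (ι : X →ₗᵢ[ℂ] Y) {A : Y →ₗ[ℂ] W} {c : ℝ} (hc : 0 ≤ c)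
    (hA : ∀ y, ‖A y‖ ≤ c * ‖y‖) :
    hs A ≤ hs (A ∘ₗ ι.toLinearMap) +
      c * Real.sqrt (Module.finrank ℂ Y - Module.finrank ℂ X) := by
  have h1 : A = (A ∘ₗ ι.toLinearMap) ∘ₗ LinearMap.adjoint ι.toLinearMap +
      A ∘ₗ (LinearMap.id - ι.toLinearMap ∘ₗ LinearMap.adjoint ι.toLinearMap) := by
    ext y
    simp
  conv_lhs => rw [h1]
  refine (hs_add_le _ _).trans (add_le_add (hs_comp_le_right _ _
    (norm_isometry_adjoint_apply_le ι)) ?_)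
  rw [← hs_id_sub_range_projection]
  exact hs_le_mul_of_norm_le hc fun y => hA _

theorem norm_trace_sub_trace_le (ι : X →ₗᵢ[ℂ] Y) (U : X →ₗ[ℂ] X) {V : Y →ₗ[ℂ] Y}
    (hV : ∀ y, ‖V y‖ ≤ ‖y‖) :
    ‖LinearMap.trace ℂ Y V - LinearMap.trace ℂ X U‖ ≤
      Real.sqrt (Module.finrank ℂ X) * hs (ι.toLinearMap ∘ₗ U - V ∘ₗ ι.toLinearMap) +
        Real.sqrt (Module.finrank ℂ Y) *
          Real.sqrt (Module.finrank ℂ Y - Module.finrank ℂ X) := by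
  have h1 : LinearMap.trace ℂ X (compression ι V) = LinearMap.trace ℂ Y
      (V ∘ₗ (ι.toLinearMap ∘ₗ LinearMap.adjoint ι.toLinearMap)) := by
    rw [compression, LinearMap.trace_comp_comm', LinearMap.comp_assoc]
  have h2 : LinearMap.trace ℂ Y V - LinearMap.trace ℂ X U =
      -LinearMap.trace ℂ X (U - compression ι V) + LinearMap.trace ℂ Y
        (V ∘ₗ (LinearMap.id - ι.toLinearMap ∘ₗ LinearMap.adjoint ι.toLinearMap)) := by
    rw [map_sub, h1, LinearMap.comp_sub, map_sub, LinearMap.comp_id]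
    ring
  rw [h2]
  refine (norm_add_le _ _).trans (add_le_add ?_ ?_)
  · rw [norm_neg]
    exact (norm_trace_le _).trans (by gcongr; exact hs_sub_compression_le ι U V)
  · refine (norm_trace_le _).trans ?_
    rw [← hs_id_sub_range_projection]
    gcongr
    exact hs_comp_le _ hV _

theorem hs_adjoint_isometry_intertwine (ι : X →ₗᵢ[ℂ] Y) (U : X ≃ₗᵢ[ℂ] X) (V : Y ≃ₗᵢ[ℂ] Y) :
    hs (unitaryOp U ∘ₗ LinearMap.adjoint ι.toLinearMap -
        LinearMap.adjoint ι.toLinearMap ∘ₗ unitaryOp V) =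
      hs (ι.toLinearMap ∘ₗ unitaryOp U - unitaryOp V ∘ₗ ι.toLinearMap) := by
  rw [← hs_adjoint, map_sub, LinearMap.adjoint_comp, LinearMap.adjoint_comp,
    LinearMap.adjoint_adjoint, adjoint_unitaryOp, adjoint_unitaryOp,
    ← hs_comp_of_isometry (unitaryOp V) (fun y => V.norm_map y), ← hs_comp_equiv _ U, hs_sub_comm]
  have h1 : (unitaryOp V ∘ₗ (ι.toLinearMap ∘ₗ unitaryOp U⁻¹ - unitaryOp V⁻¹ ∘ₗ ι.toLinearMap)) ∘ₗ
      U.toLinearEquiv.toLinearMap =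
      unitaryOp V ∘ₗ ι.toLinearMap - ι.toLinearMap ∘ₗ unitaryOp U := by
    ext x
    change V (ι (U⁻¹ (U x)) - V⁻¹ (ι (U x))) = V (ι x) - ι (U x)
    rw [map_sub]
    change V (ι (U.symm (U x))) - V (V.symm (ι (U x))) = _
    rw [U.symm_apply_apply, V.apply_symm_apply]
  rw [h1]

end Compare

/-! ### Approximate intertwiners -/

section Intertwine

variable {H X Z : Type*} [Group H]
  [NormedAddCommGroup X] [InnerProductSpace ℂ X] [FiniteDimensional ℂ X]
  [NormedAddCommGroup Z] [InnerProductSpace ℂ Z] [FiniteDimensional ℂ Z]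

/-- S is the mean of a(h) T b(h)⁻¹ over `H`. -/
theorem exists_equivariant_average [Fintype H] (a b : H →* (Z ≃ₗᵢ[ℂ] Z)) {T : Z →ₗ[ℂ] Z}
    (hT : ∀ z, ‖T z‖ ≤ ‖z‖) :
    ∃ S : Z →ₗ[ℂ] Z, (∀ h z, S (b h z) = a h (S z)) ∧ (∀ z, ‖S z‖ ≤ ‖z‖) ∧
      hs (S - T) ≤ ∑ h, hs (unitaryOp (a h) ∘ₗ T - T ∘ₗ unitaryOp (b h)) := by
  set N : ℂ := (Fintype.card H : ℂ) with hN
  have hN0 : N ≠ 0 := Nat.cast_ne_zero.mpr Fintype.card_ne_zero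
  have hN1 : ‖N⁻¹‖ ≤ 1 := by
    rw [norm_inv, hN, Complex.norm_natCast]
    exact inv_le_one_of_one_le₀ (by exact_mod_cast Fintype.card_pos)
  let R : H → Z →ₗ[ℂ] Z := fun h => unitaryOp (a h) ∘ₗ T ∘ₗ unitaryOp (b h⁻¹)
  have hR : ∀ h z, R h z = a h (T (b h⁻¹ z)) := fun _ _ => rfl
  let S : Z →ₗ[ℂ] Z := N⁻¹ • ∑ h, R h
  have hSapp : ∀ z, S z = N⁻¹ • ∑ h, R h z := fun z => by
    simp only [S, LinearMap.smul_apply, LinearMap.sum_apply]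
  refine ⟨S, fun k z => ?_, fun z => ?_, ?_⟩
  · rw [hSapp, hSapp, map_smul, map_sum]
    congr 1
    refine Fintype.sum_equiv (Equiv.mulLeft k⁻¹) _ _ fun h => ?_
    rw [Equiv.coe_mulLeft, hR, hR, ← urep_mul_apply, ← urep_mul_apply]
    simp
  · rw [hSapp, norm_smul, norm_inv, hN, Complex.norm_natCast]
    have h1 : ‖∑ h, R h z‖ ≤ Fintype.card H * ‖z‖ := by
      refine (norm_sum_le _ _).trans ?_
      have : ∑ h, ‖R h z‖ ≤ ∑ _h : H, ‖z‖ := by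
        refine Finset.sum_le_sum fun h _ => ?_
        rw [hR, LinearIsometryEquiv.norm_map]
        exact (hT _).trans (LinearIsometryEquiv.norm_map _ _).le
      simpa using this
    rwa [inv_mul_le_iff₀ (by exact_mod_cast Fintype.card_pos)]
  · have h1 : S - T = N⁻¹ • ∑ h, (unitaryOp (a h) ∘ₗ T - T ∘ₗ unitaryOp (b h)) ∘ₗ
        unitaryOp (b h⁻¹) := by
      ext z
      have h2 : ∀ h, ((unitaryOp (a h) ∘ₗ T - T ∘ₗ unitaryOp (b h)) ∘ₗ unitaryOp (b h⁻¹)) z =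
          R h z - T z := fun h => by
        change a h (T (b h⁻¹ z)) - T (b h (b h⁻¹ z)) = _
        rw [urep_apply_inv_self, hR]
      rw [LinearMap.sub_apply, hSapp, LinearMap.smul_apply, LinearMap.sum_apply]
      simp only [h2, Finset.sum_sub_distrib, smul_sub]
      congr 1
      rw [Finset.sum_const, Finset.card_univ, ← Nat.cast_smul_eq_nsmul ℂ, smul_smul, ← hN,
        inv_mul_cancel₀ hN0, one_smul]
    rw [h1, hs_smul]
    refine (mul_le_of_le_one_left (hs_nonneg _) hN1).trans ((hs_sum_le _ _).trans ?_)
    refine Finset.sum_le_sum fun h _ => ?_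
    exact hs_comp_le_right _ _ fun z => (LinearIsometryEquiv.norm_map _ _).le

/-- Averaging T to S costs ‖S - T‖ once directly and twice more in passing from T*T to S*S, whence
the factor 3. -/
theorem exists_unitary_intertwiner_near [Fintype H] (a b : H →* (Z ≃ₗᵢ[ℂ] Z))
    (hchar : ∀ h, uchar b h = uchar a h) {T : Z →ₗ[ℂ] Z} (hT : ∀ z, ‖T z‖ ≤ ‖z‖)
    {ε : ℝ} (hε : 0 < ε) :
    ∃ τ : Z ≃ₗᵢ[ℂ] Z, (∀ h, τ * b h = a h * τ) ∧
      hs (unitaryOp τ - T) ≤ hs (LinearMap.id - LinearMap.adjoint T ∘ₗ T) +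
        3 * ∑ h, hs (unitaryOp (a h) ∘ₗ T - T ∘ₗ unitaryOp (b h)) + ε := by
  obtain ⟨S, hS, hS1, hST⟩ := exists_equivariant_average a b hT
  obtain ⟨τ, hτ, hτS⟩ := exists_unitary_intertwiner b a hchar S hS hε
  refine ⟨τ, hτ, ?_⟩
  have h1 : hs (LinearMap.adjoint T ∘ₗ T - LinearMap.adjoint T ∘ₗ S) ≤ hs (S - T) := by
    rw [← LinearMap.comp_sub, hs_sub_comm S T]
    exact hs_comp_le _ (norm_adjoint_apply_le hT) _
  have h2 : hs (LinearMap.adjoint T ∘ₗ S - LinearMap.adjoint S ∘ₗ S) ≤ hs (S - T) := by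
    rw [← LinearMap.sub_comp, ← map_sub, hs_sub_comm S T, ← hs_adjoint (T - S)]
    exact hs_comp_le_right _ _ hS1
  have h3 := hs_sub_le (LinearMap.adjoint T ∘ₗ T) (LinearMap.adjoint T ∘ₗ S)
    (LinearMap.adjoint S ∘ₗ S)
  have h4 := hs_sub_le LinearMap.id (LinearMap.adjoint T ∘ₗ T) (LinearMap.adjoint S ∘ₗ S)
  have h5 := hs_sub_le (unitaryOp τ) S T
  linarith

/-- Applied to the partial isometry T = κtκ*, for which T*T = κκ* misses the identity only by the
codimension of X. The three summands are the failures of κ to intertwine `U₁` with `a`, of t to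
intertwine `U₂` with `U₁`, and of κ to intertwine `U₂` with `b`. -/
theorem exists_unitary_intertwiner_extending [Fintype H] (a b : H →* (Z ≃ₗᵢ[ℂ] Z))
    (hchar : ∀ h, uchar b h = uchar a h) (κ : X →ₗᵢ[ℂ] Z) (t : X ≃ₗᵢ[ℂ] X)
    (U₁ U₂ : H → (X ≃ₗᵢ[ℂ] X)) {ε : ℝ} (hε : 0 < ε) :
    ∃ τ : Z ≃ₗᵢ[ℂ] Z, (∀ h, τ * b h = a h * τ) ∧
      hs (κ.toLinearMap ∘ₗ unitaryOp t - unitaryOp τ ∘ₗ κ.toLinearMap) ≤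
        Real.sqrt (Module.finrank ℂ Z - Module.finrank ℂ X) +
        3 * ∑ h, (hs (κ.toLinearMap ∘ₗ unitaryOp (U₁ h) - unitaryOp (a h) ∘ₗ κ.toLinearMap) +
          hs (unitaryOp (U₁ h * t) - unitaryOp (t * U₂ h)) +
          hs (κ.toLinearMap ∘ₗ unitaryOp (U₂ h) - unitaryOp (b h) ∘ₗ κ.toLinearMap)) + ε := by
  let T : Z →ₗ[ℂ] Z := κ.toLinearMap ∘ₗ unitaryOp t ∘ₗ LinearMap.adjoint κ.toLinearMap
  have hT : ∀ z, ‖T z‖ ≤ ‖z‖ := fun z => by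
    change ‖κ (t (LinearMap.adjoint κ.toLinearMap z))‖ ≤ ‖z‖
    rw [κ.norm_map, t.norm_map]
    exact norm_isometry_adjoint_apply_le κ z
  have hκκ : ∀ x, LinearMap.adjoint κ.toLinearMap (κ x) = x := fun x =>
    congrArg (fun f : X →ₗ[ℂ] X => f x) (adjoint_comp_isometry κ)
  have hTT : LinearMap.adjoint T ∘ₗ T = κ.toLinearMap ∘ₗ LinearMap.adjoint κ.toLinearMap := by
    simp only [T, LinearMap.adjoint_comp, LinearMap.adjoint_adjoint, adjoint_unitaryOp]
    ext z
    change κ (t⁻¹ (LinearMap.adjoint κ.toLinearMap (κ (t (LinearMap.adjoint κ.toLinearMap z))))) =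
      κ (LinearMap.adjoint κ.toLinearMap z)
    rw [hκκ]
    exact congrArg κ (t.symm_apply_apply _)
  obtain ⟨τ, hτ, hτT⟩ := exists_unitary_intertwiner_near a b hchar hT hε
  refine ⟨τ, hτ, ?_⟩
  have h1 : κ.toLinearMap ∘ₗ unitaryOp t - unitaryOp τ ∘ₗ κ.toLinearMap =
      (T - unitaryOp τ) ∘ₗ κ.toLinearMap := by
    ext x
    change κ (t x) - τ (κ x) = κ (t (LinearMap.adjoint κ.toLinearMap (κ x))) - τ (κ x)
    rw [hκκ]
  rw [h1]
  refine (hs_comp_le_right _ _ fun x => (κ.norm_map x).le).trans ?_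
  rw [hs_sub_comm]
  refine hτT.trans ?_
  rw [hTT, hs_id_sub_range_projection]
  gcongr with h _
  have h2 : hs (unitaryOp (a h) ∘ₗ T - (κ.toLinearMap ∘ₗ unitaryOp (U₁ h)) ∘ₗ
      unitaryOp t ∘ₗ LinearMap.adjoint κ.toLinearMap) ≤
      hs (κ.toLinearMap ∘ₗ unitaryOp (U₁ h) - unitaryOp (a h) ∘ₗ κ.toLinearMap) := by
    rw [show unitaryOp (a h) ∘ₗ T = (unitaryOp (a h) ∘ₗ κ.toLinearMap) ∘ₗ
      unitaryOp t ∘ₗ LinearMap.adjoint κ.toLinearMap from rfl, ← LinearMap.sub_comp, hs_sub_comm]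
    refine hs_comp_le_right _ _ fun z => ?_
    exact (t.norm_map _).le.trans (norm_isometry_adjoint_apply_le κ z)
  have h3 : hs ((κ.toLinearMap ∘ₗ unitaryOp (U₁ h)) ∘ₗ unitaryOp t ∘ₗ
      LinearMap.adjoint κ.toLinearMap - κ.toLinearMap ∘ₗ unitaryOp (t * U₂ h) ∘ₗ
      LinearMap.adjoint κ.toLinearMap) ≤ hs (unitaryOp (U₁ h * t) - unitaryOp (t * U₂ h)) := by
    rw [show (κ.toLinearMap ∘ₗ unitaryOp (U₁ h)) ∘ₗ unitaryOp t ∘ₗ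
      LinearMap.adjoint κ.toLinearMap = κ.toLinearMap ∘ₗ unitaryOp (U₁ h * t) ∘ₗ
      LinearMap.adjoint κ.toLinearMap from rfl, ← LinearMap.comp_sub, ← LinearMap.sub_comp,
      hs_comp_of_isometry _ (fun x => κ.norm_map x)]
    exact hs_comp_le_right _ _ (norm_isometry_adjoint_apply_le κ)
  have h4 : hs (κ.toLinearMap ∘ₗ unitaryOp (t * U₂ h) ∘ₗ LinearMap.adjoint κ.toLinearMap -
      T ∘ₗ unitaryOp (b h)) ≤
      hs (κ.toLinearMap ∘ₗ unitaryOp (U₂ h) - unitaryOp (b h) ∘ₗ κ.toLinearMap) := by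
    rw [← hs_adjoint_isometry_intertwine]
    refine hs_le_of_norm_le fun z => le_of_eq ?_
    change ‖κ (t (U₂ h (LinearMap.adjoint κ.toLinearMap z))) -
      κ (t (LinearMap.adjoint κ.toLinearMap (b h z)))‖ =
      ‖U₂ h (LinearMap.adjoint κ.toLinearMap z) - LinearMap.adjoint κ.toLinearMap (b h z)‖
    rw [← map_sub, κ.norm_map, ← map_sub, t.norm_map]
  have h5 := hs_sub_le (unitaryOp (a h) ∘ₗ T) ((κ.toLinearMap ∘ₗ unitaryOp (U₁ h)) ∘ₗ
      unitaryOp t ∘ₗ LinearMap.adjoint κ.toLinearMap) (T ∘ₗ unitaryOp (b h))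
  have h6 := hs_sub_le ((κ.toLinearMap ∘ₗ unitaryOp (U₁ h)) ∘ₗ
      unitaryOp t ∘ₗ LinearMap.adjoint κ.toLinearMap)
      (κ.toLinearMap ∘ₗ unitaryOp (t * U₂ h) ∘ₗ LinearMap.adjoint κ.toLinearMap)
      (T ∘ₗ unitaryOp (b h))
  linarith

end Intertwine

/-! ### Estimates for approximate intertwining -/

section Estimates

variable {G X Y : Type*} [Group G]
  [NormedAddCommGroup X] [InnerProductSpace ℂ X] [FiniteDimensional ℂ X]
  [NormedAddCommGroup Y] [InnerProductSpace ℂ Y] [FiniteDimensional ℂ Y]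

theorem hs_unitaryOp_comp (V : Y ≃ₗᵢ[ℂ] Y) (A : X →ₗ[ℂ] Y) : hs (unitaryOp V ∘ₗ A) = hs A :=
  hs_comp_of_isometry _ V.norm_map A

theorem hs_intertwine_mul_le (κ : X →ₗᵢ[ℂ] Y) (f : G → (X ≃ₗᵢ[ℂ] X)) (Ψ : G →* (Y ≃ₗᵢ[ℂ] Y))
    (a b : G) :
    hs (κ.toLinearMap ∘ₗ unitaryOp (f (a * b)) - unitaryOp (Ψ (a * b)) ∘ₗ κ.toLinearMap) ≤
      hs (unitaryOp (f a * f b) - unitaryOp (f (a * b))) +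
      (hs (κ.toLinearMap ∘ₗ unitaryOp (f a) - unitaryOp (Ψ a) ∘ₗ κ.toLinearMap) +
        hs (κ.toLinearMap ∘ₗ unitaryOp (f b) - unitaryOp (Ψ b) ∘ₗ κ.toLinearMap)) := by
  have h1 : κ.toLinearMap ∘ₗ unitaryOp (f (a * b)) - unitaryOp (Ψ (a * b)) ∘ₗ κ.toLinearMap =
      κ.toLinearMap ∘ₗ (unitaryOp (f (a * b)) - unitaryOp (f a * f b)) +
      ((κ.toLinearMap ∘ₗ unitaryOp (f a) - unitaryOp (Ψ a) ∘ₗ κ.toLinearMap) ∘ₗ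
        (f b).toLinearEquiv.toLinearMap + unitaryOp (Ψ a) ∘ₗ
        (κ.toLinearMap ∘ₗ unitaryOp (f b) - unitaryOp (Ψ b) ∘ₗ κ.toLinearMap)) := by
    ext x
    change κ (f (a * b) x) - Ψ (a * b) (κ x) = κ (f (a * b) x - f a (f b x)) +
      ((κ (f a (f b x)) - Ψ a (κ (f b x))) + Ψ a (κ (f b x) - Ψ b (κ x)))
    rw [urep_mul_apply, map_sub, map_sub]
    abel
  rw [h1]
  refine (hs_add_le _ _).trans (add_le_add ?_ ((hs_add_le _ _).trans (add_le_add ?_ ?_)))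
  · rw [hs_comp_of_isometry _ (fun x => κ.norm_map x), hs_sub_comm]
  · rw [hs_comp_equiv]
  · rw [hs_unitaryOp_comp]

/-- The last term controls f(1) - id, since f(1)f(1) - f(1) = f(1)(f(1) - id). -/
theorem hs_intertwine_inv_le (κ : X →ₗᵢ[ℂ] Y) (f : G → (X ≃ₗᵢ[ℂ] X)) (Ψ : G →* (Y ≃ₗᵢ[ℂ] Y))
    (a : G) :
    hs (κ.toLinearMap ∘ₗ unitaryOp (f a⁻¹) - unitaryOp (Ψ a⁻¹) ∘ₗ κ.toLinearMap) ≤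
      hs (κ.toLinearMap ∘ₗ unitaryOp (f a) - unitaryOp (Ψ a) ∘ₗ κ.toLinearMap) +
      (hs (unitaryOp (f a * f a⁻¹) - unitaryOp (f (a * a⁻¹))) +
        hs (unitaryOp (f 1 * f 1) - unitaryOp (f (1 * 1)))) := by
  have h1 : unitaryOp (Ψ a) ∘ₗ
      (κ.toLinearMap ∘ₗ unitaryOp (f a⁻¹) - unitaryOp (Ψ a⁻¹) ∘ₗ κ.toLinearMap) =
      (unitaryOp (Ψ a) ∘ₗ κ.toLinearMap - κ.toLinearMap ∘ₗ unitaryOp (f a)) ∘ₗ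
        (f a⁻¹).toLinearEquiv.toLinearMap + (κ.toLinearMap ∘ₗ
        (unitaryOp (f a * f a⁻¹) - unitaryOp (f (a * a⁻¹))) +
        κ.toLinearMap ∘ₗ (unitaryOp (f 1) - LinearMap.id)) := by
    ext x
    change Ψ a (κ (f a⁻¹ x) - Ψ a⁻¹ (κ x)) = (Ψ a (κ (f a⁻¹ x)) - κ (f a (f a⁻¹ x))) +
      (κ (f a (f a⁻¹ x) - f (a * a⁻¹) x) + κ (f 1 x - x))
    rw [map_sub, map_sub, map_sub, urep_apply_inv_self, mul_inv_cancel]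
    abel
  have h2 : unitaryOp (f 1 * f 1) - unitaryOp (f (1 * 1)) =
      unitaryOp (f 1) ∘ₗ (unitaryOp (f 1) - LinearMap.id) := by
    rw [mul_one]
    ext x
    change f 1 (f 1 x) - f 1 x = f 1 (f 1 x - x)
    rw [map_sub]
  rw [← hs_unitaryOp_comp (Ψ a), h1, h2, hs_unitaryOp_comp]
  refine (hs_add_le _ _).trans (add_le_add ?_ ((hs_add_le _ _).trans (add_le_add ?_ ?_)))
  · rw [hs_comp_equiv, hs_sub_comm]
  · rw [hs_comp_of_isometry _ (fun x => κ.norm_map x)]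
  · rw [hs_comp_of_isometry _ (fun x => κ.norm_map x)]

theorem hs_sub_id_le_of_left (U₁ U₂ t : X ≃ₗᵢ[ℂ] X) :
    hs (unitaryOp U₂ - LinearMap.id) ≤
      hs (unitaryOp U₁ - LinearMap.id) + hs (unitaryOp (U₁ * t) - unitaryOp (t * U₂)) := by
  have h1 : unitaryOp t ∘ₗ (unitaryOp U₂ - LinearMap.id) =
      (unitaryOp U₁ - LinearMap.id) ∘ₗ t.toLinearEquiv.toLinearMap +
        (unitaryOp (t * U₂) - unitaryOp (U₁ * t)) := by
    ext x
    change t (U₂ x - x) = U₁ (t x) - t x + (t (U₂ x) - U₁ (t x))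
    rw [map_sub]
    abel
  rw [← hs_unitaryOp_comp t, h1]
  refine (hs_add_le _ _).trans (le_of_eq ?_)
  rw [hs_comp_equiv, hs_sub_comm (unitaryOp (t * U₂))]

theorem hs_sub_id_le_of_right (U₁ U₂ t : X ≃ₗᵢ[ℂ] X) :
    hs (unitaryOp U₁ - LinearMap.id) ≤
      hs (unitaryOp U₂ - LinearMap.id) + hs (unitaryOp (U₁ * t) - unitaryOp (t * U₂)) := by
  have h1 : (unitaryOp U₁ - LinearMap.id) ∘ₗ t.toLinearEquiv.toLinearMap =
      unitaryOp t ∘ₗ (unitaryOp U₂ - LinearMap.id) +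
        (unitaryOp (U₁ * t) - unitaryOp (t * U₂)) := by
    ext x
    change U₁ (t x) - t x = t (U₂ x - x) + (U₁ (t x) - t (U₂ x))
    rw [map_sub]
    abel
  rw [← hs_comp_equiv _ t, h1]
  refine (hs_add_le _ _).trans (le_of_eq ?_)
  rw [hs_unitaryOp_comp]

theorem hs_sub_id_le_of_intertwine (ι : X →ₗᵢ[ℂ] Y) (U : X ≃ₗᵢ[ℂ] X) (V : Y ≃ₗᵢ[ℂ] Y) :
    hs (unitaryOp V - LinearMap.id) ≤ hs (unitaryOp U - LinearMap.id) +
      hs (ι.toLinearMap ∘ₗ unitaryOp U - unitaryOp V ∘ₗ ι.toLinearMap) +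
      2 * Real.sqrt (Module.finrank ℂ Y - Module.finrank ℂ X) := by
  refine (hs_le_hs_comp_isometry_add ι zero_le_two fun y => ?_).trans ?_
  · refine (norm_sub_le _ _).trans (le_of_eq ?_)
    change ‖V y‖ + ‖y‖ = _
    rw [V.norm_map, two_mul]
  gcongr
  have h1 : (unitaryOp V - LinearMap.id) ∘ₗ ι.toLinearMap =
      ι.toLinearMap ∘ₗ (unitaryOp U - LinearMap.id) +
      (unitaryOp V ∘ₗ ι.toLinearMap - ι.toLinearMap ∘ₗ unitaryOp U) := by
    ext x
    change V (ι x) - ι x = ι (U x - x) + (V (ι x) - ι (U x))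
    rw [map_sub]
    abel
  rw [h1]
  refine (hs_add_le _ _).trans (le_of_eq ?_)
  rw [hs_comp_of_isometry _ (fun x => ι.norm_map x), hs_sub_comm (unitaryOp V ∘ₗ ι.toLinearMap)]

theorem hs_sub_id_le_of_eq_one (ι : X →ₗᵢ[ℂ] Y) (U : X ≃ₗᵢ[ℂ] X) {V : Y ≃ₗᵢ[ℂ] Y} (hV : V = 1) :
    hs (unitaryOp U - LinearMap.id) ≤
      hs (ι.toLinearMap ∘ₗ unitaryOp U - unitaryOp V ∘ₗ ι.toLinearMap) := by
  rw [← hs_comp_of_isometry _ (fun x => ι.norm_map x), LinearMap.comp_sub, hV]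
  rfl

theorem hs_conj_sub_id (ρ : G →* (X ≃ₗᵢ[ℂ] X)) (g c : G) :
    hs (unitaryOp (ρ (g * c * g⁻¹)) - LinearMap.id) = hs (unitaryOp (ρ c) - LinearMap.id) := by
  rw [← hs_unitaryOp_comp (ρ g) (unitaryOp (ρ c) - LinearMap.id), ← hs_comp_equiv _ (ρ g)]
  congr 1
  ext x
  change ρ (g * c * g⁻¹) (ρ g x) - ρ g x = ρ g (ρ c x - x)
  rw [urep_mul_apply, urep_mul_apply, urep_inv_apply_self, map_sub]

theorem norm_trace_sub_trace_of_conj_le (U₁ U₂ t : X ≃ₗᵢ[ℂ] X) :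
    ‖LinearMap.trace ℂ X (unitaryOp U₁) - LinearMap.trace ℂ X (unitaryOp U₂)‖ ≤
      Real.sqrt (Module.finrank ℂ X) * hs (unitaryOp (U₁ * t) - unitaryOp (t * U₂)) := by
  have h1 : LinearMap.trace ℂ X (unitaryOp U₁) =
      LinearMap.trace ℂ X (unitaryOp t⁻¹ ∘ₗ unitaryOp (U₁ * t)) := by
    rw [LinearMap.trace_comp_comm']
    congr 1
    ext x
    change U₁ x = U₁ (t (t.symm x))
    rw [t.apply_symm_apply]
  have h2 : LinearMap.trace ℂ X (unitaryOp U₂) =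
      LinearMap.trace ℂ X (unitaryOp t⁻¹ ∘ₗ unitaryOp (t * U₂)) := by
    congr 1
    ext x
    change U₂ x = t.symm (t (U₂ x))
    rw [t.symm_apply_apply]
  rw [h1, h2, ← map_sub, ← LinearMap.comp_sub]
  refine (norm_trace_le _).trans ?_
  gcongr
  exact (hs_unitaryOp_comp _ _).le

/-- Traces are compared along the chain ρ(`i₁ h`), `U₁`, `U₂`, ρ(`i₂ h`); the middle comparison uses
that t nearly conjugates `U₂` to `U₁`. -/
theorem norm_charDefect_le {H : Type*} [Group H] (i₁ i₂ : H →* G) (ρ : G →* (Y ≃ₗᵢ[ℂ] Y))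
    (ι : X →ₗᵢ[ℂ] Y) (U₁ U₂ t : X ≃ₗᵢ[ℂ] X) (h : H) :
    ‖charDefect i₁ i₂ ρ h‖ ≤ Real.sqrt (Module.finrank ℂ X) *
      (hs (ι.toLinearMap ∘ₗ unitaryOp U₁ - unitaryOp (ρ (i₁ h)) ∘ₗ ι.toLinearMap) +
        hs (unitaryOp (U₁ * t) - unitaryOp (t * U₂)) +
        hs (ι.toLinearMap ∘ₗ unitaryOp U₂ - unitaryOp (ρ (i₂ h)) ∘ₗ ι.toLinearMap)) +
      2 * (Real.sqrt (Module.finrank ℂ Y) *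
        Real.sqrt (Module.finrank ℂ Y - Module.finrank ℂ X)) := by
  have h1 := norm_trace_sub_trace_le ι (unitaryOp U₁) (V := unitaryOp (ρ (i₁ h)))
    fun y => ((ρ (i₁ h)).norm_map y).le
  have h2 := norm_trace_sub_trace_le ι (unitaryOp U₂) (V := unitaryOp (ρ (i₂ h)))
    fun y => ((ρ (i₂ h)).norm_map y).le
  have h3 := norm_trace_sub_trace_of_conj_le U₁ U₂ t
  have h4 : charDefect i₁ i₂ ρ h =
      (uchar ρ (i₁ h) - LinearMap.trace ℂ X (unitaryOp U₁)) +
      ((LinearMap.trace ℂ X (unitaryOp U₁) - LinearMap.trace ℂ X (unitaryOp U₂)) -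
        (uchar ρ (i₂ h) - LinearMap.trace ℂ X (unitaryOp U₂))) := by
    rw [charDefect]
    ring
  rw [h4]
  refine (norm_add_le _ _).trans ?_
  have h5 := norm_sub_le (LinearMap.trace ℂ X (unitaryOp U₁) - LinearMap.trace ℂ X (unitaryOp U₂))
    (uchar ρ (i₂ h) - LinearMap.trace ℂ X (unitaryOp U₂))
  rw [uchar, uchar] at *
  linarith

theorem exists_normal_finiteIndex_of_unitary_ne_one [Group.FG G] (ρ : G →* (X ≃ₗᵢ[ℂ] X)) {g : G}
    (hg : ρ g ≠ 1) :
    ∃ N : Subgroup G, N.Normal ∧ N.FiniteIndex ∧ g ∉ N ∧ ∀ x, ρ x = 1 → x ∈ N := by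
  classical
  let e := LinearMap.toMatrixAlgEquiv (stdOrthonormalBasis ℂ X).toBasis
  let R : G →* Matrix (Fin (Module.finrank ℂ X)) (Fin (Module.finrank ℂ X)) ℂ :=
    { toFun := fun g => e (linRep ρ g)
      map_one' := by rw [map_one, map_one]
      map_mul' := fun a b => by rw [map_mul, map_mul] }
  obtain ⟨N, hN, hN', hgN, hker⟩ := exists_normal_finiteIndex_of_matrix_ne_one R (g := g) (by
    intro h
    apply hg
    have h1 : linRep ρ g = 1 := e.injective (h.trans (map_one e).symm)
    ext x
    exact congrArg (fun f : X →ₗ[ℂ] X => f x) h1)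
  refine ⟨N, hN, hN', hgN, fun x hx => hker x ?_⟩
  have h1 : linRep ρ x = 1 := by
    ext v
    change ρ x v = v
    rw [hx]
    rfl
  change e (linRep ρ x) = 1
  rw [h1, map_one]

end Estimates

/-! ### Flexible Hilbert–Schmidt stability -/

section HSMain

open Asymptotics

theorem isLittleO_of_nonneg_of_le {r s d : ℕ → ℝ} (h0 : ∀ n, 0 ≤ r n) (h : ∀ n, r n ≤ s n)
    (hs : s =o[atTop] d) : r =o[atTop] d :=
  (IsBigO.of_bound' (Eventually.of_forall fun n => by
    rw [Real.norm_of_nonneg (h0 n)]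
    exact (h n).trans (le_abs_self _))).trans_isLittleO hs

theorem isLittleO_sqrt {r d : ℕ → ℝ} (h0 : ∀ n, 0 ≤ r n)
    (hr : r =o[atTop] fun n => d n ^ 2) : (fun n => Real.sqrt (r n)) =o[atTop] d := by
  refine IsLittleO.of_pow (n := 2) ?_ two_ne_zero
  refine hr.congr_left fun n => ?_
  exact (Real.sq_sqrt (h0 n)).symm

theorem tendsto_hsNorm_iff {X : ℕ → Type} [∀ n, NormedAddCommGroup (X n)]
    [∀ n, InnerProductSpace ℂ (X n)] [∀ n, FiniteDimensional ℂ (X n)] [∀ n, Nontrivial (X n)]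
    (A : ∀ n, X n →ₗ[ℂ] X n) :
    Tendsto (fun n => hsNorm (A n)) atTop (𝓝 0) ↔
      (fun n => hs (A n)) =o[atTop] fun n => Real.sqrt (Module.finrank ℂ (X n)) := by
  rw [isLittleO_iff_tendsto fun n hn => ?_]
  · simp only [hsNorm_eq]
  · have h1 : (0 : ℝ) < Module.finrank ℂ (X n) := by exact_mod_cast Module.finrank_pos
    exact absurd hn (Real.sqrt_pos.mpr h1).ne'

theorem tendsto_div_one_iff_sub_isLittleO {x y : ℕ → ℝ} (hx : ∀ n, x n ≠ 0) :
    Tendsto (fun n => y n / x n) atTop (𝓝 1) ↔ (fun n => y n - x n) =o[atTop] x := by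
  rw [isLittleO_iff_tendsto fun n hn => absurd hn (hx n), ← tendsto_sub_nhds_zero_iff]
  refine tendsto_congr fun n => ?_
  rw [sub_div, div_self (hx n)]

theorem finrank_withLp_prod_euclidean {Y : Type*} [NormedAddCommGroup Y] [InnerProductSpace ℂ Y]
    [FiniteDimensional ℂ Y] (c : ℕ) :
    Module.finrank ℂ (WithLp 2 (Y × EuclideanSpace ℂ (Fin c))) = Module.finrank ℂ Y + c := by
  rw [(WithLp.linearEquiv 2 ℂ (Y × EuclideanSpace ℂ (Fin c))).finrank_eq, Module.finrank_prod,
    finrank_euclideanSpace_fin]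

/-- The isometric embedding of the first factor of an orthogonal sum. -/
noncomputable def inlIsometry (Y W : Type*) [NormedAddCommGroup Y] [InnerProductSpace ℂ Y]
    [NormedAddCommGroup W] [InnerProductSpace ℂ W] : Y →ₗᵢ[ℂ] WithLp 2 (Y × W) where
  toLinearMap := (WithLp.linearEquiv 2 ℂ (Y × W)).symm.toLinearMap ∘ₗ LinearMap.inl ℂ Y W
  norm_map' y := by
    change ‖(WithLp.toLp 2 (y, (0 : W)) : WithLp 2 (Y × W))‖ = ‖y‖
    simp

theorem prodRep_inlIsometry {G Y W : Type*} [Group G] [NormedAddCommGroup Y]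
    [InnerProductSpace ℂ Y] [NormedAddCommGroup W] [InnerProductSpace ℂ W]
    (ρ : G →* (Y ≃ₗᵢ[ℂ] Y)) (σ : G →* (W ≃ₗᵢ[ℂ] W)) (g : G) (y : Y) :
    prodRep ρ σ g (inlIsometry Y W y) = inlIsometry Y W (ρ g y) := by
  rw [prodRep_apply]
  change (WithLp.toLp 2 (ρ g y, σ g 0) : WithLp 2 (Y × W)) = WithLp.toLp 2 (ρ g y, 0)
  rw [map_zero]

theorem flexiblyHSStable_hnn {G H : Type*} [Group G] [Group.FG G] [Group H] [Finite H]
    (i₁ i₂ : H →* G) (h₁ : Function.Injective i₁) (h₂ : Function.Injective i₂)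
    (hn₁ : IsAlmostNormal i₁.range) (hn₂ : IsAlmostNormal i₂.range) (hG : FlexiblyHSStable G) :
    FlexiblyHSStable (HNNOfEmbeddings i₁ i₂ h₁ h₂) := by
  classical
  have := Fintype.ofFinite H
  intro X _ _ _ _ φ hφ₀
  -- d is the unnormalized norm of a unitary of X n. Norms are to be o(d), while dimensions, traces
  -- and defects are to be o(d²).
  let d : ℕ → ℝ := fun n => Real.sqrt (Module.finrank ℂ (X n))
  have hd2 : ∀ n, d n ^ 2 = Module.finrank ℂ (X n) := fun n => Real.sq_sqrt (Nat.cast_nonneg _)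
  have hX0 : ∀ n, (Module.finrank ℂ (X n) : ℝ) ≠ 0 := fun n =>
    Nat.cast_ne_zero.mpr Module.finrank_pos.ne'
  have hφ : ∀ a b, (fun n => hs (unitaryOp (φ n a * φ n b) - unitaryOp (φ n (a * b))))
      =o[atTop] d := fun a b => (tendsto_hsNorm_iff _).mp (hφ₀ a b)
  obtain ⟨Y, _, _, _, ι, ψ, hψ₀, hdim⟩ := hG X (fun n g => φ n (HNNExtension.of g)) fun a b => by
    simpa using hφ₀ (HNNExtension.of a) (HNNExtension.of b)
  have hXY : ∀ n, Module.finrank ℂ (X n) ≤ Module.finrank ℂ (Y n) := fun n =>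
    LinearMap.finrank_le_finrank_of_injective (f := (ι n).toLinearMap) (ι n).injective
  have hXY0 : ∀ n, (0 : ℝ) ≤ Module.finrank ℂ (Y n) - Module.finrank ℂ (X n) := fun n =>
    sub_nonneg.mpr (by exact_mod_cast hXY n)
  have hdim' : (fun n => (Module.finrank ℂ (Y n) - Module.finrank ℂ (X n) : ℝ)) =o[atTop]
      fun n => d n ^ 2 := by
    simp only [hd2]
    exact (tendsto_div_one_iff_sub_isLittleO hX0).mp hdim
  have hδ : (fun n => Real.sqrt (Module.finrank ℂ (Y n) - Module.finrank ℂ (X n))) =o[atTop] d :=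
    isLittleO_sqrt hXY0 hdim'
  -- Closeness to a compression bounds the square of the intertwining error by O(d) · o(d) = o(d²).
  have hψ : ∀ g, (fun n => hs ((ι n).toLinearMap ∘ₗ unitaryOp (φ n (HNNExtension.of g)) -
      unitaryOp (ψ n g) ∘ₗ (ι n).toLinearMap)) =o[atTop] d := by
    intro g
    refine IsLittleO.of_pow (n := 2) ?_ two_ne_zero
    refine isLittleO_of_nonneg_of_le (fun n => sq_nonneg _)
      (fun n => hs_comp_sub_comp_sq_le (ι n) _ _) (IsLittleO.const_mul_left ?_ 2)
    have h1 := (isBigO_refl d atTop).mul_isLittleO ((tendsto_hsNorm_iff _).mp (hψ₀ g))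
    exact h1.congr_right fun n => (sq _).symm
  have hrel : ∀ h, (fun n => hs
      (unitaryOp (φ n (HNNExtension.of (i₁ h)) * φ n HNNExtension.t) -
        unitaryOp (φ n HNNExtension.t * φ n (HNNExtension.of (i₂ h))))) =o[atTop] d := by
    intro h
    refine isLittleO_of_nonneg_of_le (fun n => hs_nonneg _) (fun n => ?_)
      ((hφ (HNNExtension.of (i₁ h)) HNNExtension.t).add
        (hφ HNNExtension.t (HNNExtension.of (i₂ h))))
    rw [hnn_t_mul_of]
    refine (hs_sub_le _ (unitaryOp (φ n (HNNExtension.of (i₁ h) * HNNExtension.t))) _).trans ?_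
    rw [hs_sub_comm (unitaryOp (φ n (HNNExtension.of (i₁ h) * HNNExtension.t)))]
  -- the elements of `H` acting asymptotically nontrivially
  let small : G → Prop := fun g =>
    (fun n => hs (unitaryOp (φ n (HNNExtension.of g)) - LinearMap.id)) =o[atTop] d
  let bad : H → Prop := fun h => ¬ small (i₁ h)
  have hgood₂ : ∀ h, ¬ bad h ↔ small (i₂ h) := by
    intro h
    simp only [bad, not_not]
    exact ⟨fun hh => isLittleO_of_nonneg_of_le (fun n => hs_nonneg _)
        (fun n => hs_sub_id_le_of_left _ _ (φ n HNNExtension.t)) (hh.add (hrel h)),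
      fun hh => isLittleO_of_nonneg_of_le (fun n => hs_nonneg _)
        (fun n => hs_sub_id_le_of_right _ _ (φ n HNNExtension.t)) (hh.add (hrel h))⟩
  let u : H ⊕ H → G := Sum.elim i₁ i₂
  let ubad : H ⊕ H → Prop := Sum.elim bad bad
  have hubad : ∀ s, ¬ ubad s ↔ small (u s) := by
    rintro (h | h)
    · exact not_not
    · exact hgood₂ h
  have hψu : ∀ s, ¬ ubad s → (fun n => hs (unitaryOp (ψ n (u s)) - LinearMap.id)) =o[atTop] d := by
    intro s hs
    exact isLittleO_of_nonneg_of_le (fun n => hs_nonneg _)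
      (fun n => hs_sub_id_le_of_intertwine (ι n) _ _)
      ((((hubad s).mp hs).add (hψ (u s))).add (hδ.const_mul_left 2))
  have hconj : ∀ s, (Set.range fun g : G => g * u s * g⁻¹).Finite := by
    rintro (h | h)
    · exact finite_conjugates_of_isAlmostNormal i₁ hn₁ h
    · exact finite_conjugates_of_isAlmostNormal i₂ hn₂ h
  -- the common fixed vectors of the asymptotically trivial elements
  let C : Finset G := (Finset.univ.filter fun s => ¬ ubad s).biUnion fun s => (hconj s).toFinset
  have hmemC : ∀ c, c ∈ C ↔ ∃ s, ¬ ubad s ∧ ∃ g, g * u s * g⁻¹ = c := by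
    intro c
    simp [C]
  have hCconj : ∀ g, ∀ c ∈ (C : Set G), g⁻¹ * c * g ∈ (C : Set G) := by
    intro g c hc
    obtain ⟨s, hs, k, rfl⟩ := (hmemC c).mp hc
    exact (hmemC _).mpr ⟨s, hs, g⁻¹ * k, by group⟩
  have hupow : ∀ s, u s ^ Nat.card H = 1 := by
    rintro (h | h) <;> simp only [u, Sum.elim_inl, Sum.elim_inr] <;>
      rw [← map_pow, pow_card_eq_one', map_one]
  let E : ∀ n, Submodule ℂ (Y n) := fun n => fixedSpace (ψ n) (C : Set G)
  have hE : ∀ n g, ∀ v ∈ E n, ψ n g v ∈ E n := fun n => fixedSpace_invariant (ψ n) hCconj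
  -- `C` is finite by almost normality and its elements have order dividing |H|, so the codimension
  -- is at most a finite sum of squared o(d) norms.
  have hcodim : (fun n => (Module.finrank ℂ (E n)ᗮ : ℝ)) =o[atTop] fun n => d n ^ 2 := by
    refine isLittleO_of_nonneg_of_le (fun n => Nat.cast_nonneg _) (fun n => ?_)
      (IsLittleO.fun_sum (s := C) (A := fun c n =>
        (Nat.card H : ℝ) ^ 2 * hs (unitaryOp (ψ n c) - LinearMap.id) ^ 2) fun c hc => ?_)
    · refine (Nat.cast_le.mpr (finrank_orthogonal_fixedSpace_finset_le (ψ n) C)).trans ?_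
      push_cast
      refine Finset.sum_le_sum fun c hc => finrank_orthogonal_fixedSpace_le (ψ n) Nat.card_pos ?_
      obtain ⟨s, -, g, rfl⟩ := (hmemC c).mp hc
      rw [conj_pow, hupow, mul_one, mul_inv_cancel]
    · obtain ⟨s, hs, g, rfl⟩ := (hmemC c).mp hc
      refine IsLittleO.const_mul_left ?_ _
      simp only [hs_conj_sub_id]
      exact (hψu s hs).pow two_pos
  let ψ' : ∀ n, G →* (Y n ≃ₗᵢ[ℂ] Y n) := fun n => trivializeRep (ψ n) (E n) (hE n)
  have hψ' : ∀ g, (fun n => hs ((ι n).toLinearMap ∘ₗ unitaryOp (φ n (HNNExtension.of g)) -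
      unitaryOp (ψ' n g) ∘ₗ (ι n).toLinearMap)) =o[atTop] d := by
    intro g
    refine isLittleO_of_nonneg_of_le (fun n => hs_nonneg _) (fun n => ?_)
      ((hψ g).add ((isLittleO_sqrt (fun n => Nat.cast_nonneg _) hcodim).const_mul_left 2))
    refine (hs_sub_le _ (unitaryOp (ψ n g) ∘ₗ (ι n).toLinearMap) _).trans ?_
    rw [← LinearMap.sub_comp]
    refine add_le_add le_rfl ((hs_comp_le_right _ _ fun x => ((ι n).norm_map x).le).trans ?_)
    exact hs_sub_trivializeRep_le (ψ n) (E n) (hE n) g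
  have hψ'u : ∀ n s, ¬ ubad s → ψ' n (u s) = 1 := fun n s hs =>
    trivializeRep_eq_one fun v hv => hv _ ((hmemC _).mpr ⟨s, hs, 1, by simp⟩)
  -- a finite quotient detecting the remaining elements
  obtain ⟨k, α, hα, hα'⟩ := exists_perm_action_free u ubad fun s hs => by
    -- An element killed by every ψ' n would be asymptotically trivial under φ; Malcev's theorem
    -- then applies to one representation that detects it.
    obtain ⟨n, hn⟩ : ∃ n, ψ' n (u s) ≠ 1 := by
      by_contra! hcon
      exact (hubad s).not.mp (not_not.mpr hs) (isLittleO_of_nonneg_of_le (fun n => hs_nonneg _)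
        (fun n => hs_sub_id_le_of_eq_one (ι n) _ (hcon n)) (hψ' (u s)))
    obtain ⟨N, hN, hN', hsN, hker⟩ := exists_normal_finiteIndex_of_unitary_ne_one (ψ' n) hn
    exact ⟨N, hN, hN', hsN, fun s' hs' => hker _ (hψ'u n s' hs')⟩
  obtain ⟨K, hK⟩ := exists_unitary_correction i₁ i₂ bad α
    (fun h hh => ⟨hα (Sum.inl h) hh, hα (Sum.inr h) hh⟩)
    (fun h hh x => ⟨hα' (Sum.inl h) hh x, hα' (Sum.inr h) hh x⟩)
  have hdef : ∀ h, (fun n => ‖charDefect i₁ i₂ (ψ' n) h‖) =o[atTop] fun n => d n ^ 2 := by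
    intro h
    refine isLittleO_of_nonneg_of_le (fun n => norm_nonneg _)
      (fun n => norm_charDefect_le i₁ i₂ (ψ' n) (ι n) (φ n (HNNExtension.of (i₁ h)))
        (φ n (HNNExtension.of (i₂ h))) (φ n HNNExtension.t) h) (IsLittleO.add ?_
        (IsLittleO.const_mul_left ?_ 2))
    · exact ((isBigO_refl d atTop).mul_isLittleO
        (((hψ' (i₁ h)).add (hrel h)).add (hψ' (i₂ h)))).congr_right fun n => (sq _).symm
    · refine (IsBigO.mul_isLittleO ?_ hδ).congr_right fun n => (sq _).symm
      refine IsBigO.of_pow (n := 2) two_ne_zero ?_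
      -- This gives √(dim Y n) = O(d), as dim Y n exceeds d² only by o(d²).
      have h1 := hdim'.isBigO.add (isBigO_refl (fun n => d n ^ 2) atTop)
      refine h1.congr_left fun n => ?_
      rw [hd2, Pi.pow_apply, Real.sq_sqrt (Nat.cast_nonneg _)]
      ring
  let M : ℕ → ℝ := fun n => ∑ h, ‖charDefect i₁ i₂ (ψ' n) h‖
  have hM : M =o[atTop] fun n => d n ^ 2 := IsLittleO.fun_sum fun h _ => hdef h
  have hcorr := fun n => hK (Y n) (ψ' n) (M n)
    (fun h hh => ⟨hψ'u n (Sum.inl h) hh, hψ'u n (Sum.inr h) hh⟩)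
    (fun h => Finset.single_le_sum (f := fun h => ‖charDefect i₁ i₂ (ψ' n) h‖)
      (fun h _ => norm_nonneg _) (Finset.mem_univ h))
    (Finset.sum_nonneg fun h _ => norm_nonneg _)
  choose c σ hc hσ using hcorr
  let Z : ℕ → Type := fun n => WithLp 2 (Y n × EuclideanSpace ℂ (Fin (c n)))
  let ρ : ∀ n, G →* (Z n ≃ₗᵢ[ℂ] Z n) := fun n => prodRep (ψ' n) (σ n)
  have hρ : ∀ n h, uchar ((ρ n).comp i₂) h = uchar ((ρ n).comp i₁) h := fun n h => by
    have h1 : charDefect i₁ i₂ (ρ n) = 0 := by rw [charDefect_prodRep, hσ, add_neg_cancel]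
    exact (sub_eq_zero.mp (congrFun h1 h)).symm
  let κ : ∀ n, X n →ₗᵢ[ℂ] Z n := fun n => (inlIsometry _ _).comp (ι n)
  have hκρ : ∀ g, (fun n => hs ((κ n).toLinearMap ∘ₗ unitaryOp (φ n (HNNExtension.of g)) -
      unitaryOp (ρ n g) ∘ₗ (κ n).toLinearMap)) =o[atTop] d := by
    intro g
    refine (hψ' g).congr_left fun n => ?_
    rw [← hs_comp_of_isometry _ (inlIsometry (Y n) (EuclideanSpace ℂ (Fin (c n)))).norm_map]
    congr 1
    ext1 x
    change inlIsometry _ _ (ι n (φ n (HNNExtension.of g) x) - ψ' n g (ι n x)) =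
      inlIsometry _ _ (ι n (φ n (HNNExtension.of g) x)) -
        prodRep (ψ' n) (σ n) g (inlIsometry _ _ (ι n x))
    rw [prodRep_inlIsometry, map_sub]
  have hZ : ∀ n, (Module.finrank ℂ (Z n) : ℝ) = Module.finrank ℂ (Y n) + c n := fun n => by
    exact_mod_cast finrank_withLp_prod_euclidean (Y := Y n) (c n)
  have hc0 : (fun n => (c n : ℝ)) =o[atTop] fun n => d n ^ 2 :=
    isLittleO_of_nonneg_of_le (fun n => Nat.cast_nonneg _) hc (hM.const_mul_left K)
  have hXZ : (fun n => (Module.finrank ℂ (Z n) - Module.finrank ℂ (X n) : ℝ)) =o[atTop]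
      fun n => d n ^ 2 := by
    refine (hdim'.add hc0).congr_left fun n => ?_
    rw [hZ]
    ring
  -- The tolerance for the unitary intertwiner may be any positive sequence that is o(d).
  have hε : ∀ n : ℕ, 0 < d n / (n + 1) := fun n => by
    have h1 : 0 < d n := Real.sqrt_pos.mpr (by exact_mod_cast Module.finrank_pos)
    positivity
  choose τ hτ hτ' using fun n => exists_unitary_intertwiner_extending ((ρ n).comp i₁)
    ((ρ n).comp i₂) (hρ n) (κ n) (φ n HNNExtension.t) (fun h => φ n (HNNExtension.of (i₁ h)))
    (fun h => φ n (HNNExtension.of (i₂ h))) (hε n)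
  choose Ψ hΨ hΨt using fun n => exists_hnn_lift (h₁ := h₁) (h₂ := h₂) (ρ n) (τ n) (hτ n)
  refine ⟨Z, fun n => inferInstance, fun n => inferInstance, fun n => inferInstance, κ, Ψ,
    fun a => ?_, ?_⟩
  · rw [tendsto_hsNorm_iff]
    refine isLittleO_of_nonneg_of_le (fun n => hs_nonneg _)
      (fun n => hs_sub_compression_le (κ n) _ _) ?_
    induction a using HNNExtension.induction_on with
    | of g =>
      simp only [hΨ]
      exact hκρ g
    | t =>
      simp only [hΨt]
      refine isLittleO_of_nonneg_of_le (fun n => hs_nonneg _) hτ' (((isLittleO_sqrt (fun n => ?_)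
        hXZ).add ((IsLittleO.fun_sum fun h _ => ((hκρ (i₁ h)).add (hrel h)).add
        (hκρ (i₂ h))).const_mul_left 3)).add ?_)
      · have h1 := hXY0 n
        have h2 : (0 : ℝ) ≤ c n := Nat.cast_nonneg _
        rw [hZ]
        linarith
      · have h1 := (isBigO_refl d atTop).mul_isLittleO
          ((isLittleO_one_iff ℝ).mpr (tendsto_one_div_add_atTop_nhds_zero_nat (𝕜 := ℝ)))
        refine (h1.congr_left fun n => ?_).congr_right fun n => mul_one _
        rw [mul_one_div]
    | mul a b ha hb =>
      exact isLittleO_of_nonneg_of_le (fun n => hs_nonneg _)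
        (fun n => hs_intertwine_mul_le (κ n) (φ n) (Ψ n) a b) ((hφ a b).add (ha.add hb))
    | inv a ha =>
      exact isLittleO_of_nonneg_of_le (fun n => hs_nonneg _)
        (fun n => hs_intertwine_inv_le (κ n) (φ n) (Ψ n) a)
        (ha.add ((hφ a a⁻¹).add (hφ 1 1)))
  · rw [tendsto_div_one_iff_sub_isLittleO hX0]
    simpa only [hd2] using hXZ

end HSMain

theorem mainTheorem7 {G H : Type*} [Group G] [Group.FG G] [Group H] [Finite H]
    (i₁ i₂ : H →* G) (h₁ : Function.Injective i₁) (h₂ : Function.Injective i₂)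
    (hn₁ : IsAlmostNormal i₁.range) (hn₂ : IsAlmostNormal i₂.range) :
    (FlexiblyHSStable G → FlexiblyHSStable (HNNOfEmbeddings i₁ i₂ h₁ h₂)) ∧
    (FlexiblyPStable G → FlexiblyPStable (HNNOfEmbeddings i₁ i₂ h₁ h₂)) :=
  ⟨flexiblyHSStable_hnn i₁ i₂ h₁ h₂ hn₁ hn₂, flexiblyPStable_hnn i₁ i₂ h₁ h₂ hn₁ hn₂⟩
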